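/- Let $A\to M$ be a Lie algebroid over a smooth (Hausdorff) manifold $M$, with anchor $\rho$ and bracket $[\cdot,\cdot]$, and let $k$ be an integer with $1\le k\le \operatorname{rank}A$. Write $[\cdot,\cdot]$ also for the Schouten bracket on $\Gamma(\wedge^\bullet A)$, i.e. the unique graded skew-symmetric biderivation of degree $-1$ (so $[P,Q]=-(-1)^{(|P|-1)(|Q|-1)}[Q,P]$ and $[P,Q\wedge R]=[P,Q]\wedge R+(-1)^{(|P|-1)|Q|}Q\wedge[P,R]$) that extends the bracket of $\Gamma(A)$ and satisfies $[u,f]=\rho(u)f$, $[f,g]=0$ for $u\in\Gamma(A)$, $f,g\in C^\infty(M)$; it exists and is unique. A *$k$-differential* is an $\mathbb R$-linear map $\delta:\Gamma(\wedge^\bullet A)\to\Gamma(\wedge^{\bullet+k-1}A)$ with $\delta(P\wedge Q)=\delta P\wedge Q+(-1)^{(k-1)|P|}P\wedge\delta Q$ and $\delta[P,Q]=[\delta P,Q]+(-1)^{(k-1)(|P|-1)}[P,\delta Q]$. Let $\delta^{(0)}:\Gamma(A)\to\Gamma(\wedge^kA)$ and $\delta^{(1)}:C^\infty(M)\to\Gamma(\wedge^{k-1}A)$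 be its restrictions. Let $\mathfrak JA$ be the first jet bundle of $A$, so that $\Gamma(\mathfrak JA)=\jmath^1\Gamma(A)\oplus\Gamma(\mathfrak h)$ with $\mathfrak h=T^*M\otimes A=\mathrm{Hom}(TM,A)$ and $\jmath^1(fu)=df\otimes u+f\jmath^1u$. It is a Lie algebroid with bracket $$[\jmath^1u+H,\jmath^1v+K]=\jmath^1[u,v]+L_uK-L_vH+K\rho H-H\rho K,\qquad (L_uK)(X)=[u,K(X)]-K([\rho u,X]),$$ and it acts on $\wedge^kA$ by the adjoint action: $\mathrm{ad}_{\jmath^1u}w=[u,w]$, and $\mathrm{ad}_H$ is the derivation of $\wedge^\bullet A$ extending $v\mapsto-H(\rho v)$ (so $\mathrm{ad}_{df\otimes u}w=-[w,f]\wedge u$). Put $(d_{\mathfrak JA}\tau)(\xi)=\mathrm{ad}_\xi\tau$ for $\tau\in\Gamma(\wedge^kA)$. A *$k$-characteristic pair* is a pair $(\chi,\pi)$, where $\chi:\mathfrak JA\to\wedge^kA$ is a vector bundle morphism with $\chi([\xi,\eta])=\mathrm{ad}_\xi\chi(\eta)-\mathrm{ad}_\eta\chi(\xi)$ for all $\xi,\eta\in\Gamma(\mathfrak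 JA)$ (a $1$-cocycle), and $\pi\in\Gamma(TM\otimes\wedge^{k-1}A)$ is $\rho$-compatible, i.e. $\iota_{\rho^*\xi}\iota_\eta\pi=-\iota_{\rho^*\eta}\iota_\xi\pi$ for all $\xi,\eta\in\Omega^1(M)$ (where $\iota_\xi(X\otimes w)=\xi(X)w$), and the restriction of $\chi$ to $\mathfrak h$ is $\mu_\pi$, where $\mu_\pi(H)=(H\otimes\mathrm{id})\pi$, i.e. $\mu_\pi(\xi\otimes u)=(-1)^{k-1}(\iota_\xi\pi)\wedge u$. **Proposition.** There is a one-to-one correspondence between $k$-differentials $\delta$ and $k$-characteristic pairs $(\chi,\pi)$ on $A$, in which $\delta$ corresponds to $(\chi,\pi)$ if and only if $$\delta^{(0)}u=\chi(\jmath^1u)\quad(u\in\Gamma(A)),\qquad \delta^{(1)}f=(-1)^{k-1}\iota_{df}\pi\quad(f\in C^\infty(M)).$$ Moreover, for every $\tau\in\Gamma(\wedge^kA)$ the operator $\delta=[\tau,\cdot]$ is a $k$-differential, and it corresponds to the characteristic pair $(\chi,\pi)$ with $\chi=-d_{\mathfrak JA}\tau$ and $\pi=D_\rho\tau$. Here $D_\rho$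 is the derivation of $\wedge^\bullet(TM\oplus A)$ of degree $0$ with $D_\rho(X,u)=(\rho(u),0)$, and $TM\otimes\wedge^{k-1}A\subset\wedge^k(TM\oplus A)$ through $X\otimes w\mapsto X\wedge w$. -/

import Mathlib

open Bundle Module
open scoped Manifold ContDiff Topology

noncomputable section

namespace LieAlgd

section Sections

variable {E : Type*} [NormedAddCommGroup E] [NormedSpace ℝ E]
  {M : Type*} [TopologicalSpace M] [ChartedSpace E M]

/-- The algebra `C^∞(M)` of smooth functions. -/
abbrev Fn (E : Type*) [NormedAddCommGroup E] [NormedSpace ℝ E]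
    (M : Type*) [TopologicalSpace M] [ChartedSpace E M] : Type _ :=
  C^∞⟮𝓘(ℝ, E), M; 𝓘(ℝ, ℝ), ℝ⟯

/-- The space `Γ(V)` of global smooth sections of a vector bundle `V` over `M`. -/
abbrev Sec (E : Type*) [NormedAddCommGroup E] [NormedSpace ℝ E]
    {M : Type*} [TopologicalSpace M] [ChartedSpace E M]
    (F : Type*) [NormedAddCommGroup F] [NormedSpace ℝ F]
    (V : M → Type*) [TopologicalSpace (TotalSpace F V)] [∀ x, TopologicalSpace (V x)]
    [FiberBundle F V] : Type _ :=
  Cₛ^∞⟮𝓘(ℝ, E); F, V⟯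

/-- The space `𝔛(M) = Γ(TM)` of smooth vector fields. -/
abbrev Vect (E : Type*) [NormedAddCommGroup E] [NormedSpace ℝ E]
    (M : Type*) [TopologicalSpace M] [ChartedSpace E M] [IsManifold 𝓘(ℝ, E) ∞ M] : Type _ :=
  Sec E E (fun x : M => TangentSpace 𝓘(ℝ, E) x)

variable {F : Type*} [NormedAddCommGroup F] [NormedSpace ℝ F]
  {V : M → Type*} [TopologicalSpace (TotalSpace F V)]
  [∀ x, AddCommGroup (V x)] [∀ x, Module ℝ (V x)] [∀ x, TopologicalSpace (V x)]
  [FiberBundle F V] [VectorBundle ℝ F V]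

/-- `Γ(V)` as a module over `C^∞(M)`, with pointwise multiplication. -/
instance secModule : Module (Fn E M) (Sec E F V) where
  smul f s := ⟨fun x => f x • s x, f.contMDiff.smul_section s.contMDiff⟩
  one_smul s := by ext x; exact one_smul ℝ (s x)
  mul_smul f g s := by ext x; exact mul_smul (f x) (g x) (s x)
  smul_zero f := by ext x; exact smul_zero (f x)
  smul_add f s t := by ext x; exact smul_add (f x) (s x) (t x)
  add_smul f g s := by ext x; exact add_smul (f x) (g x) (s x)
  zero_smul s := by ext x; exact zero_smul ℝ (s x)

@[simp] theorem sec_smul_apply (f : Fn E M) (s : Sec E F V) (x : M) :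
    (f • s) x = f x • s x := rfl

section Pointwise

/-! A `C^∞(M)`-linear map `T : Γ(V) → Γ(W)` is the same thing as a smooth vector bundle morphism
`V → W` over the identity, i.e. as a smooth section of `Hom(V, W)`. Its value at a point `x` is
`fiber T x : V x → W x`, characterized by `fiber_apply`. -/

variable [FiniteDimensional ℝ E] [IsManifold 𝓘(ℝ, E) ∞ M] [T2Space M]
  [ContMDiffVectorBundle ∞ F V 𝓘(ℝ, E)]

/-- A smooth bump function at `x` supported in a given open neighbourhood of `x`. -/
theorem exists_bump (x : M) {u : Set M} (hu : IsOpen u) (hx : x ∈ u) :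
    ∃ ψ : Fn E M, ψ x = 1 ∧ tsupport ψ ⊆ u := by
  obtain ⟨ψ, hψ, -⟩ := (SmoothBumpFunction.nhds_basis_support (I := 𝓘(ℝ, E))
    (hu.mem_nhds hx)).mem_iff.1 Filter.univ_mem
  exact ⟨⟨ψ, ψ.contMDiff⟩, ψ.eq_one, hψ⟩

/-- Every vector of a fibre is the value of a global smooth section. -/
theorem exists_sec (x : M) (v : V x) : ∃ s : Sec E F V, s x = v := by
  let t := trivializationAt F V x
  have hx : x ∈ t.baseSet := FiberBundle.mem_baseSet_trivializationAt F V x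
  obtain ⟨ψ, hψ1, hψ⟩ := exists_bump (E := E) x t.open_baseSet hx
  have h : ContMDiffOn 𝓘(ℝ, E) (𝓘(ℝ, E).prod 𝓘(ℝ, F)) ∞
      (fun y => TotalSpace.mk' F y (FiberBundle.extend F v y)) t.baseSet :=
    t.contMDiffOn_section_baseSet_iff.2 (by
      refine ContMDiffOn.congr (f := fun _ => (t ⟨x, v⟩).2) contMDiffOn_const ?_
      intro y hy
      simp [FiberBundle.extend, t, t.apply_mk_symm hy])
  refine ⟨⟨_, ContMDiffOn.smul_section_of_tsupport ψ.contMDiff.contMDiffOn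
    t.open_baseSet hψ h⟩, ?_⟩
  simp [hψ1]

/-- Hadamard-type decomposition of a section vanishing at a point. -/
theorem exists_decomp [FiniteDimensional ℝ F] (s : Sec E F V) (x : M) (hs : s x = 0) :
    ∃ (ψ : Fn E M) (n : ℕ) (c : Fin n → Fn E M) (e : Fin n → Sec E F V),
      ψ x = 0 ∧ (∀ i, c i x = 0) ∧ s = ψ • s + ∑ i, c i • e i := by
  let t := trivializationAt F V x
  have hx : x ∈ t.baseSet := FiberBundle.mem_baseSet_trivializationAt F V x
  obtain ⟨ψ, hψ1, hψ⟩ := exists_bump (E := E) x t.open_baseSet hx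
  let b := Module.finBasis ℝ F
  let e : Fin (finrank ℝ F) → Sec E F V := fun i =>
    ⟨_, ContMDiffOn.smul_section_of_tsupport ψ.contMDiff.contMDiffOn t.open_baseSet hψ
      (t.contMDiffOn_localFrame_baseSet (I := 𝓘(ℝ, E)) ∞ b i)⟩
  have hc (i) := contMDiffOn_baseSet_localFrameCoeff b (e := t) s.contMDiff.contMDiffOn i
  let c : Fin (finrank ℝ F) → Fn E M := fun i =>
    ⟨fun y => ψ y * t.localFrameCoeff 𝓘(ℝ, E) b i y (s y), by
      refine contMDiff_of_tsupport fun y hy => ?_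
      have hy' : y ∈ t.baseSet := hψ (tsupport_mul_subset_left hy)
      exact ψ.contMDiff.contMDiffAt.mul
        ((hc i y hy').contMDiffAt (t.open_baseSet.mem_nhds hy'))⟩
  refine ⟨1 - ψ * ψ, _, c, e, by simp [hψ1], fun i => by simp [c, hs], ?_⟩
  ext y
  rw [ContMDiffSection.coe_add, Pi.add_apply, sec_smul_apply]
  have hsum : (∑ i, c i • e i : Sec E F V) y = ∑ i, c i y • e i y := by
    rw [← ContMDiffSection.coeAddHom_apply, map_sum, Finset.sum_apply]
    rfl
  rw [hsum]
  by_cases hy : y ∈ t.baseSet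
  · have h1 : ∑ i, c i y • e i y = (ψ y * ψ y) • s y := by
      conv_rhs => rw [Trivialization.eq_sum_localFrameCoeff_smul (I := 𝓘(ℝ, E)) (e := t) (b := b) hy (s := fun z => s z)]
      rw [Finset.smul_sum]
      refine Finset.sum_congr rfl fun i _ => ?_
      have h2 : c i y • e i y = (ψ y * t.localFrameCoeff 𝓘(ℝ, E) b i y (s y)) •
          (ψ y • t.localFrame b i y) := rfl
      rw [h2, smul_smul, smul_smul]
      congr 1
      ring
    rw [h1, ← add_smul]
    have : ((1 - ψ * ψ : Fn E M) y) + ψ y * ψ y = 1 := by simp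
    rw [this, one_smul]
  · have h0 : ψ y = 0 := image_eq_zero_of_notMem_tsupport fun h => hy (hψ h)
    have h1 : ∑ i, c i y • e i y = 0 := Finset.sum_eq_zero fun i _ => by
      have : c i y = 0 := by simp [c, h0]
      rw [this, zero_smul]
    have : (1 - ψ * ψ : Fn E M) y = 1 := by simp [h0]
    rw [h1, this, one_smul, add_zero]

variable {F' : Type*} [NormedAddCommGroup F'] [NormedSpace ℝ F']
  {W : M → Type*} [TopologicalSpace (TotalSpace F' W)]
  [∀ x, AddCommGroup (W x)] [∀ x, Module ℝ (W x)] [∀ x, TopologicalSpace (W x)]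
  [FiberBundle F' W] [VectorBundle ℝ F' W]

/-- The value of `T s` at `x` depends only on the value of `s` at `x`. -/
theorem tensorial [FiniteDimensional ℝ F] (T : Sec E F V →ₗ[Fn E M] Sec E F' W) {s s' : Sec E F V} {x : M}
    (h : s x = s' x) : T s x = T s' x := by
  obtain ⟨ψ, n, c, e, hψ, hc, hs⟩ := exists_decomp (s - s') x (by simp [h])
  have h0 : T (s - s') x = 0 := by
    rw [hs, map_add, map_smul, map_sum, ContMDiffSection.coe_add, Pi.add_apply, sec_smul_apply, hψ,
      zero_smul, zero_add, ← ContMDiffSection.coeAddHom_apply, map_sum, Finset.sum_apply]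
    refine Finset.sum_eq_zero fun i _ => ?_
    rw [map_smul, ContMDiffSection.coeAddHom_apply, sec_smul_apply, hc, zero_smul]
  rw [map_sub, ContMDiffSection.coe_sub, Pi.sub_apply, sub_eq_zero] at h0
  exact h0

/-- The value `V x → W x` at the point `x` of the bundle morphism given by a `C^∞(M)`-linear map
of sections: a vector is extended to a section, to which the map is applied. -/
def fiber [FiniteDimensional ℝ F] (T : Sec E F V →ₗ[Fn E M] Sec E F' W) (x : M) : V x →ₗ[ℝ] W x where
  toFun v := T (exists_sec (E := E) (F := F) x v).choose x
  map_add' v w := by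
    rw [← Pi.add_apply, ← ContMDiffSection.coe_add, ← map_add]
    refine tensorial T ?_
    rw [ContMDiffSection.coe_add, Pi.add_apply]
    simp only [(exists_sec (E := E) (F := F) x _).choose_spec]
  map_smul' a v := by
    let a' : Fn E M := ⟨fun _ => a, contMDiff_const⟩
    have : T (a' • (exists_sec (E := E) (F := F) x v).choose) x = a • T (exists_sec (E := E) (F := F) x v).choose x := by
      rw [map_smul]; rfl
    rw [RingHom.id_apply, ← this]
    refine tensorial T ?_
    rw [sec_smul_apply]
    simp only [(exists_sec (E := E) (F := F) x _).choose_spec]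
    rfl

theorem fiber_apply [FiniteDimensional ℝ F] (T : Sec E F V →ₗ[Fn E M] Sec E F' W) (s : Sec E F V) (x : M) :
    fiber T x (s x) = T s x :=
  tensorial T (exists_sec (E := E) (F := F) x (s x)).choose_spec

end Pointwise

section VectorFields
variable [IsManifold 𝓘(ℝ, E) ∞ M]

/-- The Lie bracket `[X, Y]` of vector fields. -/
def vbr [FiniteDimensional ℝ E] (X Y : Vect E M) : Vect E M :=
  ⟨VectorField.mlieBracket 𝓘(ℝ, E) X Y, by
    have : CompleteSpace E := FiniteDimensional.complete ℝ E
    have : IsManifold 𝓘(ℝ, E) (minSmoothness ℝ 2) M := by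
      rw [minSmoothness_of_isRCLikeNormedField]; infer_instance
    have : IsManifold 𝓘(ℝ, E) (((⊤ : ℕ∞) : WithTop ℕ∞) + 1) M := by
      simpa using ‹IsManifold 𝓘(ℝ, E) ∞ M›
    exact ContDiff.mlieBracket_vectorField (n := ⊤) (m := ⊤) X.contMDiff Y.contMDiff (by simp)⟩

/-- The derivative `X(f)` of a function along a vector field. -/
def der (X : Vect E M) (f : Fn E M) : Fn E M :=
  ⟨fun x => mvfderiv 𝓘(ℝ, E) f x (X x), by
    have h : ContMDiff 𝓘(ℝ, E) 𝓘(ℝ, ℝ).tangent ∞ (fun x => tangentMap 𝓘(ℝ, E) 𝓘(ℝ, ℝ) f ⟨x, X x⟩) :=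
      (f.contMDiff.contMDiff_tangentMap (m := ∞) (by simp)).comp X.contMDiff
    exact (contMDiff_snd_tangentBundle_modelSpace ℝ 𝓘(ℝ, ℝ)).comp h⟩


theorem vbr_add [FiniteDimensional ℝ E] (X Y Z : Vect E M) : vbr X (Y + Z) = vbr X Y + vbr X Z := by
  ext x
  exact VectorField.mlieBracket_add_right Y.mdifferentiableAt Z.mdifferentiableAt

theorem vbr_smul [FiniteDimensional ℝ E] (X : Vect E M) (f : Fn E M) (Y : Vect E M) :
    vbr X (f • Y) = f • vbr X Y + der X f • Y := by
  ext x
  rw [add_comm]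
  exact VectorField.mlieBracket_smul_right f.mdifferentiableAt Y.mdifferentiableAt

theorem der_add_left (X Y : Vect E M) (f : Fn E M) : der (X + Y) f = der X f + der Y f := by
  ext x
  exact map_add (mvfderiv 𝓘(ℝ, E) f x) (X x) (Y x)

theorem der_smul_left (g : Fn E M) (X : Vect E M) (f : Fn E M) : der (g • X) f = g * der X f := by
  ext x
  exact map_smul (mvfderiv 𝓘(ℝ, E) f x) (g x) (X x)

theorem der_add (X : Vect E M) (f g : Fn E M) : der X (f + g) = der X f + der X g := by
  ext x
  exact congrArg (· (X x)) (mvfderiv_add f.mdifferentiableAt g.mdifferentiableAt)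

theorem der_mul (X : Vect E M) (f g : Fn E M) : der X (f * g) = f * der X g + g * der X f := by
  ext x
  exact congrArg (· (X x)) (mvfderiv_mul f.mdifferentiableAt g.mdifferentiableAt)

theorem der_one (X : Vect E M) : der X 1 = 0 := by
  have := der_mul X 1 1
  simpa using this

theorem der_zero (X : Vect E M) : der X 0 = 0 := by
  have := der_add X 0 0
  simpa using this

end VectorFields

section OneForms

variable [IsManifold 𝓘(ℝ, E) ∞ M]

/-- The section `df ⊗ u` of `T*M ⊗ V = Hom(TM, V)`, i.e. `X ↦ X(f) u`. -/
def dTensor (f : Fn E M) (u : Sec E F V) : Vect E M →ₗ[Fn E M] Sec E F V where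
  toFun X := der X f • u
  map_add' X Y := by rw [der_add_left, add_smul]
  map_smul' g X := by rw [der_smul_left, mul_smul, RingHom.id_apply]

@[simp] theorem dTensor_apply (f : Fn E M) (u : Sec E F V) (X : Vect E M) :
    dTensor f u X = der X f • u := rfl

end OneForms

end Sections

section Exterior

/-! Linear algebra in exterior algebras. -/

variable {V : Type*} [AddCommGroup V] [Module ℝ V]

/-- The algebra morphism `∧V → ∧V[ε]`, `v ↦ v + ε T v`. -/
def extDerAux (T : V →ₗ[ℝ] V) : ExteriorAlgebra ℝ V →ₐ[ℝ] DualNumber (ExteriorAlgebra ℝ V) :=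
  ExteriorAlgebra.lift ℝ
    ⟨(TrivSqZeroExt.inlAlgHom ℝ (ExteriorAlgebra ℝ V) (ExteriorAlgebra ℝ V)).toLinearMap ∘ₗ
        ExteriorAlgebra.ι ℝ +
      (TrivSqZeroExt.inrHom (ExteriorAlgebra ℝ V) (ExteriorAlgebra ℝ V)).restrictScalars ℝ ∘ₗ
        ExteriorAlgebra.ι ℝ ∘ₗ T, fun v => by
      ext
      · simp
      · simp⟩

/-- The degree `0` derivation of `∧V` extending an endomorphism `T` of `V`:
`v₁ ∧ ⋯ ∧ vₚ ↦ ∑ᵢ v₁ ∧ ⋯ ∧ T vᵢ ∧ ⋯ ∧ vₚ`. -/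
def extDer (T : V →ₗ[ℝ] V) : ExteriorAlgebra ℝ V →ₗ[ℝ] ExteriorAlgebra ℝ V :=
  (TrivSqZeroExt.sndHom (ExteriorAlgebra ℝ V) (ExteriorAlgebra ℝ V)).restrictScalars ℝ ∘ₗ
    (extDerAux T).toLinearMap

theorem fst_extDerAux (T : V →ₗ[ℝ] V) (a : ExteriorAlgebra ℝ V) : (extDerAux T a).fst = a := by
  have : (TrivSqZeroExt.fstHom ℝ (ExteriorAlgebra ℝ V) (ExteriorAlgebra ℝ V)).comp (extDerAux T) =
      AlgHom.id ℝ _ := by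
    ext v
    simp [extDerAux]
  exact congrArg (fun g => g a) this

@[simp] theorem extDer_ι (T : V →ₗ[ℝ] V) (v : V) :
    extDer T (ExteriorAlgebra.ι ℝ v) = ExteriorAlgebra.ι ℝ (T v) := by
  simp [extDer, extDerAux]

@[simp] theorem extDer_mul (T : V →ₗ[ℝ] V) (a b : ExteriorAlgebra ℝ V) :
    extDer T (a * b) = extDer T a * b + a * extDer T b := by
  simp [extDer, fst_extDerAux, add_comm]

variable {W : Type*} [AddCommGroup W] [Module ℝ W]

/-- The contraction `ι_ξ (X ⊗ w) = ξ(X) w` of `W ⊗ ∧ʲV` with a covector `ξ` of `W`. -/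
def contract (ξ : W →ₗ[ℝ] ℝ) (j : ℕ) : TensorProduct ℝ W (⋀[ℝ]^j V) →ₗ[ℝ] ExteriorAlgebra ℝ V :=
  (TensorProduct.lid ℝ (ExteriorAlgebra ℝ V)).toLinearMap ∘ₗ
    TensorProduct.map ξ (⋀[ℝ]^j V).subtype

/-- The map `(H ⊗ id) (X ⊗ w) = H X ∧ w` from `W ⊗ ∧ʲV` to `∧V` given by `H : W → V`. -/
def homWedge (H : W →ₗ[ℝ] V) (j : ℕ) : TensorProduct ℝ W (⋀[ℝ]^j V) →ₗ[ℝ] ExteriorAlgebra ℝ V :=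
  LinearMap.mul' ℝ (ExteriorAlgebra ℝ V) ∘ₗ
    TensorProduct.map (ExteriorAlgebra.ι ℝ ∘ₗ H) (⋀[ℝ]^j V).subtype

/-- The inclusion `X ⊗ w ↦ X ∧ w` of `W ⊗ ∧ʲV` into `∧(W ⊕ V)`. -/
def mixedIncl (W V : Type*) [AddCommGroup V] [Module ℝ V] [AddCommGroup W] [Module ℝ W] (j : ℕ) :
    TensorProduct ℝ W (⋀[ℝ]^j V) →ₗ[ℝ] ExteriorAlgebra ℝ (W × V) :=
  LinearMap.mul' ℝ (ExteriorAlgebra ℝ (W × V)) ∘ₗ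
    TensorProduct.map (ExteriorAlgebra.ι ℝ ∘ₗ LinearMap.inl ℝ W V)
      ((ExteriorAlgebra.map (LinearMap.inr ℝ W V)).toLinearMap ∘ₗ (⋀[ℝ]^j V).subtype)

/-- The derivation `D_ρ` of `∧(W ⊕ V)` extending `(X, u) ↦ (ρ u, 0)`, for `ρ : V → W`. -/
def dRho (ρ : V →ₗ[ℝ] W) : ExteriorAlgebra ℝ (W × V) →ₗ[ℝ] ExteriorAlgebra ℝ (W × V) :=
  extDer (LinearMap.inl ℝ W V ∘ₗ ρ ∘ₗ LinearMap.snd ℝ W V)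

end Exterior

section Multisections

variable {E : Type*} [NormedAddCommGroup E] [NormedSpace ℝ E]
  {M : Type*} [TopologicalSpace M] [ChartedSpace E M]
  {F : Type*} [NormedAddCommGroup F] [NormedSpace ℝ F] [FiniteDimensional ℝ F]
  {A : M → Type*} [TopologicalSpace (TotalSpace F A)]
  [∀ x, AddCommGroup (A x)] [∀ x, Module ℝ (A x)] [∀ x, TopologicalSpace (A x)]
  [FiberBundle F A] [VectorBundle ℝ F A]

/-- Smoothness of a section of the bundle `∧A` of exterior algebras: in the local trivializations
of `∧A` induced by those of `A`, all components are smooth. -/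
def SmoothMulti (E F : Type*) [NormedAddCommGroup E] [NormedSpace ℝ E]
    {M : Type*} [TopologicalSpace M] [ChartedSpace E M]
    [NormedAddCommGroup F] [NormedSpace ℝ F]
    {A : M → Type*} [TopologicalSpace (TotalSpace F A)]
    [∀ x, AddCommGroup (A x)] [∀ x, Module ℝ (A x)] [∀ x, TopologicalSpace (A x)]
    [FiberBundle F A] [VectorBundle ℝ F A] (P : Π x, ExteriorAlgebra ℝ (A x)) : Prop :=
  ∀ (x₀ : M) (φ : ExteriorAlgebra ℝ F →ₗ[ℝ] ℝ), ContMDiffAt 𝓘(ℝ, E) 𝓘(ℝ, ℝ) ∞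
    (fun x => φ (ExteriorAlgebra.map ((trivializationAt F A x₀).linearMapAt ℝ x) (P x))) x₀

instance finite_exteriorAlgebra : Module.Finite ℝ (ExteriorAlgebra ℝ F) := by
  have h0 : ∀ i, finrank ℝ F < i → ⋀[ℝ]^i F = ⊥ := fun i hi => by
    rw [← Submodule.finrank_eq_zero (R := ℝ), exteriorPower.finrank_eq, Nat.choose_eq_zero_of_lt hi]
  have h1 : ⨆ i, ⋀[ℝ]^i F = ⊤ :=
    (DirectSum.Decomposition.isInternal fun i => ⋀[ℝ]^i F).submodule_iSup_eq_top
  have h2 : (⊤ : Submodule ℝ (ExteriorAlgebra ℝ F)) =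
      ⨆ i ∈ Finset.range (finrank ℝ F + 1), ⋀[ℝ]^i F := by
    rw [← h1]
    refine le_antisymm (iSup_le fun i => ?_) (iSup₂_le fun i _ => le_iSup (fun i => ⋀[ℝ]^i F) i)
    by_cases hi : i ∈ Finset.range (finrank ℝ F + 1)
    · exact le_iSup₂ (f := fun i _ => ⋀[ℝ]^i F) i hi
    · rw [h0 i (by simpa using hi)]
      exact bot_le
  refine ⟨?_⟩
  rw [h2]
  exact Submodule.fg_biSup _ _ fun i _ => Module.Finite.iff_fg.1 inferInstance

/-- The algebra `Γ(∧A)` of smooth multisections of `A`, with the wedge product as (pointwise)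
multiplication. -/
def Multi (E F : Type*) [NormedAddCommGroup E] [NormedSpace ℝ E]
    {M : Type*} [TopologicalSpace M] [ChartedSpace E M]
    [NormedAddCommGroup F] [NormedSpace ℝ F] [FiniteDimensional ℝ F]
    (A : M → Type*) [TopologicalSpace (TotalSpace F A)]
    [∀ x, AddCommGroup (A x)] [∀ x, Module ℝ (A x)] [∀ x, TopologicalSpace (A x)]
    [FiberBundle F A] [VectorBundle ℝ F A] : Subalgebra ℝ (Π x, ExteriorAlgebra ℝ (A x)) where
  carrier := {P | SmoothMulti E F P}
  mul_mem' {P Q} hP hQ x₀ φ := by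
    let b := Module.finBasis ℝ (ExteriorAlgebra ℝ F)
    have key : ∀ p q : ExteriorAlgebra ℝ F,
        φ (p * q) = ∑ i, ∑ j, b.coord i p * b.coord j q * φ (b i * b j) := by
      intro p q
      conv_lhs => rw [← b.sum_repr p, ← b.sum_repr q]
      simp only [Finset.sum_mul_sum, map_sum, smul_mul_smul_comm, map_smul, smul_eq_mul,
        Basis.coord_apply]
    have h : (fun x => φ (ExteriorAlgebra.map ((trivializationAt F A x₀).linearMapAt ℝ x)
        ((P * Q) x))) = fun x => ∑ i, ∑ j,
          b.coord i (ExteriorAlgebra.map ((trivializationAt F A x₀).linearMapAt ℝ x) (P x)) *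
          b.coord j (ExteriorAlgebra.map ((trivializationAt F A x₀).linearMapAt ℝ x) (Q x)) *
          φ (b i * b j) := by
      funext x
      rw [Pi.mul_apply, map_mul, key]
    rw [h]
    exact contMDiffAt_finsetSum fun i _ => contMDiffAt_finsetSum fun j _ =>
      ((hP x₀ (b.coord i)).mul (hQ x₀ (b.coord j))).mul contMDiffAt_const
  add_mem' {P Q} hP hQ x₀ φ := by
    simp only [Pi.add_apply, map_add]
    exact (hP x₀ φ).add (hQ x₀ φ)
  algebraMap_mem' r x₀ φ := by
    simp only [Pi.algebraMap_apply, AlgHom.commutes]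
    exact contMDiffAt_const

/-- Functions as multisections of degree `0`. -/
def ofFn : Fn E M →+* Multi E F A where
  toFun f := ⟨fun x => algebraMap ℝ _ (f x), fun x₀ φ => by
    simp only [AlgHom.commutes]
    simp only [Algebra.algebraMap_eq_smul_one, map_smul, smul_eq_mul]
    exact f.contMDiff.contMDiffAt.mul contMDiffAt_const⟩
  map_one' := by ext x; simp
  map_mul' f g := by ext x; simp
  map_zero' := by ext x; simp
  map_add' f g := by ext x; simp

/-- `Γ(∧A)` as an algebra over `C^∞(M)`. -/
instance multiAlgebra : Algebra (Fn E M) (Multi E F A) :=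
  (ofFn (E := E) (F := F) (A := A)).toAlgebra' fun f P => by
    ext x
    exact Algebra.commutes (f x) (P.1 x)

/-- Sections of `A` as multisections of degree `1`. -/
def ofSec : Sec E F A →ₗ[Fn E M] Multi E F A where
  toFun u := ⟨fun x => ExteriorAlgebra.ι ℝ (u x), fun x₀ φ => by
    have h := (Bundle.contMDiffAt_section x₀).1 (u.contMDiff x₀)
    have h2 : ContMDiffAt 𝓘(ℝ, E) 𝓘(ℝ, ℝ) ∞
        (fun x => (φ ∘ₗ ExteriorAlgebra.ι ℝ).toContinuousLinearMap
          (trivializationAt F A x₀ ⟨x, u x⟩).2) x₀ :=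
      (ContinuousLinearMap.contMDiff _).contMDiffAt.comp x₀ h
    refine h2.congr_of_eventuallyEq ?_
    filter_upwards [(trivializationAt F A x₀).open_baseSet.mem_nhds
      (FiberBundle.mem_baseSet_trivializationAt F A x₀)] with x hx
    simp [Trivialization.linearMapAt_apply, hx]⟩
  map_add' u v := by ext x; simp
  map_smul' f u := by
    ext x
    change ExteriorAlgebra.ι ℝ (f x • u x) = algebraMap ℝ _ (f x) * ExteriorAlgebra.ι ℝ (u x)
    rw [map_smul, Algebra.smul_def]

/-- `P ∈ Γ(∧ᵖA)`. -/
def IsHomog (p : ℕ) (P : Multi E F A) : Prop := ∀ x, P.1 x ∈ ⋀[ℝ]^p (A x)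

end Multisections

section Mixed

variable {E : Type*} [NormedAddCommGroup E] [NormedSpace ℝ E]
  {M : Type*} [TopologicalSpace M] [ChartedSpace E M] [IsManifold 𝓘(ℝ, E) ∞ M]
  {F : Type*} [NormedAddCommGroup F] [NormedSpace ℝ F]
  {A : M → Type*} [TopologicalSpace (TotalSpace F A)]
  [∀ x, AddCommGroup (A x)] [∀ x, Module ℝ (A x)] [∀ x, TopologicalSpace (A x)]
  [FiberBundle F A] [VectorBundle ℝ F A]

/-- Smooth sections of `TM ⊗ ∧ʲA`: in the local trivializations induced by those of `TM` and `A`,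
all components are smooth. -/
structure Mixed (E F : Type*) [NormedAddCommGroup E] [NormedSpace ℝ E]
    {M : Type*} [TopologicalSpace M] [ChartedSpace E M] [IsManifold 𝓘(ℝ, E) ∞ M]
    [NormedAddCommGroup F] [NormedSpace ℝ F]
    (A : M → Type*) [TopologicalSpace (TotalSpace F A)]
    [∀ x, AddCommGroup (A x)] [∀ x, Module ℝ (A x)] [∀ x, TopologicalSpace (A x)]
    [FiberBundle F A] [VectorBundle ℝ F A] (j : ℕ) where
  /-- the value at a point -/
  toFun : Π x : M, TensorProduct ℝ (TangentSpace 𝓘(ℝ, E) x) (⋀[ℝ]^j (A x))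
  smooth : ∀ (x₀ : M) (φ : TensorProduct ℝ E (⋀[ℝ]^j F) →ₗ[ℝ] ℝ),
    ContMDiffAt 𝓘(ℝ, E) 𝓘(ℝ, ℝ) ∞ (fun x => φ (TensorProduct.map
      ((trivializationAt E (fun x : M => TangentSpace 𝓘(ℝ, E) x) x₀).linearMapAt ℝ x)
      (exteriorPower.map j ((trivializationAt F A x₀).linearMapAt ℝ x)) (toFun x))) x₀

end Mixed

/-- A Lie algebroid structure on the smooth vector bundle `A` over `M`. The anchor is a bundle
morphism `A → TM`, the bracket is an operation on global smooth sections. -/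
structure LieAlgebroid (E F : Type*) [NormedAddCommGroup E] [NormedSpace ℝ E]
    [FiniteDimensional ℝ E]
    {M : Type*} [TopologicalSpace M] [ChartedSpace E M] [IsManifold 𝓘(ℝ, E) ∞ M]
    [NormedAddCommGroup F] [NormedSpace ℝ F]
    (A : M → Type*) [TopologicalSpace (TotalSpace F A)]
    [∀ x, AddCommGroup (A x)] [∀ x, Module ℝ (A x)] [∀ x, TopologicalSpace (A x)]
    [FiberBundle F A] [VectorBundle ℝ F A] where
  /-- the anchor `ρ` -/
  anchor : Sec E F A →ₗ[Fn E M] Vect E M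
  /-- the Lie bracket of sections -/
  bracket : Sec E F A →ₗ[ℝ] Sec E F A →ₗ[ℝ] Sec E F A
  bracket_self : ∀ u, bracket u u = 0
  jacobi : ∀ u v w, bracket u (bracket v w) = bracket (bracket u v) w + bracket v (bracket u w)
  leibniz : ∀ u (f : Fn E M) v,
    bracket u (f • v) = f • bracket u v + der (anchor u) f • v
  anchor_bracket : ∀ u v, anchor (bracket u v) = vbr (anchor u) (anchor v)

section Jets

variable {E : Type*} [NormedAddCommGroup E] [NormedSpace ℝ E]
  {M : Type*} [TopologicalSpace M] [ChartedSpace E M] [IsManifold 𝓘(ℝ, E) ∞ M]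
  {F : Type*} [NormedAddCommGroup F] [NormedSpace ℝ F]
  {A : M → Type*} [TopologicalSpace (TotalSpace F A)]
  [∀ x, AddCommGroup (A x)] [∀ x, Module ℝ (A x)] [∀ x, TopologicalSpace (A x)]
  [FiberBundle F A] [VectorBundle ℝ F A]

/-- The space `Γ(𝔍A)` of smooth sections of the first jet bundle `𝔍A`, through the decomposition
`Γ(𝔍A) = j¹Γ(A) ⊕ Γ(T*M ⊗ A)` of real vector spaces: the pair `(u, H)` is the section `j¹u + H`,
where `H` is a bundle morphism `TM → A`, i.e. a section of `𝔥 = T*M ⊗ A = Hom(TM, A)`. -/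
def JetSec (E F : Type*) [NormedAddCommGroup E] [NormedSpace ℝ E]
    {M : Type*} [TopologicalSpace M] [ChartedSpace E M] [IsManifold 𝓘(ℝ, E) ∞ M]
    [NormedAddCommGroup F] [NormedSpace ℝ F]
    (A : M → Type*) [TopologicalSpace (TotalSpace F A)]
    [∀ x, AddCommGroup (A x)] [∀ x, Module ℝ (A x)] [∀ x, TopologicalSpace (A x)]
    [FiberBundle F A] [VectorBundle ℝ F A] : Type _ :=
  Sec E F A × (Vect E M →ₗ[Fn E M] Sec E F A)

namespace JetSec

/-- The underlying section `u` of `A` of the jet section `j¹u + H`. -/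
def base (ξ : JetSec E F A) : Sec E F A := ξ.1

/-- The component `H : TM → A` of the jet section `j¹u + H`. -/
def hom (ξ : JetSec E F A) : Vect E M →ₗ[Fn E M] Sec E F A := ξ.2

instance : AddCommGroup (JetSec E F A) :=
  inferInstanceAs (AddCommGroup (Sec E F A × (Vect E M →ₗ[Fn E M] Sec E F A)))

/-- The jet prolongation `j¹u` of a section `u`. -/
def j1 (u : Sec E F A) : JetSec E F A := (u, 0)

/-- The inclusion of `Γ(𝔥)` in `Γ(𝔍A)`. -/
def ofHom (H : Vect E M →ₗ[Fn E M] Sec E F A) : JetSec E F A := (0, H)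

/-- The `C^∞(M)`-module structure of `Γ(𝔍A)`. It is determined by `j¹(f u) = df ⊗ u + f j¹u`, so
that `f (j¹u + H) = j¹(f u) + f H - df ⊗ u`. -/
instance : Module (Fn E M) (JetSec E F A) where
  smul f ξ := (f • ξ.1, f • ξ.2 - dTensor f ξ.1)
  one_smul ξ := by
    refine Prod.ext (one_smul _ ξ.1) (LinearMap.ext fun X => ?_)
    change (1 : Fn E M) • ξ.2 X - der X 1 • ξ.1 = ξ.2 X
    rw [der_one, one_smul, zero_smul, sub_zero]
  mul_smul f g ξ := by
    refine Prod.ext (mul_smul f g ξ.1) (LinearMap.ext fun X => ?_)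
    change (f * g) • ξ.2 X - der X (f * g) • ξ.1 =
      f • (g • ξ.2 X - der X g • ξ.1) - der X f • g • ξ.1
    rw [der_mul, mul_smul, smul_sub, add_smul, mul_smul, mul_smul, smul_comm (der X f) g,
      sub_sub]
  smul_zero f := by
    refine Prod.ext (smul_zero f) (LinearMap.ext fun X => ?_)
    change f • (0 : Sec E F A) - der X f • (0 : Sec E F A) = 0
    rw [smul_zero, smul_zero, sub_zero]
  smul_add f ξ η := by
    refine Prod.ext (smul_add f ξ.1 η.1) (LinearMap.ext fun X => ?_)
    change f • (ξ.2 X + η.2 X) - der X f • (ξ.1 + η.1) =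
      f • ξ.2 X - der X f • ξ.1 + (f • η.2 X - der X f • η.1)
    rw [smul_add, smul_add]
    abel
  add_smul f g ξ := by
    refine Prod.ext (add_smul f g ξ.1) (LinearMap.ext fun X => ?_)
    change (f + g) • ξ.2 X - der X (f + g) • ξ.1 =
      f • ξ.2 X - der X f • ξ.1 + (g • ξ.2 X - der X g • ξ.1)
    rw [der_add, add_smul, add_smul]
    abel
  zero_smul ξ := by
    refine Prod.ext (zero_smul _ ξ.1) (LinearMap.ext fun X => ?_)
    change (0 : Fn E M) • ξ.2 X - der X 0 • ξ.1 = 0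
    rw [der_zero, zero_smul, zero_smul, sub_zero]

theorem j1_smul (f : Fn E M) (u : Sec E F A) :
    j1 (f • u) = ofHom (dTensor f u) + f • j1 u := by
  refine Prod.ext (zero_add _).symm (LinearMap.ext fun X => ?_)
  change (0 : Sec E F A) = der X f • u + (f • 0 - der X f • u)
  rw [smul_zero, zero_sub, add_neg_cancel]

end JetSec

end Jets

namespace LieAlgebroid

section Brackets

variable {E : Type*} [NormedAddCommGroup E] [NormedSpace ℝ E] [FiniteDimensional ℝ E]
  {M : Type*} [TopologicalSpace M] [ChartedSpace E M] [IsManifold 𝓘(ℝ, E) ∞ M]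
  {F : Type*} [NormedAddCommGroup F] [NormedSpace ℝ F]
  {A : M → Type*} [TopologicalSpace (TotalSpace F A)]
  [∀ x, AddCommGroup (A x)] [∀ x, Module ℝ (A x)] [∀ x, TopologicalSpace (A x)]
  [FiberBundle F A] [VectorBundle ℝ F A]
  (𝓐 : LieAlgebroid E F A)

/-- The action of `u ∈ Γ(A)` on `Γ(Hom(TM, A))`: `(L_u H)(X) = [u, H X] - H [ρ u, X]`. -/
def lieHom (u : Sec E F A) (H : Vect E M →ₗ[Fn E M] Sec E F A) :
    Vect E M →ₗ[Fn E M] Sec E F A where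
  toFun X := 𝓐.bracket u (H X) - H (vbr (𝓐.anchor u) X)
  map_add' X Y := by
    simp only [map_add, vbr_add]
    abel
  map_smul' f X := by
    simp only [map_smul, vbr_smul, 𝓐.leibniz, map_add, RingHom.id_apply, smul_sub]
    abel

/-- The Lie bracket of `Γ(𝔍A)`:
`[j¹u + H, j¹v + K] = j¹[u, v] + L_u K - L_v H + K ρ H - H ρ K`. -/
def jetBracket (ξ η : JetSec E F A) : JetSec E F A :=
  (𝓐.bracket ξ.base η.base,
    𝓐.lieHom ξ.base η.hom - 𝓐.lieHom η.base ξ.hom +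
      η.hom ∘ₗ 𝓐.anchor ∘ₗ ξ.hom - ξ.hom ∘ₗ 𝓐.anchor ∘ₗ η.hom)

theorem jetBracket_j1 (u v : Sec E F A) :
    𝓐.jetBracket (JetSec.j1 u) (JetSec.j1 v) = JetSec.j1 (𝓐.bracket u v) := by
  refine Prod.ext rfl (LinearMap.ext fun X => ?_)
  simp [jetBracket, lieHom, JetSec.j1, JetSec.hom, JetSec.base]

end Brackets

section Schouten

variable {E : Type*} [NormedAddCommGroup E] [NormedSpace ℝ E] [FiniteDimensional ℝ E]
  {M : Type*} [TopologicalSpace M] [ChartedSpace E M] [IsManifold 𝓘(ℝ, E) ∞ M]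
  {F : Type*} [NormedAddCommGroup F] [NormedSpace ℝ F] [FiniteDimensional ℝ F]
  {A : M → Type*} [TopologicalSpace (TotalSpace F A)]
  [∀ x, AddCommGroup (A x)] [∀ x, Module ℝ (A x)] [∀ x, TopologicalSpace (A x)]
  [FiberBundle F A] [VectorBundle ℝ F A]
  (𝓐 : LieAlgebroid E F A)

/-- The properties that characterize the Schouten bracket on `Γ(∧A)`: it is a graded skew-symmetric
biderivation of degree `-1` which extends the Lie bracket of sections and the anchor. -/
structure IsSchouten (br : Multi E F A →ₗ[ℝ] Multi E F A →ₗ[ℝ] Multi E F A) : Prop where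
  homog : ∀ p q r P Q, IsHomog p P → IsHomog q Q → p + q = r + 1 → IsHomog r (br P Q)
  skew : ∀ p q P Q, IsHomog p P → IsHomog q Q →
    br P Q = -((-1 : ℝ) ^ ((p + 1) * (q + 1)) • br Q P)
  leibniz : ∀ p q P Q R, IsHomog p P → IsHomog q Q →
    br P (Q * R) = br P Q * R + (-1 : ℝ) ^ ((p + 1) * q) • (Q * br P R)
  fn_fn : ∀ f g : Fn E M, br (ofFn f) (ofFn g) = 0
  sec_fn : ∀ u (f : Fn E M), br (ofSec u) (ofFn f) = ofFn (der (𝓐.anchor u) f)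
  sec_sec : ∀ u v, br (ofSec u) (ofSec v) = ofSec (𝓐.bracket u v)

open Classical in
/-- The Schouten bracket on `Γ(∧A)`: the operation with the properties `IsSchouten`. -/
def schouten : Multi E F A →ₗ[ℝ] Multi E F A →ₗ[ℝ] Multi E F A :=
  if h : ∃ br, 𝓐.IsSchouten br then h.choose else 0

end Schouten

section Pairs

variable {E : Type*} [NormedAddCommGroup E] [NormedSpace ℝ E] [FiniteDimensional ℝ E]
  {M : Type*} [TopologicalSpace M] [ChartedSpace E M] [IsManifold 𝓘(ℝ, E) ∞ M] [T2Space M]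
  {F : Type*} [NormedAddCommGroup F] [NormedSpace ℝ F] [FiniteDimensional ℝ F]
  {A : M → Type*} [TopologicalSpace (TotalSpace F A)]
  [∀ x, AddCommGroup (A x)] [∀ x, Module ℝ (A x)] [∀ x, TopologicalSpace (A x)]
  [FiberBundle F A] [VectorBundle ℝ F A] [ContMDiffVectorBundle ∞ F A 𝓘(ℝ, E)]
  (𝓐 : LieAlgebroid E F A)

/-- The anchor `A x → T_x M` at a point. -/
def rho (x : M) : A x →ₗ[ℝ] TangentSpace 𝓘(ℝ, E) x := fiber 𝓐.anchor x

/-- The adjoint action of `𝔍A` on `∧A`: `j¹u` acts by `w ↦ [u, w]` and `H ∈ Γ(𝔥)` acts by the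
derivation of `∧A` extending the endomorphism `v ↦ - H (ρ v)` of `A`. -/
def ad (ξ : JetSec E F A) (w : Multi E F A) (x : M) : ExteriorAlgebra ℝ (A x) :=
  (𝓐.schouten (ofSec ξ.base) w).1 x + extDer (-(fiber ξ.hom x ∘ₗ 𝓐.rho x)) (w.1 x)

/-- A `k`-differential on `A`: a derivation `Γ(∧^• A) → Γ(∧^{• + k - 1} A)` compatible with the
Schouten bracket. -/
structure Differential (k : ℕ) where
  /-- the operator -/
  toFun : Multi E F A →ₗ[ℝ] Multi E F A
  homog : ∀ p P, IsHomog p P → IsHomog (p + k - 1) (toFun P)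
  derivation : ∀ p P Q, IsHomog p P →
    toFun (P * Q) = toFun P * Q + (-1 : ℝ) ^ (p * (k - 1)) • (P * toFun Q)
  schouten : ∀ p P Q, IsHomog p P →
    toFun (𝓐.schouten P Q) = 𝓐.schouten (toFun P) Q +
      (-1 : ℝ) ^ ((k - 1) * (p + 1)) • 𝓐.schouten P (toFun Q)

/-- The tensor `t = π ∈ Γ(TM ⊗ ∧ʲA)` is `ρ`-compatible:
`ι_{ρ*ξ} ι_η π = - ι_{ρ*η} ι_ξ π` for all covectors `ξ`, `η` of `M`. -/
def IsCompatible {j : ℕ} (t : Mixed E F A j) : Prop :=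
  ∀ (x : M) (ξ η : TangentSpace 𝓘(ℝ, E) x →ₗ[ℝ] ℝ),
    CliffordAlgebra.contractLeft (ξ ∘ₗ 𝓐.rho x) (contract η j (t.toFun x)) =
      -CliffordAlgebra.contractLeft (η ∘ₗ 𝓐.rho x) (contract ξ j (t.toFun x))

/-- A `k`-characteristic pair `(χ, π)` on `A`. -/
structure CharPair (k : ℕ) where
  /-- the bundle morphism `χ : 𝔍A → ∧ᵏA` -/
  chi : JetSec E F A →ₗ[Fn E M] Multi E F A
  homog : ∀ ξ, IsHomog k (chi ξ)
  cocycle : ∀ ξ η x, (chi (𝓐.jetBracket ξ η)).1 x = 𝓐.ad ξ (chi η) x - 𝓐.ad η (chi ξ) x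
  /-- the section `π` of `TM ⊗ ∧^{k-1} A` -/
  tensor : Mixed E F A (k - 1)
  compatible : 𝓐.IsCompatible tensor
  restrict : ∀ (H : Vect E M →ₗ[Fn E M] Sec E F A) x,
    (chi (JetSec.ofHom H)).1 x = homWedge (fiber H x) (k - 1) (tensor.toFun x)

variable {𝓐}

/-- The differential `δ` and the characteristic pair `(χ, π)` are related by `δ u = χ (j¹u)` for
sections `u` of `A`, and `δ f = (-1)^{k-1} ι_{df} π` for functions `f`. -/
def Corresponds {k : ℕ} (δ : 𝓐.Differential k) (c : 𝓐.CharPair k) : Prop :=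
  (∀ u : Sec E F A, δ.toFun (ofSec u) = c.chi (JetSec.j1 u)) ∧
  ∀ (f : Fn E M) (x : M), (δ.toFun (ofFn f)).1 x = (-1 : ℝ) ^ (k - 1) •
    contract (mvfderiv 𝓘(ℝ, E) f x).toLinearMap (k - 1) (c.tensor.toFun x)

end Pairs

end LieAlgebroid

end LieAlgd

end

/-!
Differentials and characteristic pairs on a Lie algebroid `A`.

Everything rests on one extension theorem, `exists_isGDer`: an operator on functions and an
operator on sections of `A`, with values in `Γ(∧A)`, which satisfy the Leibniz rules `δ(fg) = f δg
+ g δf` and `δ(fu) = δf ∧ u + f δu` extend to a graded derivation of `Γ(∧A)`, and only to one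
(`IsGDer.ext`). Graded derivations are local by bump functions, and near a point functions and
sections generate `Γ(∧A)`, which gives uniqueness and smoothness; the value at a point is
constructed in a local frame. Degrees are handled by the Euler derivation, which multiplies degree
`p` by `p`: a derivation has degree `c` if its commutator with the Euler derivation is `c` times
it, and that is again checked on functions and sections.

The Schouten bracket is obtained by applying the extension theorem twice. It gives the derivations
`[f, ·]` (`fnOp`, the contraction with `-ρ* df`) and `[u, ·]` (`secOp`) for functions `f` and
sections `u`, and then `[P, ·]` from its values `±[f, P]` and `-[u, P]`.

For a graded derivation `δ`, the defect `δ[P, Q] - [δP, Q] - ±[P, δQ]` of compatibility with the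
bracket is a derivation in `Q` and graded skew-symmetric, so it vanishes if it vanishes on the
pairs `(f, g)`, `(u, f)` and `(u, v)` (`defect_eq_zero`). The pair `(u, f)` follows from the pairs
`(u, v)`: the defect `B` satisfies `B(u, f) ∧ v = B(u, fv) - f B(u, v)`, and an element of degree
`k - 1 < rank A` which is killed by all `v` vanishes (`defect_sec_fn`); this is where `k ≤ rank A`
enters. On the pairs `(f, g)` the condition is the `ρ`-compatibility of `π` (`isCompatible_iff`).
On the pairs `(u, v)` it is the cocycle condition for `χ` on jet prolongations. Near a point these
generate `Γ(𝔍A)` over `C^∞(M)`, because `df ⊗ u = j¹(fu) - f j¹u` (`JetSec.eq_zero_of_j1`), and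
the cocycle defect is `C^∞(M)`-bilinear, so the condition holds for all jets (`cocycle_of_j1`).

Finally, derivations of `C^∞(M)` with values in `Γ(∧ʲA)` are the contractions of differentials
with sections of `TM ⊗ ∧ʲA` (`exists_mixed`). This follows from Hadamard's lemma in coordinates,
as for vector fields. The statement on `δ = [τ, ·]` is the Jacobi identity (`defect_schouten`),
together with the comparison of `χ` with `-d_{𝔍A} τ` on jet prolongations and of `π` with `D_ρ τ`
after contraction with differentials.
-/

set_option linter.unusedSectionVars false

noncomputable section

namespace LieAlgd

/-! ### Gradings and derivations of exterior algebras -/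

section ExteriorLinearAlgebra

open ExteriorAlgebra

variable {V : Type*} [AddCommGroup V] [Module ℝ V] {W : Type*} [AddCommGroup W] [Module ℝ W]

/-- The `s`-th power of the grade involution of `∧V`: it multiplies `v ∈ V` by `(-1)ˢ`. -/
def twist (s : ℕ) : ExteriorAlgebra ℝ V →ₐ[ℝ] ExteriorAlgebra ℝ V :=
  ExteriorAlgebra.map ((-1 : ℝ) ^ s • LinearMap.id)

@[simp] theorem twist_ι (s : ℕ) (v : V) : twist s (ι ℝ v) = (-1 : ℝ) ^ s • ι ℝ v := by
  simp [twist]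

theorem twist_add (s t : ℕ) (a : ExteriorAlgebra ℝ V) : twist (s + t) a = twist s (twist t a) := by
  have : (twist (s + t) : ExteriorAlgebra ℝ V →ₐ[ℝ] _) = (twist s).comp (twist t) := by
    ext v
    simp [pow_add, smul_smul, mul_comm]
  exact congrArg (fun g => g a) this

theorem twist_of_even {s : ℕ} (hs : Even s) (a : ExteriorAlgebra ℝ V) : twist s a = a := by
  have : (twist s : ExteriorAlgebra ℝ V →ₐ[ℝ] _) = AlgHom.id ℝ _ := by
    ext v
    simp [hs.neg_one_pow]
  exact congrArg (fun g => g a) this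

theorem twist_congr {s t : ℕ} (h : Even (s + t)) (a : ExteriorAlgebra ℝ V) :
    twist s a = twist t a := by
  have h2 : Even (t + t) := ⟨t, rfl⟩
  rw [← twist_of_even h2 (twist s a), ← twist_add,
    show t + t + s = t + (s + t) by omega, twist_add, twist_of_even h]

theorem map_twist (s : ℕ) (g : V →ₗ[ℝ] W) (a : ExteriorAlgebra ℝ V) :
    ExteriorAlgebra.map g (twist s a) = twist s (ExteriorAlgebra.map g a) := by
  have : (ExteriorAlgebra.map g).comp (twist s) = (twist s).comp (ExteriorAlgebra.map g) := by
    ext v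
    simp
  exact congrArg (fun g => g a) this

theorem exterior_induction {C : ExteriorAlgebra ℝ V → Prop} (h1 : C 1)
    (hι : ∀ v a, C a → C (ι ℝ v * a)) (hadd : ∀ a b, C a → C b → C (a + b))
    (hsmul : ∀ (r : ℝ) a, C a → C (r • a)) (a : ExteriorAlgebra ℝ V) : C a := by
  refine CliffordAlgebra.left_induction (Q := (0 : QuadraticForm ℝ V)) (fun r => ?_) hadd
    (fun x m h => hι m x h) a
  rw [Algebra.algebraMap_eq_smul_one]
  exact hsmul r 1 h1

theorem exteriorPower_induction {p : ℕ} {C : ExteriorAlgebra ℝ V → Prop}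
    (hι : ∀ v : Fin p → V, C (ιMulti ℝ p v)) (hzero : C 0)
    (hadd : ∀ a b, C a → C b → C (a + b))
    (hsmul : ∀ (r : ℝ) a, C a → C (r • a)) {a : ExteriorAlgebra ℝ V} (ha : a ∈ ⋀[ℝ]^p V) : C a := by
  rw [← ιMulti_span_fixedDegree] at ha
  induction ha using Submodule.span_induction with
  | mem x h => obtain ⟨v, rfl⟩ := h; exact hι v
  | zero => exact hzero
  | add x y _ _ hx hy => exact hadd x y hx hy
  | smul r x _ hx => exact hsmul r x hx

theorem map_smul_id_of_mem (c : ℝ) {p : ℕ} {a : ExteriorAlgebra ℝ V} (ha : a ∈ ⋀[ℝ]^p V) :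
    ExteriorAlgebra.map (c • LinearMap.id) a = c ^ p • a := by
  refine exteriorPower_induction
    (C := fun a => ExteriorAlgebra.map (c • LinearMap.id) a = c ^ p • a)
    (fun v => ?_) ?_ (fun a b ha hb => ?_) (fun r a ha => ?_) ha
  · rw [map_apply_ιMulti]
    have := (ιMulti ℝ p (M := V)).toMultilinearMap.map_smul_univ (fun _ => c) v
    rw [Finset.prod_const, Finset.card_univ, Fintype.card_fin] at this
    exact this
  · simp
  · rw [map_add, ha, hb, smul_add]
  · rw [map_smul, ha, smul_comm]

theorem twist_of_mem (s : ℕ) {p : ℕ} {a : ExteriorAlgebra ℝ V} (ha : a ∈ ⋀[ℝ]^p V) :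
    twist s a = (-1 : ℝ) ^ (p * s) • a := by
  rw [twist, map_smul_id_of_mem _ ha, ← pow_mul, mul_comm]

theorem ι_mul_eq (v : V) (a : ExteriorAlgebra ℝ V) : ι ℝ v * a = twist 1 a * ι ℝ v := by
  induction a using exterior_induction with
  | h1 => simp
  | hι w a ha =>
    rw [← mul_assoc, eq_neg_of_add_eq_zero_left (ι_add_mul_swap v w), neg_mul, mul_assoc, ha]
    simp [mul_assoc]
  | hadd a b ha hb => simp [mul_add, add_mul, ha, hb]
  | hsmul r a ha => simp [ha]

/-- `a` is even or odd, according to the parity of `p`. Only `p` modulo `2` matters; natural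
numbers are used so that degrees can be inserted directly. -/
def HasPar (p : ℕ) (a : ExteriorAlgebra ℝ V) : Prop := twist 1 a = (-1 : ℝ) ^ p • a

theorem HasPar.twist {p : ℕ} {a : ExteriorAlgebra ℝ V} (h : HasPar p a) (s : ℕ) :
    twist s a = (-1 : ℝ) ^ (p * s) • a := by
  induction s with
  | zero => simp [twist_of_even]
  | succ n ih =>
    rw [twist_add, h, map_smul, ih, smul_smul, ← pow_add]
    congr 2
    ring

theorem hasPar_of_mem {p : ℕ} {a : ExteriorAlgebra ℝ V} (h : a ∈ ⋀[ℝ]^p V) : HasPar p a := by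
  rw [HasPar, twist_of_mem 1 h, mul_one]

/-- Graded commutativity of the exterior algebra. -/
theorem HasPar.mul_comm {p : ℕ} {a : ExteriorAlgebra ℝ V} (h : HasPar p a)
    (b : ExteriorAlgebra ℝ V) : a * b = LieAlgd.twist p b * a := by
  induction b using exterior_induction with
  | h1 => simp
  | hι w b hb =>
    have h1 : a * ι ℝ w = (-1 : ℝ) ^ p • (ι ℝ w * a) := by
      rw [ι_mul_eq w a, h, smul_mul_assoc, smul_smul, ← mul_pow]
      simp
    rw [← mul_assoc, h1, smul_mul_assoc, mul_assoc, hb, map_mul, twist_ι, smul_mul_assoc,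
      smul_mul_assoc, mul_assoc]
  | hadd a b ha hb => simp [mul_add, add_mul, ha, hb]
  | hsmul r a ha => simp [ha]

theorem HasPar.mul_comm' {p q : ℕ} {a b : ExteriorAlgebra ℝ V} (h : HasPar p a)
    (hb : HasPar q b) : a * b = (-1 : ℝ) ^ (p * q) • (b * a) := by
  rw [h.mul_comm, hb.twist, smul_mul_assoc, Nat.mul_comm]

/-- A map `T : V → ∧V` of degree `s` (mod 2) extends to a graded derivation of `∧V`. -/
theorem exists_algebraic_derivation (s : ℕ) (T : V →ₗ[ℝ] ExteriorAlgebra ℝ V)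
    (hT : ∀ v, HasPar (s + 1) (T v)) :
    ∃ D : ExteriorAlgebra ℝ V →ₗ[ℝ] ExteriorAlgebra ℝ V, (∀ v, D (ι ℝ v) = T v) ∧
      ∀ a b, D (a * b) = D a * b + twist s a * D b := by
  -- `a ↦ !![twist s a, D a; 0, a]` is a morphism of algebras
  let m : V →ₗ[ℝ] Matrix (Fin 2) (Fin 2) (ExteriorAlgebra ℝ V) :=
    { toFun := fun v => !![(-1 : ℝ) ^ s • ι ℝ v, T v; 0, ι ℝ v]
      map_add' := fun v w => by
        ext i j; fin_cases i <;> fin_cases j <;> simp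
      map_smul' := fun r v => by
        ext i j; fin_cases i <;> fin_cases j <;> simp [smul_comm r] }
  have hm : ∀ v, m v * m v = 0 := fun v => by
    have h1 : T v * ι ℝ v = -((-1 : ℝ) ^ s • (ι ℝ v * T v)) := by
      rw [(hT v).mul_comm, twist_ι, pow_succ, smul_mul_assoc]
      simp
    ext i j
    fin_cases i <;> fin_cases j <;> simp [m, Matrix.mul_apply, Fin.sum_univ_two, h1]
  let L := ExteriorAlgebra.lift ℝ ⟨m, hm⟩
  have hL : ∀ a, L a 0 0 = twist s a ∧ L a 1 0 = 0 ∧ L a 1 1 = a := by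
    intro a
    induction a using exterior_induction with
    | h1 => simp [L]
    | hι v a ha =>
      obtain ⟨h1, h2, h3⟩ := ha
      simp [L, Matrix.mul_apply, Fin.sum_univ_two] at h1 h2 h3 ⊢
      simp [h1, h2, h3, m]
    | hadd a b ha hb => simp [ha, hb]
    | hsmul r a ha => simp [ha]
  refine ⟨(LinearMap.proj 1 ∘ₗ LinearMap.proj (R := ℝ)
    (φ := fun _ : Fin 2 => Fin 2 → ExteriorAlgebra ℝ V) 0) ∘ₗ L.toLinearMap,
    fun v => ?_, fun a b => ?_⟩
  · change L (ι ℝ v) 0 1 = T v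
    rw [ExteriorAlgebra.lift_ι_apply]
    rfl
  · obtain ⟨h1, -, -⟩ := hL a
    obtain ⟨-, -, h3⟩ := hL b
    have : L (a * b) 0 1 = twist s a * L b 0 1 + L a 0 1 * b := by
      rw [map_mul, Matrix.mul_apply, Fin.sum_univ_two, h1, h3]
    rw [add_comm]
    exact this

theorem extDer_one (T : V →ₗ[ℝ] V) : extDer T (1 : ExteriorAlgebra ℝ V) = 0 := by
  simp [extDer]

theorem extDer_algebraMap (T : V →ₗ[ℝ] V) (r : ℝ) :
    extDer T (algebraMap ℝ _ r) = 0 := by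
  rw [Algebra.algebraMap_eq_smul_one, map_smul, extDer_one, smul_zero]

theorem extDer_add (S T : V →ₗ[ℝ] V) (a : ExteriorAlgebra ℝ V) :
    extDer (S + T) a = extDer S a + extDer T a := by
  induction a using exterior_induction with
  | h1 => simp [extDer_one]
  | hι v a ha => simp [ha, mul_add, add_mul]; abel
  | hadd a b ha hb => simp only [map_add, ha, hb]; abel
  | hsmul r a ha => simp [ha]

theorem extDer_smul (r : ℝ) (T : V →ₗ[ℝ] V) (a : ExteriorAlgebra ℝ V) :
    extDer (r • T) a = r • extDer T a := by
  induction a using exterior_induction with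
  | h1 => simp [extDer_one]
  | hι v a ha => simp [ha]
  | hadd a b ha hb => simp only [map_add, ha, hb, smul_add]
  | hsmul r a ha => simp [ha, smul_comm r]

/-- `extDer` as a linear function of the endomorphism. -/
def extDerHom (V : Type*) [AddCommGroup V] [Module ℝ V] :
    (V →ₗ[ℝ] V) →ₗ[ℝ] ExteriorAlgebra ℝ V →ₗ[ℝ] ExteriorAlgebra ℝ V where
  toFun := extDer
  map_add' S T := LinearMap.ext (extDer_add S T)
  map_smul' r T := LinearMap.ext (extDer_smul r T)

theorem extDer_ιMulti_id (p : ℕ) (v : Fin p → V) :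
    extDer LinearMap.id (ιMulti ℝ p v) = (p : ℝ) • ιMulti ℝ p v := by
  induction p with
  | zero => simp [extDer_one]
  | succ n ih =>
    rw [ιMulti_succ_apply, extDer_mul, ih, extDer_ι]
    simp [add_smul, add_comm]

theorem extDer_id_of_mem {p : ℕ} {a : ExteriorAlgebra ℝ V} (ha : a ∈ ⋀[ℝ]^p V) :
    extDer LinearMap.id a = (p : ℝ) • a := by
  refine exteriorPower_induction (C := fun a => extDer LinearMap.id a = (p : ℝ) • a)
    (fun v => extDer_ιMulti_id p v) ?_ (fun a b ha hb => ?_)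
    (fun r a ha => ?_) ha
  · simp
  · rw [map_add, ha, hb, smul_add]
  · rw [map_smul, ha, smul_comm]

/-- The homogeneous components of `a` are determined by the Euler derivation of `∧V`. -/
theorem smul_proj_eq (a : ExteriorAlgebra ℝ V) (c : ℝ) (h : extDer LinearMap.id a = c • a) (i : ℕ) :
    (c - i) • GradedAlgebra.proj (fun i : ℕ => ⋀[ℝ]^i V) i a = 0 := by
  have key : ∀ b : ExteriorAlgebra ℝ V, GradedAlgebra.proj (fun i : ℕ => ⋀[ℝ]^i V) i
      (extDer LinearMap.id b) = (i : ℝ) • GradedAlgebra.proj (fun i : ℕ => ⋀[ℝ]^i V) i b := by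
    intro b
    induction b using DirectSum.Decomposition.inductionOn fun i => ⋀[ℝ]^i V with
    | zero => simp
    | add a b ha hb => rw [map_add, map_add, ha, hb, map_add, smul_add]
    | @homogeneous j b =>
      rw [extDer_id_of_mem b.2, map_smul]
      by_cases hij : j = i
      · subst hij; rfl
      · rw [GradedAlgebra.proj_apply,
          DirectSum.decompose_of_mem_ne (fun i : ℕ => ⋀[ℝ]^i V) b.2 hij, smul_zero, smul_zero]
  have h1 := key a
  rw [h, map_smul] at h1
  rw [sub_smul, h1, sub_self]

theorem mem_of_extDer_id {p : ℕ} {a : ExteriorAlgebra ℝ V}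
    (h : extDer LinearMap.id a = (p : ℝ) • a) : a ∈ ⋀[ℝ]^p V := by
  classical
  rw [← DirectSum.sum_support_decompose (fun i : ℕ => ⋀[ℝ]^i V) a]
  refine Submodule.sum_mem _ fun i _ => ?_
  by_cases hi : i = p
  · rw [hi]; exact Subtype.mem _
  · have := smul_proj_eq a p h i
    rw [smul_eq_zero, sub_eq_zero, Nat.cast_inj] at this
    rw [← GradedAlgebra.proj_apply, this.resolve_left (Ne.symm hi)]
    exact zero_mem _

end ExteriorLinearAlgebra

/-! ### Contractions and mixed tensors -/

section Contraction

open ExteriorAlgebra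

variable {V : Type*} [AddCommGroup V] [Module ℝ V] {W : Type*} [AddCommGroup W] [Module ℝ W]

/-- The contraction `i_ξ` on `∧V`. -/
abbrev ctr (ξ : V →ₗ[ℝ] ℝ) : ExteriorAlgebra ℝ V →ₗ[ℝ] ExteriorAlgebra ℝ V :=
  CliffordAlgebra.contractLeft ξ

theorem ctr_ι_mul (ξ : V →ₗ[ℝ] ℝ) (v : V) (a : ExteriorAlgebra ℝ V) :
    ctr ξ (ι ℝ v * a) = ξ v • a - ι ℝ v * ctr ξ a :=
  CliffordAlgebra.contractLeft_ι_mul (Q := (0 : QuadraticForm ℝ V)) ξ v a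

theorem ctr_one (ξ : V →ₗ[ℝ] ℝ) : ctr ξ (1 : ExteriorAlgebra ℝ V) = 0 :=
  CliffordAlgebra.contractLeft_one (Q := (0 : QuadraticForm ℝ V)) ξ

theorem ctr_ι (ξ : V →ₗ[ℝ] ℝ) (v : V) : ctr ξ (ι ℝ v) = algebraMap ℝ _ (ξ v) :=
  CliffordAlgebra.contractLeft_ι (Q := (0 : QuadraticForm ℝ V)) ξ v

theorem ctr_mul (ξ : V →ₗ[ℝ] ℝ) (a b : ExteriorAlgebra ℝ V) :
    ctr ξ (a * b) = ctr ξ a * b + twist 1 a * ctr ξ b := by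
  induction a using exterior_induction with
  | h1 => simp
  | hι v a ha =>
    rw [mul_assoc, ctr_ι_mul, ha, ctr_ι_mul]
    simp [sub_mul, mul_add, mul_assoc]
    abel
  | hadd a b ha hb => simp only [map_add, add_mul, ha, hb]; abel
  | hsmul r a ha => simp [ha]

theorem ctr_map (g : V →ₗ[ℝ] W) (ξ : W →ₗ[ℝ] ℝ) (a : ExteriorAlgebra ℝ V) :
    ctr ξ (ExteriorAlgebra.map g a) = ExteriorAlgebra.map g (ctr (ξ ∘ₗ g) a) := by
  induction a using exterior_induction with
  | h1 => simp
  | hι v a ha =>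
    rw [map_mul, map_apply_ι, ctr_ι_mul, ha, ctr_ι_mul]
    simp
  | hadd a b ha hb => simp only [map_add, ha, hb]
  | hsmul r a ha => simp only [map_smul, ha]

theorem extDer_smulRight (ξ : V →ₗ[ℝ] ℝ) (v : V) (a : ExteriorAlgebra ℝ V) :
    extDer (ξ.smulRight v) a = ι ℝ v * ctr ξ a := by
  induction a using exterior_induction with
  | h1 => simp [extDer_one]
  | hι w a ha =>
    rw [extDer_mul, ha, ctr_ι_mul, ← mul_assoc, eq_neg_of_add_eq_zero_left (ι_add_mul_swap w v)]
    simp [mul_sub, mul_assoc]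
    abel
  | hadd a b ha hb => simp only [map_add, ha, hb, mul_add]
  | hsmul r a ha => simp only [map_smul, ha, mul_smul_comm]

theorem extDer_eq_sum {ι' : Type*} [Fintype ι'] (b : Basis ι' ℝ W) (f : W →ₗ[ℝ] V) (g : V →ₗ[ℝ] W)
    (a : ExteriorAlgebra ℝ V) :
    extDer (f ∘ₗ g) a = ∑ i, ι ℝ (f (b i)) * ctr (b.coord i ∘ₗ g) a := by
  have : f ∘ₗ g = ∑ i, (b.coord i ∘ₗ g).smulRight (f (b i)) := by
    ext v
    rw [LinearMap.sum_apply]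
    conv_lhs => rw [LinearMap.comp_apply, ← b.sum_repr (g v), map_sum]
    simp
  rw [this]
  change extDerHom V _ a = _
  rw [map_sum, LinearMap.sum_apply]
  exact Finset.sum_congr rfl fun i _ => extDer_smulRight _ _ _

/-- An element of degree less than the dimension which is killed by exterior multiplication with
every vector vanishes: for a basis `bᵢ`, the operator `w ↦ ∑ᵢ i_{bᵢ*} (bᵢ ∧ w)` multiplies elements
of degree `j` by `dim V - j`. -/
theorem eq_zero_of_forall_mul_ι [FiniteDimensional ℝ V] {j : ℕ} (hj : j < finrank ℝ V)
    {w : ExteriorAlgebra ℝ V} (hw : w ∈ ⋀[ℝ]^j V) (h : ∀ v, w * ι ℝ v = 0) : w = 0 := by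
  have h' : ∀ v, ι ℝ v * w = 0 := fun v => by
    rw [ι_mul_eq, hasPar_of_mem hw, smul_mul_assoc, h, smul_zero]
  let b := Module.finBasis ℝ V
  have h1 : ∑ i, ι ℝ (b i) * ctr (b.coord i) w = (j : ℝ) • w := by
    rw [← extDer_id_of_mem hw]
    exact (extDer_eq_sum b LinearMap.id LinearMap.id w).symm
  have h2 : ∑ i, ctr (b.coord i) (ι ℝ (b i) * w) = (finrank ℝ V : ℝ) • w - (j : ℝ) • w := by
    simp only [ctr_ι_mul, Finset.sum_sub_distrib, h1]
    simp [Nat.cast_smul_eq_nsmul]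
  simp only [h', map_zero, Finset.sum_const_zero] at h2
  rw [← sub_smul] at h2
  refine (smul_eq_zero.1 h2.symm).resolve_left (ne_of_gt ?_)
  rw [sub_pos]
  exact_mod_cast hj

theorem tensor_eq_sum {U : Type*} [AddCommGroup U] [Module ℝ U] {ι' : Type*} [Fintype ι']
    (b : Basis ι' ℝ W) (t : TensorProduct ℝ W U) :
    t = ∑ i, b i ⊗ₜ[ℝ] TensorProduct.lid ℝ U (TensorProduct.map (b.coord i) LinearMap.id t) := by
  induction t with
  | zero => simp
  | add x y hx hy =>
    conv_lhs => rw [hx, hy]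
    simp [TensorProduct.tmul_add, Finset.sum_add_distrib]
  | tmul w u =>
    have h : w = ∑ i, b.repr w i • b i := (b.sum_repr w).symm
    have h2 : w ⊗ₜ[ℝ] u = ∑ i, b.repr w i • (b i ⊗ₜ[ℝ] u) := by
      conv_lhs => rw [h, TensorProduct.sum_tmul]
      rfl
    conv_lhs => rw [h2]
    simp

theorem contract_eq (ξ : W →ₗ[ℝ] ℝ) (j : ℕ) (t : TensorProduct ℝ W (⋀[ℝ]^j V)) :
    contract ξ j t = TensorProduct.lid ℝ (⋀[ℝ]^j V) (TensorProduct.map ξ LinearMap.id t) := by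
  induction t with
  | zero => simp
  | add x y hx hy => simp [hx, hy]
  | tmul w u => simp [contract]

theorem contract_mem (ξ : W →ₗ[ℝ] ℝ) (j : ℕ) (t : TensorProduct ℝ W (⋀[ℝ]^j V)) :
    contract ξ j t ∈ ⋀[ℝ]^j V := by
  rw [contract_eq]
  exact Subtype.mem _

theorem contract_tmul (ξ : W →ₗ[ℝ] ℝ) (j : ℕ) (w : W) (u : ⋀[ℝ]^j V) :
    contract ξ j (w ⊗ₜ u) = ξ w • (u : ExteriorAlgebra ℝ V) := by
  simp [contract]

theorem homWedge_tmul (H : W →ₗ[ℝ] V) (j : ℕ) (w : W) (u : ⋀[ℝ]^j V) :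
    homWedge H j (w ⊗ₜ u) = ι ℝ (H w) * (u : ExteriorAlgebra ℝ V) := by
  simp [homWedge]

theorem mixedIncl_tmul (j : ℕ) (w : W) (u : ⋀[ℝ]^j V) :
    mixedIncl W V j (w ⊗ₜ u) = ι ℝ (w, 0) * ExteriorAlgebra.map (LinearMap.inr ℝ W V) u := by
  simp [mixedIncl]

/-- Tensors in `W ⊗ ∧ʲV` are determined by their contractions with covectors. -/
theorem tensor_ext [FiniteDimensional ℝ W] {j : ℕ} {t t' : TensorProduct ℝ W (⋀[ℝ]^j V)}
    (h : ∀ ξ : W →ₗ[ℝ] ℝ, contract ξ j t = contract ξ j t') : t = t' := by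
  rw [tensor_eq_sum (Module.finBasis ℝ W) t, tensor_eq_sum (Module.finBasis ℝ W) t']
  refine Finset.sum_congr rfl fun i _ => ?_
  congr 1
  apply Subtype.ext
  rw [← contract_eq, ← contract_eq, h]

theorem contract_add (ξ η : W →ₗ[ℝ] ℝ) (j : ℕ) (t : TensorProduct ℝ W (⋀[ℝ]^j V)) :
    contract (ξ + η) j t = contract ξ j t + contract η j t := by
  induction t with
  | zero => simp
  | add x y hx hy => simp only [map_add, hx, hy]; abel
  | tmul w u => simp [contract_tmul, add_smul]

theorem contract_smul (r : ℝ) (ξ : W →ₗ[ℝ] ℝ) (j : ℕ) (t : TensorProduct ℝ W (⋀[ℝ]^j V)) :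
    contract (r • ξ) j t = r • contract ξ j t := by
  induction t with
  | zero => simp
  | add x y hx hy => simp only [map_add, hx, hy, smul_add]
  | tmul w u => simp [contract_tmul, mul_smul]

theorem homWedge_smulRight (ξ : W →ₗ[ℝ] ℝ) (v : V) (j : ℕ) (t : TensorProduct ℝ W (⋀[ℝ]^j V)) :
    homWedge (ξ.smulRight v) j t = ι ℝ v * contract ξ j t := by
  induction t with
  | zero => simp
  | add x y hx hy => simp only [map_add, hx, hy, mul_add]
  | tmul w u => simp [contract_tmul, homWedge_tmul]

theorem homWedge_add (H K : W →ₗ[ℝ] V) (j : ℕ) (t : TensorProduct ℝ W (⋀[ℝ]^j V)) :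
    homWedge (H + K) j t = homWedge H j t + homWedge K j t := by
  induction t with
  | zero => simp
  | add a b ha hb => simp only [map_add, ha, hb]; abel
  | tmul a b => simp [homWedge_tmul, add_mul]

theorem homWedge_smul (r : ℝ) (H : W →ₗ[ℝ] V) (j : ℕ) (t : TensorProduct ℝ W (⋀[ℝ]^j V)) :
    homWedge (r • H) j t = r • homWedge H j t := by
  induction t with
  | zero => simp
  | add a b ha hb => simp only [map_add, ha, hb, smul_add]
  | tmul a b => simp [homWedge_tmul]

theorem homWedge_mem (H : W →ₗ[ℝ] V) (j : ℕ) (t : TensorProduct ℝ W (⋀[ℝ]^j V)) :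
    homWedge H j t ∈ ⋀[ℝ]^(j + 1) V := by
  induction t with
  | zero => rw [map_zero]; exact zero_mem _
  | add a b ha hb => rw [map_add]; exact add_mem ha hb
  | tmul a b =>
    rw [homWedge_tmul, exteriorPower, pow_succ']
    exact Submodule.mul_mem_mul (LinearMap.mem_range_self _ _) b.2

/-- `(H ⊗ id) t = ∑ᵢ H (wᵢ) ∧ ι_{ξᵢ} t` for vectors `wᵢ` and covectors `ξᵢ` with
`∑ᵢ ξᵢ ⊗ wᵢ = id`. -/
theorem homWedge_eq_sum {ι' : Type*} [Fintype ι'] (ξ : ι' → W →ₗ[ℝ] ℝ) (w : ι' → W)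
    (h : ∀ x, x = ∑ i, ξ i x • w i) (H : W →ₗ[ℝ] V) (j : ℕ) (t : TensorProduct ℝ W (⋀[ℝ]^j V)) :
    homWedge H j t = ∑ i, ι ℝ (H (w i)) * contract (ξ i) j t := by
  induction t with
  | zero => simp
  | add x y hx hy => simp only [map_add, hx, hy, mul_add, Finset.sum_add_distrib]
  | tmul x u =>
    rw [homWedge_tmul]
    conv_lhs => rw [h x]
    simp [contract_tmul, Finset.sum_mul]

/-- Contractions with covectors in terms of coordinates. -/
theorem contract_eq_sum {κ : Type*} [Fintype κ] (ζ : κ → W →ₗ[ℝ] ℝ) (w : κ → W)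
    (h : ∀ v, v = ∑ i, ζ i v • w i) (ξ : W →ₗ[ℝ] ℝ) (j : ℕ) (t : TensorProduct ℝ W (⋀[ℝ]^j V)) :
    contract ξ j t = ∑ i, ξ (w i) • contract (ζ i) j t := by
  induction t with
  | zero => simp
  | add a b ha hb => simp only [map_add, ha, hb, smul_add, Finset.sum_add_distrib]
  | tmul a b =>
    simp only [contract_tmul, smul_smul, ← Finset.sum_smul]
    congr 1
    conv_lhs => rw [h a]
    simp only [map_sum, map_smul, smul_eq_mul]
    exact Finset.sum_congr rfl fun i _ => mul_comm _ _

/-- If the contractions of `t` are those of `τ` with the pulled back covectors, then `t = D_ρ τ`. -/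
theorem mixedIncl_eq_dRho [FiniteDimensional ℝ W] (ρ : V →ₗ[ℝ] W) {j : ℕ}
    (t : TensorProduct ℝ W (⋀[ℝ]^j V)) (τ : ExteriorAlgebra ℝ V)
    (h : ∀ ξ : W →ₗ[ℝ] ℝ, contract ξ j t = ctr (ξ ∘ₗ ρ) τ) :
    mixedIncl W V j t = dRho ρ (ExteriorAlgebra.map (LinearMap.inr ℝ W V) τ) := by
  let b := Module.finBasis ℝ W
  rw [dRho, extDer_eq_sum b, tensor_eq_sum b t, map_sum]
  refine Finset.sum_congr rfl fun i _ => ?_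
  rw [mixedIncl_tmul, ← contract_eq, h, ctr_map]
  rfl

theorem coe_exteriorPower_map (j : ℕ) (g : V →ₗ[ℝ] W) (u : ⋀[ℝ]^j V) :
    (exteriorPower.map j g u : ExteriorAlgebra ℝ W) = ExteriorAlgebra.map g u := by
  have : (⋀[ℝ]^j W).subtype ∘ₗ exteriorPower.map j g =
      (ExteriorAlgebra.map g).toLinearMap ∘ₗ (⋀[ℝ]^j V).subtype := by
    refine exteriorPower.linearMap_ext (AlternatingMap.ext fun v => ?_)
    simp [exteriorPower.map_apply_ιMulti, ExteriorAlgebra.map_apply_ιMulti]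
  exact congrArg (fun f => f u) this

theorem contract_map {V' W' : Type*} [AddCommGroup V'] [Module ℝ V'] [AddCommGroup W']
    [Module ℝ W'] (T : W →ₗ[ℝ] W') (g : V →ₗ[ℝ] V') (ξ : W' →ₗ[ℝ] ℝ) (j : ℕ)
    (t : TensorProduct ℝ W (⋀[ℝ]^j V)) :
    ((TensorProduct.lid ℝ (⋀[ℝ]^j V') (TensorProduct.map ξ LinearMap.id
      (TensorProduct.map T (exteriorPower.map j g) t)) : ⋀[ℝ]^j V') : ExteriorAlgebra ℝ V') =
      ExteriorAlgebra.map g (contract (ξ ∘ₗ T) j t) := by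
  induction t with
  | zero => simp
  | add x y hx hy => simp only [map_add, Submodule.coe_add, hx, hy]
  | tmul w u =>
    simp [contract_tmul, coe_exteriorPower_map]

end Contraction

/-! ### Bump functions -/

section Local

variable {E : Type*} [NormedAddCommGroup E] [NormedSpace ℝ E] [FiniteDimensional ℝ E]
  {M : Type*} [TopologicalSpace M] [ChartedSpace E M] [IsManifold 𝓘(ℝ, E) ∞ M] [T2Space M]

theorem exists_bump_eventually (x : M) {u : Set M} (hu : IsOpen u) (hx : x ∈ u) :
    ∃ ψ : Fn E M, (∀ᶠ y in 𝓝 x, ψ y = 1) ∧ tsupport ψ ⊆ u := by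
  obtain ⟨ψ, hψ, -⟩ := (SmoothBumpFunction.nhds_basis_support (I := 𝓘(ℝ, E))
    (hu.mem_nhds hx)).mem_iff.1 Filter.univ_mem
  exact ⟨⟨ψ, ψ.contMDiff⟩, ψ.eventuallyEq_one, hψ⟩

/-- A property that holds near `x` holds on the support of a bump function at `x`. -/
theorem exists_bump_forall {x : M} {p : M → Prop} (h : ∀ᶠ y in 𝓝 x, p y) :
    ∃ ψ : Fn E M, ψ x = 1 ∧ ∀ y, p y ∨ ψ y = 0 := by
  obtain ⟨u, hup, hu, hx⟩ := mem_nhds_iff.1 h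
  obtain ⟨ψ, h1, h2⟩ := exists_bump (E := E) x hu hx
  refine ⟨ψ, h1, fun y => ?_⟩
  by_cases hy : y ∈ u
  · exact Or.inl (hup hy)
  · exact Or.inr (image_eq_zero_of_notMem_tsupport fun h => hy (h2 h))

/-- A function which is smooth near `x` agrees near `x` with a globally smooth one. -/
theorem exists_fn_eventuallyEq {x : M} {u : Set M} (hu : IsOpen u) (hx : x ∈ u) {g : M → ℝ}
    (hg : ContMDiffOn 𝓘(ℝ, E) 𝓘(ℝ, ℝ) ∞ g u) :
    ∃ f : Fn E M, ∀ᶠ y in 𝓝 x, f y = g y := by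
  obtain ⟨ψ, h1, h2⟩ := exists_bump_eventually (E := E) x hu hx
  refine ⟨⟨fun y => ψ y * g y, contMDiff_of_tsupport fun y hy => ?_⟩, ?_⟩
  · have hy' : y ∈ u := h2 (tsupport_mul_subset_left hy)
    exact ψ.contMDiff.contMDiffAt.mul ((hg y hy').contMDiffAt (hu.mem_nhds hy'))
  · filter_upwards [h1] with y hy
    change ψ y * g y = g y
    rw [hy, one_mul]

end Local

/-! ### Smooth maps into exterior algebras -/

section Frames

open ExteriorAlgebra

variable {E : Type*} [NormedAddCommGroup E] [NormedSpace ℝ E]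
  {M : Type*} [TopologicalSpace M] [ChartedSpace E M]
  {F : Type*} [NormedAddCommGroup F] [NormedSpace ℝ F] [FiniteDimensional ℝ F]

/-- All components of `g : M → ∧F` are smooth at `x`. -/
def SmoothExtAt (E : Type*) [NormedAddCommGroup E] [NormedSpace ℝ E] {M : Type*}
    [TopologicalSpace M] [ChartedSpace E M] {F : Type*} [NormedAddCommGroup F] [NormedSpace ℝ F]
    (g : M → ExteriorAlgebra ℝ F) (x : M) : Prop :=
  ∀ φ : ExteriorAlgebra ℝ F →ₗ[ℝ] ℝ, ContMDiffAt 𝓘(ℝ, E) 𝓘(ℝ, ℝ) ∞ (fun y => φ (g y)) x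

theorem SmoothExtAt.mul {g h : M → ExteriorAlgebra ℝ F} {x : M} (hg : SmoothExtAt E g x)
    (hh : SmoothExtAt E h x) : SmoothExtAt E (fun y => g y * h y) x := by
  intro φ
  let b := Module.finBasis ℝ (ExteriorAlgebra ℝ F)
  have key : ∀ p q : ExteriorAlgebra ℝ F,
      φ (p * q) = ∑ i, ∑ j, b.coord i p * b.coord j q * φ (b i * b j) := by
    intro p q
    conv_lhs => rw [← b.sum_repr p, ← b.sum_repr q]
    simp only [Finset.sum_mul_sum, map_sum, smul_mul_smul_comm, map_smul, smul_eq_mul,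
      Basis.coord_apply]
  rw [show (fun y => φ (g y * h y)) = _ from funext fun y => key (g y) (h y)]
  exact contMDiffAt_finsetSum fun i _ => contMDiffAt_finsetSum fun j _ =>
    ((hg (b.coord i)).mul (hh (b.coord j))).mul contMDiffAt_const

theorem SmoothExtAt.ι {g : M → F} {x : M} (hg : ContMDiffAt 𝓘(ℝ, E) 𝓘(ℝ, F) ∞ g x) :
    SmoothExtAt E (fun y => ExteriorAlgebra.ι ℝ (g y)) x := fun φ =>
  ((φ ∘ₗ ExteriorAlgebra.ι ℝ).toContinuousLinearMap.contMDiff).contMDiffAt.comp x hg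

theorem SmoothExtAt.map_const {T : M → F →ₗ[ℝ] F} {x : M}
    (hT : ∀ v, ContMDiffAt 𝓘(ℝ, E) 𝓘(ℝ, F) ∞ (fun y => T y v) x) (a : ExteriorAlgebra ℝ F) :
    SmoothExtAt E (fun y => ExteriorAlgebra.map (T y) a) x := by
  induction a using exterior_induction with
  | h1 => intro φ; simp only [map_one]; exact contMDiffAt_const
  | hι v a ha => simp only [map_mul, map_apply_ι]; exact (SmoothExtAt.ι (hT v)).mul ha
  | hadd a b ha hb => intro φ; simp only [map_add]; exact (ha φ).add (hb φ)
  | hsmul r a ha => intro φ; simp only [map_smul, smul_eq_mul]; exact contMDiffAt_const.mul (ha φ)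

theorem SmoothExtAt.map {T : M → F →ₗ[ℝ] F} {x : M}
    (hT : ∀ v, ContMDiffAt 𝓘(ℝ, E) 𝓘(ℝ, F) ∞ (fun y => T y v) x) {g : M → ExteriorAlgebra ℝ F}
    (hg : SmoothExtAt E g x) : SmoothExtAt E (fun y => ExteriorAlgebra.map (T y) (g y)) x := by
  intro φ
  let b := Module.finBasis ℝ (ExteriorAlgebra ℝ F)
  have key : ∀ y, φ (ExteriorAlgebra.map (T y) (g y)) =
      ∑ i, b.coord i (g y) * φ (ExteriorAlgebra.map (T y) (b i)) := by
    intro y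
    conv_lhs => rw [← b.sum_repr (g y)]
    simp only [map_sum, map_smul, smul_eq_mul, Basis.coord_apply]
  simp only [key]
  exact contMDiffAt_finsetSum fun i _ => (hg (b.coord i)).mul (SmoothExtAt.map_const hT (b i) φ)

variable {A : M → Type*} [TopologicalSpace (TotalSpace F A)]
  [∀ x, AddCommGroup (A x)] [∀ x, Module ℝ (A x)] [∀ x, TopologicalSpace (A x)]
  [FiberBundle F A] [VectorBundle ℝ F A]

theorem map_symmₗ_linearMapAt (e : Trivialization F (TotalSpace.proj : TotalSpace F A → M))
    [e.IsLinear ℝ] {y : M} (hy : y ∈ e.baseSet) (a : ExteriorAlgebra ℝ (A y)) :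
    ExteriorAlgebra.map (e.symmₗ ℝ y) (ExteriorAlgebra.map (e.linearMapAt ℝ y) a) = a := by
  have : e.symmₗ ℝ y ∘ₗ e.linearMapAt ℝ y = LinearMap.id :=
    LinearMap.ext fun v => e.symmₗ_linearMapAt hy v
  rw [← AlgHom.comp_apply, ExteriorAlgebra.map_comp_map, this, ExteriorAlgebra.map_id]
  rfl

/-- The components of a smooth multisection are smooth in all trivializations of the atlas. -/
theorem SmoothMulti.smoothExtAt [IsManifold 𝓘(ℝ, E) ∞ M] [ContMDiffVectorBundle ∞ F A 𝓘(ℝ, E)]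
    (e : Trivialization F (TotalSpace.proj : TotalSpace F A → M)) [MemTrivializationAtlas e]
    {P : Π x, ExteriorAlgebra ℝ (A x)} (hP : SmoothMulti E F P) {x : M} (hx : x ∈ e.baseSet) :
    SmoothExtAt E (fun y => ExteriorAlgebra.map (e.linearMapAt ℝ y) (P y)) x := by
  let e' := trivializationAt F A x
  have hx' : x ∈ e'.baseSet := FiberBundle.mem_baseSet_trivializationAt F A x
  have hP' : SmoothExtAt E (fun y => ExteriorAlgebra.map (e'.linearMapAt ℝ y) (P y)) x := hP x
  have hT : ∀ v, ContMDiffAt 𝓘(ℝ, E) 𝓘(ℝ, F) ∞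
      (fun y => ((e'.coordChangeL ℝ e y : F →L[ℝ] F) : F →ₗ[ℝ] F) v) x := fun v =>
    (contMDiffAt_coordChangeL (n := ∞) (IB := 𝓘(ℝ, E)) (e := e') (e' := e) hx' hx).clm_apply
      contMDiffAt_const
  intro φ
  refine (SmoothExtAt.map hT hP' φ).congr_of_eventuallyEq ?_
  filter_upwards [e.open_baseSet.mem_nhds hx, e'.open_baseSet.mem_nhds hx'] with y hy hy'
  congr 1
  rw [← AlgHom.comp_apply, ExteriorAlgebra.map_comp_map]
  congr 2
  ext v
  have h1 := Trivialization.coordChangeL_apply (R := ℝ) e' e ⟨hy', hy⟩ (e'.linearMapAt ℝ y v)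
  rw [LinearMap.comp_apply]
  refine Eq.trans ?_ h1.symm
  rw [e'.symm_linearMapAt hy', Trivialization.linearMapAt_apply, if_pos hy]

end Frames

/-! ### Multisections -/

section MultiBasic

variable {E : Type*} [NormedAddCommGroup E] [NormedSpace ℝ E]
  {M : Type*} [TopologicalSpace M] [ChartedSpace E M]
  {F : Type*} [NormedAddCommGroup F] [NormedSpace ℝ F] [FiniteDimensional ℝ F]
  {A : M → Type*} [TopologicalSpace (TotalSpace F A)]
  [∀ x, AddCommGroup (A x)] [∀ x, Module ℝ (A x)] [∀ x, TopologicalSpace (A x)]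
  [FiberBundle F A] [VectorBundle ℝ F A]

theorem multi_ext {P Q : Multi E F A} (h : ∀ x, P.1 x = Q.1 x) : P = Q :=
  Subtype.ext (funext h)

@[simp] theorem multi_add_apply (P Q : Multi E F A) (x : M) : (P + Q).1 x = P.1 x + Q.1 x := rfl
@[simp] theorem multi_sub_apply (P Q : Multi E F A) (x : M) : (P - Q).1 x = P.1 x - Q.1 x := rfl
@[simp] theorem multi_zero_apply (x : M) : (0 : Multi E F A).1 x = 0 := rfl
@[simp] theorem multi_mul_apply (P Q : Multi E F A) (x : M) : (P * Q).1 x = P.1 x * Q.1 x := rfl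
@[simp] theorem multi_real_smul_apply (r : ℝ) (P : Multi E F A) (x : M) :
    (r • P).1 x = r • P.1 x := rfl
@[simp] theorem ofFn_apply (f : Fn E M) (x : M) :
    (ofFn f : Multi E F A).1 x = algebraMap ℝ _ (f x) := rfl
@[simp] theorem ofSec_apply (u : Sec E F A) (x : M) :
    (ofSec u : Multi E F A).1 x = ExteriorAlgebra.ι ℝ (u x) := rfl

theorem fn_smul_eq (f : Fn E M) (P : Multi E F A) : f • P = ofFn f * P := rfl

@[simp] theorem fn_smul_apply (f : Fn E M) (P : Multi E F A) (x : M) :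
    (f • P).1 x = f x • P.1 x := by
  rw [fn_smul_eq, multi_mul_apply, ofFn_apply, Algebra.smul_def]

/-- Evaluation of multisections at a point. -/
def evalAt (E : Type*) [NormedAddCommGroup E] [NormedSpace ℝ E]
    {M : Type*} [TopologicalSpace M] [ChartedSpace E M]
    {F : Type*} [NormedAddCommGroup F] [NormedSpace ℝ F] [FiniteDimensional ℝ F]
    (A : M → Type*) [TopologicalSpace (TotalSpace F A)]
    [∀ x, AddCommGroup (A x)] [∀ x, Module ℝ (A x)] [∀ x, TopologicalSpace (A x)]
    [FiberBundle F A] [VectorBundle ℝ F A] (x : M) :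
    Multi E F A →ₐ[ℝ] ExteriorAlgebra ℝ (A x) :=
  (Pi.evalAlgHom ℝ _ x).comp (Multi E F A).val

@[simp] theorem evalAt_apply (x : M) (P : Multi E F A) : evalAt E A x P = P.1 x := rfl

/-- `ofSec` as a map of real vector spaces. -/
def ofSecR : Sec E F A →ₗ[ℝ] Multi E F A where
  toFun := ofSec
  map_add' := map_add _
  map_smul' r u := multi_ext fun x => by
    rw [ofSec_apply, ContMDiffSection.coe_smul, Pi.smul_apply, map_smul]
    rfl

@[simp] theorem ofSecR_apply (u : Sec E F A) : ofSecR u = ofSec u := rfl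

/-- `ofFn` as a map of real vector spaces. -/
def ofFnR : Fn E M →ₗ[ℝ] Multi E F A where
  toFun := ofFn
  map_add' := map_add _
  map_smul' r f := multi_ext fun x => by
    rw [ofFn_apply, ContMDiffMap.coe_smul, Pi.smul_apply, smul_eq_mul, map_mul,
      ← Algebra.smul_def]
    rfl

theorem ofSec_fn_smul (f : Fn E M) (u : Sec E F A) : ofSec (f • u) = ofFn f * ofSec u := by
  rw [map_smul, fn_smul_eq]

theorem ofSec_mul_self (u : Sec E F A) : ofSec u * ofSec u = 0 :=
  multi_ext fun x => ExteriorAlgebra.ι_sq_zero (u x)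

end MultiBasic

/-! ### Local frames of the exterior bundle -/

section LocalFrames

open ExteriorAlgebra

variable {E : Type*} [NormedAddCommGroup E] [NormedSpace ℝ E] [FiniteDimensional ℝ E]
  {M : Type*} [TopologicalSpace M] [ChartedSpace E M] [IsManifold 𝓘(ℝ, E) ∞ M] [T2Space M]
  {F : Type*} [NormedAddCommGroup F] [NormedSpace ℝ F]
  {A : M → Type*} [TopologicalSpace (TotalSpace F A)]
  [∀ x, AddCommGroup (A x)] [∀ x, Module ℝ (A x)] [∀ x, TopologicalSpace (A x)]
  [FiberBundle F A] [VectorBundle ℝ F A] [ContMDiffVectorBundle ∞ F A 𝓘(ℝ, E)]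

/-- A bump function at `x`, supported in the domain of the chosen trivialization of `A` at `x`. -/
def trivBump (E F : Type*) [NormedAddCommGroup E] [NormedSpace ℝ E] [FiniteDimensional ℝ E]
    {M : Type*} [TopologicalSpace M] [ChartedSpace E M] [IsManifold 𝓘(ℝ, E) ∞ M] [T2Space M]
    [NormedAddCommGroup F] [NormedSpace ℝ F]
    (A : M → Type*) [TopologicalSpace (TotalSpace F A)] [∀ x, TopologicalSpace (A x)]
    [FiberBundle F A] (x : M) : Fn E M :=
  (exists_bump_eventually (E := E) x (trivializationAt F A x).open_baseSet
    (FiberBundle.mem_baseSet_trivializationAt F A x)).choose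

theorem trivBump_eventually (x : M) : ∀ᶠ y in 𝓝 x, trivBump E F A x y = 1 :=
  (exists_bump_eventually (E := E) x (trivializationAt F A x).open_baseSet
    (FiberBundle.mem_baseSet_trivializationAt F A x)).choose_spec.1

theorem tsupport_trivBump (x : M) :
    tsupport (trivBump E F A x) ⊆ (trivializationAt F A x).baseSet :=
  (exists_bump_eventually (E := E) x (trivializationAt F A x).open_baseSet
    (FiberBundle.mem_baseSet_trivializationAt F A x)).choose_spec.2

theorem eventually_triv (x : M) : ∀ᶠ y in 𝓝 x,
    y ∈ (trivializationAt F A x).baseSet ∧ trivBump E F A x y = 1 :=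
  Filter.Eventually.and ((trivializationAt F A x).open_baseSet.mem_nhds
    (FiberBundle.mem_baseSet_trivializationAt F A x)) (trivBump_eventually x)

/-- The global section which is constant equal to `v` near `x`, in the chosen trivialization. -/
def constSec (E : Type*) [NormedAddCommGroup E] [NormedSpace ℝ E] [FiniteDimensional ℝ E]
    {M : Type*} [TopologicalSpace M] [ChartedSpace E M] [IsManifold 𝓘(ℝ, E) ∞ M] [T2Space M]
    {F : Type*} [NormedAddCommGroup F] [NormedSpace ℝ F]
    (A : M → Type*) [TopologicalSpace (TotalSpace F A)]
    [∀ x, AddCommGroup (A x)] [∀ x, Module ℝ (A x)] [∀ x, TopologicalSpace (A x)]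
    [FiberBundle F A] [VectorBundle ℝ F A] [ContMDiffVectorBundle ∞ F A 𝓘(ℝ, E)] (x : M) :
    F →ₗ[ℝ] Sec E F A where
  toFun v := ⟨fun y => trivBump E F A x y • (trivializationAt F A x).symmₗ ℝ y v, by
    refine ContMDiffOn.smul_section_of_tsupport (trivBump E F A x).contMDiff.contMDiffOn
      (trivializationAt F A x).open_baseSet (tsupport_trivBump x) ?_
    refine (trivializationAt F A x).contMDiffOn_section_baseSet_iff.2 ?_
    refine (contMDiffOn_const (c := v)).congr fun y hy => ?_
    have := (trivializationAt F A x).linearMapAt_symmₗ (R := ℝ) hy v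
    rwa [Trivialization.linearMapAt_apply, if_pos hy] at this⟩
  map_add' v w := by ext y; simp
  map_smul' r v := by ext y; simp [smul_comm r]

theorem constSec_apply (x y : M) (v : F) :
    constSec E A x v y = trivBump E F A x y • (trivializationAt F A x).symmₗ ℝ y v := rfl

variable [FiniteDimensional ℝ F]

/-- The morphism `∧F → Γ(∧A)` extending `constSec`. Near `x` it identifies `∧F` with the fibres of
`∧A`, so that the images of a basis of `∧F` form a frame. -/
def frameHom (E : Type*) [NormedAddCommGroup E] [NormedSpace ℝ E] [FiniteDimensional ℝ E]
    {M : Type*} [TopologicalSpace M] [ChartedSpace E M] [IsManifold 𝓘(ℝ, E) ∞ M] [T2Space M]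
    {F : Type*} [NormedAddCommGroup F] [NormedSpace ℝ F] [FiniteDimensional ℝ F]
    (A : M → Type*) [TopologicalSpace (TotalSpace F A)]
    [∀ x, AddCommGroup (A x)] [∀ x, Module ℝ (A x)] [∀ x, TopologicalSpace (A x)]
    [FiberBundle F A] [VectorBundle ℝ F A] [ContMDiffVectorBundle ∞ F A 𝓘(ℝ, E)] (x : M) :
    ExteriorAlgebra ℝ F →ₐ[ℝ] Multi E F A :=
  ExteriorAlgebra.lift ℝ ⟨ofSecR ∘ₗ constSec E A x, fun _ => ofSec_mul_self _⟩

@[simp] theorem frameHom_ι (x : M) (v : F) :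
    frameHom E A x (ExteriorAlgebra.ι ℝ v) = ofSec (constSec E A x v) := by
  exact ExteriorAlgebra.lift_ι_apply (R := ℝ) (ofSecR ∘ₗ constSec E A x)
    (fun _ => ofSec_mul_self _) v

theorem frameHom_apply {x y : M} (hy : trivBump E F A x y = 1) (a : ExteriorAlgebra ℝ F) :
    (frameHom E A x a).1 y = ExteriorAlgebra.map ((trivializationAt F A x).symmₗ ℝ y) a := by
  have : (evalAt E A y).comp (frameHom E A x) =
      ExteriorAlgebra.map ((trivializationAt F A x).symmₗ ℝ y) := by
    ext v
    simp [constSec_apply, hy]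
  exact congrArg (fun g => g a) this

theorem contMDiff_comp (x : M) (φ : ExteriorAlgebra ℝ F →ₗ[ℝ] ℝ) (P : Multi E F A) :
    ContMDiff 𝓘(ℝ, E) 𝓘(ℝ, ℝ) ∞ (fun y => trivBump E F A x y *
      φ (ExteriorAlgebra.map ((trivializationAt F A x).linearMapAt ℝ y) (P.1 y))) := by
  refine contMDiff_of_tsupport fun y hy => ?_
  have hy' := Set.mem_of_mem_of_subset (tsupport_mul_subset_left hy) (tsupport_trivBump x)
  exact (trivBump E F A x).contMDiff.contMDiffAt.mul
    (SmoothMulti.smoothExtAt (trivializationAt F A x) P.2 hy' φ)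

/-- The component `φ` of a multisection in the chosen trivialization at `x`, cut off outside the
domain of the trivialization. -/
def comp (x : M) (φ : ExteriorAlgebra ℝ F →ₗ[ℝ] ℝ) : Multi E F A →ₗ[ℝ] Fn E M where
  toFun P := ⟨_, contMDiff_comp x φ P⟩
  map_add' P Q := ContMDiffMap.ext fun y => by
    change trivBump E F A x y * _ = trivBump E F A x y * _ + trivBump E F A x y * _
    rw [multi_add_apply, map_add, map_add, mul_add]
  map_smul' r P := ContMDiffMap.ext fun y => by
    change trivBump E F A x y * _ = r * (trivBump E F A x y * _)
    rw [multi_real_smul_apply, map_smul, map_smul, smul_eq_mul]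
    ring

theorem comp_apply (x y : M) (φ : ExteriorAlgebra ℝ F →ₗ[ℝ] ℝ) (P : Multi E F A) :
    comp x φ P y = trivBump E F A x y *
      φ (ExteriorAlgebra.map ((trivializationAt F A x).linearMapAt ℝ y) (P.1 y)) := rfl

/-- Near `x`, a multisection is a combination of exterior products of constant sections. -/
theorem eventually_eq_sum {ι' : Type*} [Fintype ι'] (b : Basis ι' ℝ (ExteriorAlgebra ℝ F)) (x : M) :
    ∀ᶠ y in 𝓝 x, ∀ P : Multi E F A,
      P.1 y = ∑ i, comp x (b.coord i) P y • (frameHom E A x (b i)).1 y := by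
  filter_upwards [eventually_triv (E := E) (F := F) (A := A) x] with y hy P
  conv_lhs => rw [← map_symmₗ_linearMapAt (trivializationAt F A x) hy.1 (P.1 y)]
  conv_lhs => rw [← b.sum_repr
    (ExteriorAlgebra.map ((trivializationAt F A x).linearMapAt ℝ y) (P.1 y))]
  rw [map_sum]
  refine Finset.sum_congr rfl fun i _ => ?_
  rw [comp_apply, hy.2, frameHom_apply hy.2, map_smul, one_mul, Basis.coord_apply]

/-- Near a point, a multisection agrees with one in the subalgebra generated by functions and
sections. -/
theorem exists_mem_adjoin (P : Multi E F A) (x : M) :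
    ∃ Q ∈ Algebra.adjoin ℝ (Set.range (ofFn : Fn E M → Multi E F A) ∪
      Set.range (ofSec : Sec E F A → Multi E F A)), ∀ᶠ y in 𝓝 x, P.1 y = Q.1 y := by
  let b := Module.finBasis ℝ (ExteriorAlgebra ℝ F)
  refine ⟨∑ i, comp x (b.coord i) P • frameHom E A x (b i), ?_, ?_⟩
  · refine sum_mem fun i _ => ?_
    rw [fn_smul_eq]
    refine mul_mem (Algebra.subset_adjoin (Or.inl ⟨_, rfl⟩)) ?_
    induction b i using exterior_induction with
    | h1 => rw [map_one]; exact one_mem _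
    | hι v a ha =>
      rw [map_mul, frameHom_ι]
      exact mul_mem (Algebra.subset_adjoin (Or.inr ⟨_, rfl⟩)) ha
    | hadd a b ha hb => rw [map_add]; exact add_mem ha hb
    | hsmul r a ha => rw [map_smul]; exact Subalgebra.smul_mem _ ha r
  · filter_upwards [eventually_eq_sum (E := E) (A := A) b x] with y hy
    rw [hy P, ← evalAt_apply, map_sum]
    refine Finset.sum_congr rfl fun i _ => ?_
    rw [evalAt_apply, fn_smul_apply]

/-- A section which vanishes near `x` is killed by a bump function at `x`. -/
theorem exists_bump_smul_eq_zero {P : Multi E F A} {x : M} (h : ∀ᶠ y in 𝓝 x, P.1 y = 0) :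
    ∃ ψ : Fn E M, ψ x = 1 ∧ ofFn ψ * P = 0 := by
  obtain ⟨ψ, h1, h2⟩ := exists_bump_forall (E := E) h
  refine ⟨ψ, h1, multi_ext fun y => ?_⟩
  rcases h2 y with h | h <;> simp [h]

theorem exists_bump_mul_eq_zero {f : Fn E M} {x : M} (h : ∀ᶠ y in 𝓝 x, f y = 0) :
    ∃ ψ : Fn E M, ψ x = 1 ∧ ψ * f = 0 := by
  obtain ⟨ψ, h1, h2⟩ := exists_bump_forall (E := E) h
  refine ⟨ψ, h1, ContMDiffMap.ext fun y => ?_⟩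
  rcases h2 y with h | h <;> simp [h]

theorem exists_bump_sec_smul_eq_zero {u : Sec E F A} {x : M} (h : ∀ᶠ y in 𝓝 x, u y = 0) :
    ∃ ψ : Fn E M, ψ x = 1 ∧ ψ • u = 0 := by
  obtain ⟨ψ, h1, h2⟩ := exists_bump_forall (E := E) h
  refine ⟨ψ, h1, ContMDiffSection.ext fun y => ?_⟩
  rcases h2 y with h | h <;> simp [h]

end LocalFrames

/-! ### Hadamard's lemma -/

section Hadamard

variable {E : Type*} [NormedAddCommGroup E] [NormedSpace ℝ E]
  {V : Type*} [NormedAddCommGroup V] [NormedSpace ℝ V] [CompleteSpace V]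

/-- Smoothness of integrals over `[0, 1]` depending smoothly on a parameter. -/
theorem contDiff_integral_param {h : E × ℝ → V} (hh : ContDiff ℝ ∞ h) :
    ContDiff ℝ ∞ (fun y => ∫ t in (0 : ℝ)..1, h (y, t)) := by
  -- the integral is a convolution in `t`, after cutting off `h` outside a compact set
  let χ : ContDiffBump (0 : ℝ) := ⟨2, 3, by norm_num, by norm_num⟩
  let f : ℝ → ℝ := Set.indicator (Set.Ioc 0 1) 1
  let g : E → ℝ → V := fun p s => χ s • h (p, -s)
  have key := MeasureTheory.contDiffOn_convolution_right_with_param_comp (n := ⊤)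
    (μ := MeasureTheory.volume)
    (ContinuousLinearMap.lsmul ℝ ℝ : ℝ →L[ℝ] V →L[ℝ] V) (s := (Set.univ : Set E))
    (v := fun _ : E => (0 : ℝ)) contDiffOn_const (f := f) (g := g) (k := Metric.closedBall 0 3)
    isOpen_univ (isCompact_closedBall _ _) (fun p s _ hs => by
      have : χ s = 0 := χ.zero_of_le_dist (by
        simp only [Metric.mem_closedBall, not_le] at hs
        exact hs.le)
      simp [g, this])
    ((MeasureTheory.integrable_indicator_iff measurableSet_Ioc).2
      ((MeasureTheory.integrableOn_const (by simp)))).locallyIntegrable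
    (by
      refine ContDiff.contDiffOn ?_
      have h1 : ContDiff ℝ ∞ (fun q : E × ℝ => χ q.2) := χ.contDiff.comp contDiff_snd
      exact h1.smul (hh.comp (contDiff_fst.prodMk contDiff_snd.neg)))
  rw [contDiffOn_univ] at key
  convert key using 2 with y
  rw [MeasureTheory.convolution, intervalIntegral.integral_of_le zero_le_one,
    ← MeasureTheory.integral_indicator measurableSet_Ioc]
  congr 1
  ext t
  by_cases ht : t ∈ Set.Ioc (0 : ℝ) 1
  · have : χ (-t) = 1 := χ.one_of_mem_closedBall (by
      have h1 := ht.1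
      have h2 := ht.2
      simp only [Metric.mem_closedBall, dist_zero_right, norm_neg, Real.norm_eq_abs]
      change |t| ≤ 2
      rw [abs_of_pos h1]
      linarith)
    simp [f, g, ht, this]
  · simp [f, ht]

/-- Hadamard's lemma. -/
theorem hadamard {f : E → ℝ} (hf : ContDiff ℝ ∞ f) (x : E) :
    ∃ G : E → E →L[ℝ] ℝ, ContDiff ℝ ∞ G ∧ ∀ y, f y = f x + G y (y - x) := by
  have h1 : ContDiff ℝ ∞ (fun q : E × ℝ => fderiv ℝ f (x + q.2 • (q.1 - x))) :=
    (hf.fderiv_right (m := ∞) (by simp)).comp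
      (contDiff_const.add (contDiff_snd.smul (contDiff_fst.sub contDiff_const)))
  refine ⟨fun y => ∫ t in (0 : ℝ)..1, fderiv ℝ f (x + t • (y - x)),
    contDiff_integral_param h1, fun y => ?_⟩
  have h2 : Continuous (fun t : ℝ => fderiv ℝ f (x + t • (y - x))) :=
    h1.continuous.comp (continuous_const.prodMk continuous_id)
  rw [ContinuousLinearMap.intervalIntegral_apply (h2.intervalIntegrable _ _)]
  have h3 : ∀ t ∈ Set.uIcc (0 : ℝ) 1,
      HasDerivAt (fun t : ℝ => f (x + t • (y - x))) (fderiv ℝ f (x + t • (y - x)) (y - x)) t := by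
    intro t _
    have h4 : HasDerivAt (fun t : ℝ => x + t • (y - x)) (y - x) t := by
      simpa using ((hasDerivAt_id t).smul_const (y - x)).const_add x
    exact ((hf.differentiable (by simp)) _).hasFDerivAt.comp_hasDerivAt t h4
  rw [intervalIntegral.integral_eq_sub_of_hasDerivAt h3
    ((h2.clm_apply continuous_const).intervalIntegrable _ _)]
  simp

end Hadamard

/-! ### Derivations at a point and coordinates -/

section PointDerivations

variable {E : Type*} [NormedAddCommGroup E] [NormedSpace ℝ E] [FiniteDimensional ℝ E]
  {M : Type*} [TopologicalSpace M] [ChartedSpace E M] [IsManifold 𝓘(ℝ, E) ∞ M] [T2Space M]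
  {W : Type*} [AddCommGroup W] [Module ℝ W]

/-- `D` is a derivation at the point `x` of the algebra of smooth functions. -/
def IsPtDer (x : M) (D : Fn E M →ₗ[ℝ] W) : Prop :=
  ∀ f g : Fn E M, D (f * g) = f x • D g + g x • D f

namespace IsPtDer

variable {x : M} {D : Fn E M →ₗ[ℝ] W}

theorem congr_of_eventually (hD : IsPtDer x D) {f g : Fn E M} (h : ∀ᶠ y in 𝓝 x, f y = g y) :
    D f = D g := by
  have h0 : ∀ᶠ y in 𝓝 x, (f - g) y = 0 := by
    filter_upwards [h] with y hy
    simp [hy]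
  obtain ⟨ψ, h1, h2⟩ := exists_bump_mul_eq_zero h0
  have h3 := hD ψ (f - g)
  rw [h2, map_zero, h1, h0.self_of_nhds, one_smul, zero_smul, add_zero, map_sub] at h3
  exact (sub_eq_zero.1 h3.symm)

theorem map_const (hD : IsPtDer x D) (c : ℝ) : D (c • 1) = 0 := by
  have h1 := hD 1 1
  rw [mul_one, ContMDiffMap.coe_one, Pi.one_apply, one_smul] at h1
  rw [map_smul, left_eq_add.1 h1, smul_zero]

end IsPtDer

/-- The differential, in the form of a linear map on `C^∞(M)`. -/
theorem isPtDer_mvfderiv (x : M) (v : TangentSpace 𝓘(ℝ, E) x) :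
    ∃ D : Fn E M →ₗ[ℝ] ℝ, IsPtDer x D ∧ ∀ f, D f = mvfderiv 𝓘(ℝ, E) f x v := by
  have hmul : ∀ f g : Fn E M, mvfderiv 𝓘(ℝ, E) (f * g : Fn E M) x v =
      f x • mvfderiv 𝓘(ℝ, E) g x v + g x • mvfderiv 𝓘(ℝ, E) f x v := fun f g =>
    congrArg (· v) (mvfderiv_mul f.mdifferentiableAt g.mdifferentiableAt)
  have hconst : ∀ c : ℝ, mvfderiv 𝓘(ℝ, E) (c • 1 : Fn E M) x v = 0 := fun c => by
    have : ((c • 1 : Fn E M) : M → ℝ) = fun _ => c := by ext y; simp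
    rw [this, mvfderiv_const]
    rfl
  refine ⟨⟨⟨fun f => mvfderiv 𝓘(ℝ, E) f x v, fun f g => ?_⟩, fun c f => ?_⟩, hmul, fun f => rfl⟩
  · exact congrArg (· v) (mvfderiv_add f.mdifferentiableAt g.mdifferentiableAt)
  · have h1 : c • f = (c • 1 : Fn E M) * f := by ext y; simp
    change mvfderiv 𝓘(ℝ, E) (c • f : Fn E M) x v = _
    rw [h1, hmul, hconst]
    simp

/-- A derivation at `x₀` is determined by its values on the coordinate functions `qⱼ` of a Hadamard
expansion. -/
theorem IsPtDer.eq_sum {x₀ : M} {D : Fn E M →ₗ[ℝ] W} (hD : IsPtDer x₀ D) {ι' : Type*} [Fintype ι']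
    {q : ι' → Fn E M} {f : Fn E M} {g : ι' → Fn E M}
    (h : ∀ᶠ y in 𝓝 x₀, f y = f x₀ + ∑ j, (q j y - q j x₀) * g j y) :
    D f = ∑ j, g j x₀ • D (q j) := by
  have h1 : D f = D (f x₀ • 1 + ∑ j, (q j - q j x₀ • 1) * g j) := by
    refine hD.congr_of_eventually ?_
    filter_upwards [h] with y hy
    rw [hy, ContMDiffMap.coe_add, show ((∑ j, (q j - q j x₀ • 1) * g j : Fn E M) : M → ℝ) =
      ∑ j, (((q j - q j x₀ • 1) * g j : Fn E M) : M → ℝ) from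
        map_sum ContMDiffMap.coeFnRingHom _ _]
    simp
  rw [h1, map_add, hD.map_const, zero_add, map_sum]
  refine Finset.sum_congr rfl fun j _ => ?_
  rw [hD _ (g j), map_sub, hD.map_const, sub_zero]
  simp

/-- Local coordinates `qⱼ` at `x₀` and the coordinate vector fields `Xⱼ`, extended to `M`, with the
Hadamard expansions of functions at `x₀`. -/
theorem exists_coordinates (x₀ : M) :
    ∃ (q : Fin (finrank ℝ E) → Fn E M) (X : Fin (finrank ℝ E) → Vect E M),
      (∀ᶠ y in 𝓝 x₀, ∀ v : TangentSpace 𝓘(ℝ, E) y,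
        v = ∑ j, mvfderiv 𝓘(ℝ, E) (q j) y v • X j y) ∧
      (∀ f : Fn E M, ∃ g : Fin (finrank ℝ E) → Fn E M, (∀ j, g j x₀ = der (X j) f x₀) ∧
        ∀ᶠ y in 𝓝 x₀, f y = f x₀ + ∑ j, (q j y - q j x₀) * g j y) := by
  let b := Module.finBasis ℝ E
  let t := trivializationAt E (fun x : M => TangentSpace 𝓘(ℝ, E) x) x₀
  let φ := extChartAt 𝓘(ℝ, E) x₀
  have hsrc : IsOpen φ.source := isOpen_extChartAt_source x₀
  have hx₀ : x₀ ∈ φ.source := mem_extChartAt_source x₀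
  have hφ : ContMDiffOn 𝓘(ℝ, E) 𝓘(ℝ, E) ∞ φ φ.source := by
    have := contMDiffOn_extChartAt (I := 𝓘(ℝ, E)) (n := ∞) (x := x₀)
    rwa [← extChartAt_source 𝓘(ℝ, E) x₀] at this
  have hcoord : ∀ j, ContMDiff 𝓘(ℝ, E) 𝓘(ℝ, ℝ) ∞ (fun e : E => b.coord j e) := fun j =>
    (b.coord j).toContinuousLinearMap.contMDiff
  choose q hq using fun j => exists_fn_eventuallyEq (E := E) hsrc hx₀
    ((hcoord j).comp_contMDiffOn hφ)
  let X : Fin (finrank ℝ E) → Vect E M := fun j =>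
    constSec E (fun x : M => TangentSpace 𝓘(ℝ, E) x) x₀ (b j)
  have hq' : ∀ᶠ y in 𝓝 x₀, ∀ j, ∀ v : TangentSpace 𝓘(ℝ, E) y,
      mvfderiv 𝓘(ℝ, E) (q j) y v = b.coord j (t.linearMapAt ℝ y v) := by
    rw [Filter.eventually_all]
    intro j
    filter_upwards [(hq j).eventually_nhds, hsrc.mem_nhds hx₀] with y hy hys v
    have h1 : MDifferentiableAt 𝓘(ℝ, E) 𝓘(ℝ, E) φ y :=
      ((hφ y hys).contMDiffAt (hsrc.mem_nhds hys)).mdifferentiableAt (by simp)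
    have h2 : MDifferentiableAt 𝓘(ℝ, E) 𝓘(ℝ, ℝ) (fun e : E => b.coord j e) (φ y) :=
      (hcoord j).mdifferentiable (by simp) _
    have h3 : mfderiv 𝓘(ℝ, E) 𝓘(ℝ, ℝ) (q j) y =
        mfderiv 𝓘(ℝ, E) 𝓘(ℝ, ℝ) ((fun e : E => b.coord j e) ∘ φ) y :=
      Filter.EventuallyEq.mfderiv_eq hy
    have h4 : t.continuousLinearMapAt ℝ y = mfderiv 𝓘(ℝ, E) 𝓘(ℝ, E) φ y :=
      TangentBundle.continuousLinearMapAt_trivializationAt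
        (by rwa [extChartAt_source] at hys)
    have h5 : mfderiv 𝓘(ℝ, E) 𝓘(ℝ, ℝ) (fun e : E => b.coord j e) (φ y) =
        (b.coord j).toContinuousLinearMap := by
      rw [mfderiv_eq_fderiv]
      exact (b.coord j).toContinuousLinearMap.fderiv
    change mfderiv 𝓘(ℝ, E) 𝓘(ℝ, ℝ) (q j) y v = _
    rw [h3, mfderiv_comp y h2 h1, h5, ← h4]
    rfl
  have hX : ∀ᶠ y in 𝓝 x₀, y ∈ t.baseSet ∧ ∀ j, X j y = t.symmₗ ℝ y (b j) := by
    filter_upwards [eventually_triv (E := E) (F := E)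
      (A := fun x : M => TangentSpace 𝓘(ℝ, E) x) x₀] with y hy
    refine ⟨hy.1, fun j => ?_⟩
    change constSec E (fun x : M => TangentSpace 𝓘(ℝ, E) x) x₀ (b j) y = _
    rw [constSec_apply, hy.2, one_smul]
  refine ⟨q, X, ?_, fun f => ?_⟩
  · filter_upwards [hq', hX] with y h1 h2 v
    simp only [h1, h2.2]
    conv_lhs => rw [← t.symmₗ_linearMapAt (R := ℝ) h2.1 v,
      ← b.sum_repr (t.linearMapAt ℝ y v), map_sum]
    simp only [map_smul, Basis.coord_apply]
  · have htgt : IsOpen φ.target := isOpen_extChartAt_target x₀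
    obtain ⟨F, hF⟩ := exists_fn_eventuallyEq (E := E) (M := E) (x := φ x₀) htgt
      (mem_extChartAt_target x₀)
      (f.contMDiff.comp_contMDiffOn (contMDiffOn_extChartAt_symm (I := 𝓘(ℝ, E)) (n := ∞) x₀))
    obtain ⟨G, hG, hFG⟩ := hadamard (contMDiff_iff_contDiff.1 F.contMDiff) (φ x₀)
    choose g hg using fun j => exists_fn_eventuallyEq (E := E) hsrc hx₀
      (g := fun y => G (φ y) (b j))
      ((contMDiff_iff_contDiff.2 (hG.clm_apply contDiff_const)).comp_contMDiffOn hφ)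
    have hcont : ContinuousAt φ x₀ := continuousAt_extChartAt x₀
    have hf : ∀ᶠ y in 𝓝 x₀, f y = f x₀ + ∑ j, (q j y - q j x₀) * g j y := by
      have hq1 : ∀ᶠ y in 𝓝 x₀, ∀ j, q j y = b.coord j (φ y) := Filter.eventually_all.2 hq
      have hg1 : ∀ᶠ y in 𝓝 x₀, ∀ j, g j y = G (φ y) (b j) := Filter.eventually_all.2 hg
      have hF1 : ∀ᶠ y in 𝓝 x₀, F (φ y) = f y := by
        filter_upwards [hcont.eventually hF, hsrc.mem_nhds hx₀] with y h1 h2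
        rw [h1, Function.comp_apply]
        exact congrArg f (φ.left_inv h2)
      filter_upwards [hq1, hg1, hF1] with y h1 h2 h3
      rw [← h3, ← hF1.self_of_nhds, hFG]
      congr 1
      simp only [h1, h2, hq1.self_of_nhds, ← map_sub]
      conv_lhs => rw [← b.sum_repr (φ y - φ x₀), map_sum]
      simp only [map_smul, smul_eq_mul, Basis.coord_apply]
    refine ⟨g, fun i => ?_, hf⟩
    obtain ⟨D, hD, hD2⟩ := isPtDer_mvfderiv (E := E) x₀ (X i x₀)
    have h2 : ∀ j, D (q j) = if i = j then 1 else 0 := fun j => by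
      rw [hD2, hq'.self_of_nhds, hX.self_of_nhds.2, t.linearMapAt_symmₗ hX.self_of_nhds.1,
        Basis.coord_apply, b.repr_self, Finsupp.single_apply]
    change _ = mvfderiv 𝓘(ℝ, E) f x₀ (X i x₀)
    rw [← hD2, hD.eq_sum hf]
    simp [h2]

end PointDerivations

/-! ### Parity and graded derivations of multisections -/

section GradedDerivations

open ExteriorAlgebra

variable {E : Type*} [NormedAddCommGroup E] [NormedSpace ℝ E] [FiniteDimensional ℝ E]
  {M : Type*} [TopologicalSpace M] [ChartedSpace E M] [IsManifold 𝓘(ℝ, E) ∞ M] [T2Space M]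
  {F : Type*} [NormedAddCommGroup F] [NormedSpace ℝ F] [FiniteDimensional ℝ F]
  {A : M → Type*} [TopologicalSpace (TotalSpace F A)]
  [∀ x, AddCommGroup (A x)] [∀ x, Module ℝ (A x)] [∀ x, TopologicalSpace (A x)]
  [FiberBundle F A] [VectorBundle ℝ F A] [ContMDiffVectorBundle ∞ F A 𝓘(ℝ, E)]

/-- The `s`-th power of the grade involution of `Γ(∧A)`. -/
def twistM (s : ℕ) : Multi E F A →ₐ[ℝ] Multi E F A where
  toFun P := ⟨fun x => twist s (P.1 x), fun x₀ φ => by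
    simp only [map_twist]
    exact P.2 x₀ (φ ∘ₗ (twist s).toLinearMap)⟩
  map_one' := multi_ext fun _ => map_one (twist s)
  map_mul' P Q := multi_ext fun _ => map_mul (twist s) _ _
  map_zero' := multi_ext fun _ => map_zero (twist s)
  map_add' P Q := multi_ext fun _ => map_add (twist s) _ _
  commutes' r := multi_ext fun _ => (twist s).commutes r

theorem twistM_congr {s t : ℕ} (h : Even (s + t)) (P : Multi E F A) : twistM s P = twistM t P :=
  multi_ext fun _ => twist_congr h _

@[simp] theorem twistM_zero (P : Multi E F A) : twistM 0 P = P :=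
  multi_ext fun _ => twist_of_even (by simp) _

theorem twistM_add (s t : ℕ) (P : Multi E F A) : twistM (s + t) P = twistM s (twistM t P) :=
  multi_ext fun _ => twist_add s t _

theorem twistM_one_twistM_one (P : Multi E F A) : twistM 1 (twistM 1 P) = P := by
  rw [← twistM_add, twistM_congr (s := 1 + 1) (t := 0) (by decide), twistM_zero]

@[simp] theorem twistM_ofFn (s : ℕ) (f : Fn E M) :
    twistM s (ofFn f : Multi E F A) = ofFn f :=
  multi_ext fun _ => (twist s).commutes _

@[simp] theorem twistM_ofSec (s : ℕ) (u : Sec E F A) :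
    twistM s (ofSec u) = (-1 : ℝ) ^ s • ofSec u :=
  multi_ext fun _ => twist_ι s _

/-- A multisection whose components all have degrees of the same parity as `p`. -/
def IsPar (p : ℕ) (P : Multi E F A) : Prop := ∀ x, HasPar p (P.1 x)

theorem IsHomog.isPar {p : ℕ} {P : Multi E F A} (h : IsHomog p P) : IsPar p P :=
  fun x => hasPar_of_mem (h x)

theorem isPar_iff {p : ℕ} {P : Multi E F A} : IsPar p P ↔ twistM 1 P = (-1 : ℝ) ^ p • P :=
  ⟨fun h => multi_ext h, fun h x => congrArg (fun P : Multi E F A => P.1 x) h⟩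

theorem IsPar.twistM {p : ℕ} {P : Multi E F A} (h : IsPar p P) (s : ℕ) :
    twistM s P = (-1 : ℝ) ^ (p * s) • P :=
  multi_ext fun x => (h x).twist s

theorem IsPar.congr {p q : ℕ} {P : Multi E F A} (h : IsPar p P) (hpq : Even (p + q)) :
    IsPar q P := by
  rw [isPar_iff] at h ⊢
  rw [h]
  congr 1
  exact neg_one_pow_congr (by
    rw [Nat.even_add] at hpq
    exact hpq)

theorem IsPar.smul {p : ℕ} {P : Multi E F A} (h : IsPar p P) (r : ℝ) : IsPar p (r • P) := by
  rw [isPar_iff] at h ⊢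
  rw [map_smul, h, smul_comm]

theorem IsPar.neg {p : ℕ} {P : Multi E F A} (h : IsPar p P) : IsPar p (-P) := by
  simpa using h.smul (-1)

theorem isPar_zero (p : ℕ) : IsPar p (0 : Multi E F A) := by
  rw [isPar_iff, map_zero, smul_zero]

theorem IsPar.mul {p q : ℕ} {P Q : Multi E F A} (h : IsPar p P) (h' : IsPar q Q) :
    IsPar (p + q) (P * Q) := by
  rw [isPar_iff] at h h' ⊢
  rw [map_mul, h, h', smul_mul_smul_comm, pow_add]

theorem isPar_ofFn (f : Fn E M) : IsPar 0 (ofFn f : Multi E F A) := by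
  rw [isPar_iff]; simp

theorem isPar_ofSec (u : Sec E F A) : IsPar 1 (ofSec u) := by
  rw [isPar_iff]; simp

theorem IsPar.mul_comm {p : ℕ} {P : Multi E F A} (h : IsPar p P) (Q : Multi E F A) :
    P * Q = LieAlgd.twistM p Q * P :=
  multi_ext fun x => (h x).mul_comm (Q.1 x)

theorem IsPar.mul_comm' {p q : ℕ} {P Q : Multi E F A} (h : IsPar p P) (h' : IsPar q Q) :
    P * Q = (-1 : ℝ) ^ (p * q) • (Q * P) :=
  multi_ext fun x => (h x).mul_comm' (h' x)

theorem ofFn_mul_comm (f : Fn E M) (P : Multi E F A) : ofFn f * P = P * ofFn f := by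
  rw [(isPar_ofFn f).mul_comm, twistM_zero]

/-- The part of `P` of parity `p`. -/
def parPart (p : ℕ) : Multi E F A →ₗ[ℝ] Multi E F A where
  toFun P := (2⁻¹ : ℝ) • (P + (-1 : ℝ) ^ p • twistM 1 P)
  map_add' P Q := by rw [map_add, ← smul_add, smul_add ((-1 : ℝ) ^ p), add_add_add_comm]
  map_smul' r P := by
    rw [map_smul, RingHom.id_apply, smul_comm _ r (twistM 1 P), ← smul_add, smul_comm]

theorem parPart_apply (p : ℕ) (P : Multi E F A) :
    parPart p P = (2⁻¹ : ℝ) • (P + (-1 : ℝ) ^ p • twistM 1 P) := rfl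

theorem isPar_parPart (p : ℕ) (P : Multi E F A) : IsPar p (parPart p P) := by
  rw [isPar_iff, parPart_apply, map_smul, smul_comm]
  congr 1
  rw [map_add, map_smul, twistM_one_twistM_one, smul_add, smul_smul, ← mul_pow]
  simp [add_comm]

theorem parPart_add (P : Multi E F A) : parPart 0 P + parPart 1 P = P := by
  rw [parPart_apply, parPart_apply, ← smul_add]
  simp only [pow_zero, one_smul, pow_one, neg_smul, add_add_add_comm, add_neg_cancel, add_zero]
  rw [← two_smul ℝ P, smul_smul]
  norm_num

theorem parPart_of_isPar {p : ℕ} {P : Multi E F A} (h : IsPar p P) : parPart p P = P := by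
  rw [parPart_apply, isPar_iff.1 h, smul_smul, ← mul_pow]
  simp only [mul_neg, mul_one, neg_neg, one_pow, one_smul]
  rw [← two_smul ℝ P, smul_smul]
  norm_num

theorem parPart_of_isPar_succ {p q : ℕ} {P : Multi E F A} (h : IsPar q P) (hpq : Odd (p + q)) :
    parPart p P = 0 := by
  rw [parPart_apply, isPar_iff.1 h, smul_smul, ← pow_add, hpq.neg_one_pow]
  simp

/-- `δ` is the value at `x` of a graded derivation of `Γ(∧A)` of the parity of `s`. -/
def IsDerAt (s : ℕ) (x : M) (δ : Multi E F A →ₗ[ℝ] ExteriorAlgebra ℝ (A x)) : Prop :=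
  ∀ P Q, δ (P * Q) = δ P * Q.1 x + twist s (P.1 x) * δ Q

namespace IsDerAt

variable {s : ℕ} {x : M} {δ δ' : Multi E F A →ₗ[ℝ] ExteriorAlgebra ℝ (A x)}

/-- Graded derivations are local. -/
theorem congr_of_eventually (h : IsDerAt s x δ) {P Q : Multi E F A}
    (hPQ : ∀ᶠ y in 𝓝 x, P.1 y = Q.1 y) : δ P = δ Q := by
  have h0 : ∀ᶠ y in 𝓝 x, (P - Q).1 y = 0 := by
    filter_upwards [hPQ] with y hy
    rw [multi_sub_apply, hy, sub_self]
  obtain ⟨ψ, h1, h2⟩ := exists_bump_smul_eq_zero h0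
  have h3 := h (ofFn ψ) (P - Q)
  rw [h2, map_zero, h0.self_of_nhds, mul_zero, zero_add, ofFn_apply, h1, map_one, map_one, one_mul,
    map_sub] at h3
  exact sub_eq_zero.1 h3.symm

/-- A graded derivation is determined by its values on functions and sections. -/
theorem ext (h : IsDerAt s x δ) (h' : IsDerAt s x δ') (hf : ∀ f, δ (ofFn f) = δ' (ofFn f))
    (hu : ∀ u, δ (ofSec u) = δ' (ofSec u)) : δ = δ' := by
  refine LinearMap.ext fun P => ?_
  obtain ⟨Q, hQ, hPQ⟩ := exists_mem_adjoin P x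
  rw [h.congr_of_eventually hPQ, h'.congr_of_eventually hPQ]
  clear hPQ
  induction hQ using Algebra.adjoin_induction with
  | mem Q hQ =>
    rcases hQ with ⟨f, rfl⟩ | ⟨u, rfl⟩
    · exact hf f
    · exact hu u
  | algebraMap r =>
    have : algebraMap ℝ (Multi E F A) r = r • ofFn 1 := by
      rw [map_one, Algebra.algebraMap_eq_smul_one]
    rw [this, map_smul, map_smul, hf]
  | add P Q _ _ hP hQ => rw [map_add, map_add, hP, hQ]
  | mul P Q _ _ hP hQ => rw [h, h', hP, hQ]

end IsDerAt

/-- A graded derivation of `Γ(∧A)` of the parity of `s`: the Leibniz rule is written with the grade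
involution, so that it makes sense for arguments which are not homogeneous. -/
structure IsGDer (s : ℕ) (δ : Multi E F A →ₗ[ℝ] Multi E F A) : Prop where
  leib : ∀ P Q, δ (P * Q) = δ P * Q + twistM s P * δ Q
  par : ∀ P, δ (twistM 1 P) = (-1 : ℝ) ^ s • twistM 1 (δ P)

theorem IsGDer.isDerAt {s : ℕ} {δ : Multi E F A →ₗ[ℝ] Multi E F A}
    (h : ∀ P Q, δ (P * Q) = δ P * Q + twistM s P * δ Q) (x : M) :
    IsDerAt s x ((evalAt E A x).toLinearMap ∘ₗ δ) := fun P Q =>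
  congrArg (fun P : Multi E F A => P.1 x) (h P Q)

/-- Operators satisfying the same graded Leibniz rule agree if they agree on functions and
sections. -/
theorem ext_of_leib {s : ℕ} {δ δ' : Multi E F A →ₗ[ℝ] Multi E F A}
    (h : ∀ P Q, δ (P * Q) = δ P * Q + twistM s P * δ Q)
    (h' : ∀ P Q, δ' (P * Q) = δ' P * Q + twistM s P * δ' Q)
    (hf : ∀ f, δ (ofFn f) = δ' (ofFn f)) (hu : ∀ u, δ (ofSec u) = δ' (ofSec u)) : δ = δ' := by
  refine LinearMap.ext fun P => multi_ext fun x => ?_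
  have := (IsGDer.isDerAt h x).ext (IsGDer.isDerAt h' x)
    (fun f => congrArg (fun P : Multi E F A => P.1 x) (hf f))
    (fun u => congrArg (fun P : Multi E F A => P.1 x) (hu u))
  exact congrArg (fun g => g P) this

theorem IsGDer.ext {s : ℕ} {δ δ' : Multi E F A →ₗ[ℝ] Multi E F A} (h : IsGDer s δ)
    (h' : IsGDer s δ') (hf : ∀ f, δ (ofFn f) = δ' (ofFn f))
    (hu : ∀ u, δ (ofSec u) = δ' (ofSec u)) : δ = δ' :=
  ext_of_leib h.leib h'.leib hf hu

/-- The parity of a graded derivation can be checked on functions and sections. -/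
theorem isGDer_of_leib {s : ℕ} {δ : Multi E F A →ₗ[ℝ] Multi E F A}
    (h : ∀ P Q, δ (P * Q) = δ P * Q + twistM s P * δ Q)
    (hf : ∀ f, IsPar s (δ (ofFn f))) (hu : ∀ u, IsPar (s + 1) (δ (ofSec u))) : IsGDer s δ := by
  refine ⟨h, fun P => ?_⟩
  let δ' : Multi E F A →ₗ[ℝ] Multi E F A :=
    (-1 : ℝ) ^ s • ((twistM 1).toLinearMap ∘ₗ δ ∘ₗ (twistM 1).toLinearMap)
  have hδ' : ∀ P, δ' P = (-1 : ℝ) ^ s • twistM 1 (δ (twistM 1 P)) := fun P => rfl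
  have : δ = δ' := by
    refine ext_of_leib h (fun P Q => ?_) (fun f => ?_) (fun u => ?_)
    · rw [hδ', hδ', hδ', map_mul, h, map_add, map_mul, map_mul, twistM_one_twistM_one,
        ← twistM_add, ← twistM_add, twistM_congr (s := 1 + s + 1) (t := s) ⟨s + 1, by ring⟩,
        smul_add, smul_mul_assoc, mul_smul_comm]
    · rw [hδ', twistM_ofFn, isPar_iff.1 (hf f), smul_smul, ← mul_pow]
      simp
    · rw [hδ', twistM_ofSec, map_smul, map_smul, isPar_iff.1 (hu u), smul_smul, smul_smul, pow_succ]
      have h3 : (-1 : ℝ) ^ s * (-1) ^ s = 1 := by rw [← mul_pow]; simp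
      conv_lhs => rw [← one_smul ℝ (δ (ofSec u))]
      congr 1
      linear_combination -h3
  conv_lhs => rw [this, hδ', twistM_one_twistM_one]

theorem IsGDer.isPar {s p : ℕ} {δ : Multi E F A →ₗ[ℝ] Multi E F A} (h : IsGDer s δ)
    {P : Multi E F A} (hP : IsPar p P) : IsPar (p + s) (δ P) := by
  have h1 := h.par P
  rw [isPar_iff.1 hP, map_smul] at h1
  rw [isPar_iff, pow_add, mul_comm, mul_smul, h1, smul_smul, ← mul_pow]
  simp

theorem IsGDer.twistM {s : ℕ} {δ : Multi E F A →ₗ[ℝ] Multi E F A} (h : IsGDer s δ) (t : ℕ)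
    (P : Multi E F A) : δ (twistM t P) = (-1 : ℝ) ^ (s * t) • LieAlgd.twistM t (δ P) := by
  induction t generalizing P with
  | zero => simp
  | succ n ih =>
    rw [twistM_add, ih, h.par, map_smul, smul_smul, ← twistM_add, ← pow_add, mul_add, mul_one]

theorem IsGDer.congr {s t : ℕ} {δ : Multi E F A →ₗ[ℝ] Multi E F A} (h : IsGDer s δ)
    (hst : Even (s + t)) : IsGDer t δ := by
  refine ⟨fun P Q => ?_, fun P => ?_⟩
  · rw [h.leib, twistM_congr hst]
  · rw [h.par]
    congr 1
    exact neg_one_pow_congr (by rw [Nat.even_add] at hst; exact hst)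

theorem IsGDer.add {s : ℕ} {δ δ' : Multi E F A →ₗ[ℝ] Multi E F A} (h : IsGDer s δ)
    (h' : IsGDer s δ') : IsGDer s (δ + δ') := by
  refine ⟨fun P Q => ?_, fun P => ?_⟩
  · simp only [LinearMap.add_apply, h.leib, h'.leib, add_mul, mul_add]
    abel
  · simp only [LinearMap.add_apply, h.par, h'.par, map_add, smul_add]

theorem IsGDer.smul {s : ℕ} {δ : Multi E F A →ₗ[ℝ] Multi E F A} (h : IsGDer s δ) (r : ℝ) :
    IsGDer s (r • δ) := by
  refine ⟨fun P Q => ?_, fun P => ?_⟩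
  · simp only [LinearMap.smul_apply, h.leib, smul_add, smul_mul_assoc, mul_smul_comm]
  · simp only [LinearMap.smul_apply, h.par, map_smul, smul_comm r]

theorem IsGDer.sub {s : ℕ} {δ δ' : Multi E F A →ₗ[ℝ] Multi E F A} (h : IsGDer s δ)
    (h' : IsGDer s δ') : IsGDer s (δ - δ') := by
  refine ⟨fun P Q => ?_, fun P => ?_⟩
  · simp only [LinearMap.sub_apply, h.leib, h'.leib, sub_mul, mul_sub]
    abel
  · simp only [LinearMap.sub_apply, h.par, h'.par, map_sub, smul_sub]

theorem isGDer_zero (s : ℕ) : IsGDer s (0 : Multi E F A →ₗ[ℝ] Multi E F A) :=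
  ⟨fun P Q => by simp, fun P => by simp⟩

/-- Left multiplication of a graded derivation with a multisection. -/
theorem IsGDer.mul_left {s q : ℕ} {δ : Multi E F A →ₗ[ℝ] Multi E F A} (h : IsGDer s δ)
    {Q : Multi E F A} (hQ : IsPar q Q) : IsGDer (s + q) (LinearMap.mulLeft ℝ Q ∘ₗ δ) := by
  refine ⟨fun P R => ?_, fun P => ?_⟩
  · simp only [LinearMap.comp_apply, LinearMap.mulLeft_apply, h.leib, mul_add, ← mul_assoc]
    rw [hQ.mul_comm (LieAlgd.twistM s P), ← twistM_add, add_comm q s]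
  · simp only [LinearMap.comp_apply, LinearMap.mulLeft_apply, h.par, map_mul, isPar_iff.1 hQ]
    rw [smul_mul_assoc, smul_smul, mul_smul_comm, pow_add, mul_assoc, ← mul_pow]
    simp

/-- The graded commutator of two graded derivations is a graded derivation. -/
theorem IsGDer.commutator {s t : ℕ} {δ δ' : Multi E F A →ₗ[ℝ] Multi E F A} (h : IsGDer s δ)
    (h' : IsGDer t δ') : IsGDer (s + t) (δ ∘ₗ δ' - (-1 : ℝ) ^ (s * t) • (δ' ∘ₗ δ)) := by
  have hsq : (-1 : ℝ) ^ (s * t) * (-1) ^ (s * t) = 1 := by rw [← mul_pow]; simp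
  refine ⟨fun P Q => ?_, fun P => ?_⟩
  · simp only [LinearMap.sub_apply, LinearMap.smul_apply, LinearMap.comp_apply, h.leib, h'.leib,
      map_add, h.twistM t, h'.twistM s, mul_comm t s, ← twistM_add, add_comm t s, sub_mul, mul_sub,
      smul_add, smul_mul_assoc, mul_smul_comm, smul_smul, hsq, one_smul]
    abel
  · simp only [LinearMap.sub_apply, LinearMap.smul_apply, LinearMap.comp_apply, h.par, h'.par,
      map_smul, map_sub, smul_sub, smul_smul, pow_add]
    congr 2 <;> ring

/-! ### Extension of derivations from functions and sections -/

section Extension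

variable {s : ℕ} {d0 : Fn E M →ₗ[ℝ] Multi E F A} {d1 : Sec E F A →ₗ[ℝ] Multi E F A}

theorem fn_sum_apply {κ : Type*} (t : Finset κ) (f : κ → Fn E M) (y : M) :
    (∑ i ∈ t, f i) y = ∑ i ∈ t, f i y := by
  rw [← ContMDiffMap.coeFnRingHom_apply, map_sum, Finset.sum_apply]
  rfl

theorem sec_sum_apply {κ : Type*} (t : Finset κ) (u : κ → Sec E F A) (y : M) :
    (∑ i ∈ t, u i) y = ∑ i ∈ t, u i y := by
  rw [← ContMDiffSection.coeAddHom_apply, map_sum, Finset.sum_apply]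
  rfl

/-- The extension of `(d0, d1)` to `Γ(∧A)` at a point: in a local frame it differentiates the
components with `d0` (the operator `S` in the proof) and the frame with `d1` (the algebraic
derivation `D`). -/
theorem exists_isDerAt (h1 : ∀ f g, d0 (f * g) = ofFn f * d0 g + ofFn g * d0 f)
    (h2 : ∀ f u, d1 (f • u) = d0 f * ofSec u + ofFn f * d1 u)
    (p0 : ∀ f, IsPar s (d0 f)) (p1 : ∀ u, IsPar (s + 1) (d1 u)) (x : M) :
    ∃ δ : Multi E F A →ₗ[ℝ] ExteriorAlgebra ℝ (A x), IsDerAt s x δ ∧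
      (∀ f, δ (ofFn f) = (d0 f).1 x) ∧ ∀ u, δ (ofSec u) = (d1 u).1 x := by
  let B := Module.finBasis ℝ (ExteriorAlgebra ℝ F)
  let t := trivializationAt F A x
  have htriv := (eventually_triv (E := E) (F := F) (A := A) x).self_of_nhds
  let d0x : Fn E M →ₗ[ℝ] ExteriorAlgebra ℝ (A x) := (evalAt E A x).toLinearMap ∘ₗ d0
  have hd0x : IsPtDer x d0x := fun f g => by
    change (d0 (f * g)).1 x = f x • (d0 g).1 x + g x • (d0 f).1 x
    rw [h1, multi_add_apply, multi_mul_apply, multi_mul_apply, ofFn_apply, ofFn_apply,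
      Algebra.smul_def, Algebra.smul_def]
  have hpar : ∀ f, HasPar s (d0x f) := fun f => p0 f x
  obtain ⟨D, hDι, hDmul⟩ := exists_algebraic_derivation s
    ((evalAt E A x).toLinearMap ∘ₗ d1 ∘ₗ constSec E A x ∘ₗ t.linearMapAt ℝ x)
    (fun v => p1 _ x)
  let e : ExteriorAlgebra ℝ F →ₐ[ℝ] ExteriorAlgebra ℝ (A x) := (evalAt E A x).comp (frameHom E A x)
  have he : ∀ a, e a = ∑ i, B.coord i a • e (B i) := fun a => by
    conv_lhs => rw [← B.sum_repr a, map_sum]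
    simp only [map_smul, Basis.coord_apply]
  let S : Multi E F A →ₗ[ℝ] ExteriorAlgebra ℝ (A x) :=
    ∑ i, LinearMap.mulRight ℝ (e (B i)) ∘ₗ d0x ∘ₗ comp x (B.coord i)
  have hS : ∀ P, S P = ∑ i, d0x (comp x (B.coord i) P) * e (B i) := fun P => by
    simp [S]
  have hexp : ∀ P : Multi E F A, P.1 x = ∑ i, comp x (B.coord i) P x • e (B i) := fun P =>
    (eventually_eq_sum B x).self_of_nhds P
  have hSmul : ∀ P Q, S (P * Q) = S P * Q.1 x + twist s (P.1 x) * S Q := by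
    intro P Q
    have hc : ∀ i, d0x (comp x (B.coord i) (P * Q)) =
        ∑ j, ∑ k, B.coord i (B j * B k) • (comp x (B.coord j) P x • d0x (comp x (B.coord k) Q) +
          comp x (B.coord k) Q x • d0x (comp x (B.coord j) P)) := by
      intro i
      have : d0x (comp x (B.coord i) (P * Q)) = d0x (∑ j, ∑ k, B.coord i (B j * B k) •
          (comp x (B.coord j) P * comp x (B.coord k) Q)) := by
        refine hd0x.congr_of_eventually ?_
        filter_upwards [eventually_triv (E := E) (F := F) (A := A) x] with y hy
        simp only [fn_sum_apply, ContMDiffMap.coe_smul, ContMDiffMap.coe_mul, Pi.smul_apply,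
          Pi.mul_apply, comp_apply, hy.2, one_mul, smul_eq_mul, multi_mul_apply, map_mul]
        conv_lhs => rw [← B.sum_repr (ExteriorAlgebra.map _ (P.1 y)),
          ← B.sum_repr (ExteriorAlgebra.map _ (Q.1 y))]
        simp only [Finset.sum_mul_sum, map_sum, smul_mul_smul_comm, map_smul, smul_eq_mul]
        refine Finset.sum_congr rfl fun j _ => Finset.sum_congr rfl fun k _ => ?_
        simp only [Basis.coord_apply]
        ring
      rw [this]
      simp only [map_sum, map_smul, hd0x _ _]
    rw [hS]
    simp only [hc, Finset.sum_mul, smul_mul_assoc]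
    rw [Finset.sum_comm]
    have hswap : ∀ j, ∑ i, ∑ k, B.coord i (B j * B k) •
        ((comp x (B.coord j) P x • d0x (comp x (B.coord k) Q) +
          comp x (B.coord k) Q x • d0x (comp x (B.coord j) P)) * e (B i)) =
        ∑ k, (comp x (B.coord j) P x • d0x (comp x (B.coord k) Q) +
          comp x (B.coord k) Q x • d0x (comp x (B.coord j) P)) * (e (B j) * e (B k)) := by
      intro j
      rw [Finset.sum_comm]
      refine Finset.sum_congr rfl fun k _ => ?_
      rw [← map_mul e, he (B j * B k), Finset.mul_sum]
      simp only [mul_smul_comm]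
    simp only [hswap]
    rw [hexp P, hexp Q, hS, hS]
    simp only [map_sum, Finset.sum_mul_sum, map_smul]
    rw [← Finset.sum_add_distrib]
    refine Finset.sum_congr rfl fun j _ => ?_
    rw [← Finset.sum_add_distrib]
    refine Finset.sum_congr rfl fun k _ => ?_
    rw [add_mul, smul_mul_assoc, ← mul_assoc, (hpar _).mul_comm (e (B j)), add_comm]
    simp only [smul_mul_assoc, mul_smul_comm, mul_assoc]
  refine ⟨S + D ∘ₗ (evalAt E A x).toLinearMap, fun P Q => ?_, fun f => ?_, fun u => ?_⟩
  · change S (P * Q) + D (P.1 x * Q.1 x) = (S P + D (P.1 x)) * Q.1 x +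
      twist s (P.1 x) * (S Q + D (Q.1 x))
    rw [hSmul, hDmul, add_mul, mul_add]
    abel
  · have hD1 : D 1 = 0 := by
      have := hDmul 1 1
      rw [mul_one, mul_one, map_one (twist s), one_mul] at this
      exact left_eq_add.1 this
    change S (ofFn f) + D (algebraMap ℝ _ (f x)) = d0x f
    rw [Algebra.algebraMap_eq_smul_one, map_smul, hD1, smul_zero, add_zero, hS]
    have hc : ∀ i, d0x (comp x (B.coord i) (ofFn f : Multi E F A)) = B.coord i 1 • d0x f :=
        fun i => by
      rw [← map_smul]
      refine hd0x.congr_of_eventually ?_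
      filter_upwards [eventually_triv (E := E) (F := F) (A := A) x] with y hy
      rw [comp_apply, hy.2, one_mul, ofFn_apply, AlgHom.commutes, Algebra.algebraMap_eq_smul_one,
        map_smul, ContMDiffMap.coe_smul, Pi.smul_apply, smul_eq_mul, smul_eq_mul, mul_comm]
    simp only [hc, smul_mul_assoc]
    have := he 1
    rw [map_one] at this
    conv_rhs => rw [← mul_one (d0x f), this, Finset.mul_sum]
    simp only [mul_smul_comm]
  · let b := Module.finBasis ℝ F
    -- the components of `u` in the local frame
    let a : Fin (finrank ℝ F) → Fn E M := fun i =>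
      comp x (b.coord i ∘ₗ ExteriorAlgebra.ιInv) (ofSec u)
    have ha : ∀ i y, a i y = trivBump E F A x y * b.coord i (t.linearMapAt ℝ y (u y)) := by
      intro i y
      change trivBump E F A x y * _ = _
      rw [ofSec_apply, map_apply_ι, LinearMap.comp_apply]
      congr 2
      exact ι_leftInverse _
    have hu : ∀ᶠ y in 𝓝 x, u y = (∑ i, a i • constSec E A x (b i)) y := by
      filter_upwards [eventually_triv (E := E) (F := F) (A := A) x] with y hy
      rw [sec_sum_apply]
      conv_lhs => rw [← t.symmₗ_linearMapAt (R := ℝ) hy.1 (u y),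
        ← b.sum_repr (t.linearMapAt ℝ y (u y)), map_sum]
      refine Finset.sum_congr rfl fun i _ => ?_
      rw [sec_smul_apply, ha, hy.2, constSec_apply, hy.2, one_mul,
        one_smul, map_smul, Basis.coord_apply]
    have hd1 : (d1 u).1 x = (d1 (∑ i, a i • constSec E A x (b i))).1 x := by
      have h0 : ∀ᶠ y in 𝓝 x, (u - ∑ i, a i • constSec E A x (b i)) y = 0 := by
        filter_upwards [hu] with y hy
        rw [ContMDiffSection.coe_sub, Pi.sub_apply, hy, sub_self]
      obtain ⟨ψ, hψ1, hψ2⟩ := exists_bump_sec_smul_eq_zero h0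
      have h3 := congrArg (fun P : Multi E F A => P.1 x)
        (h2 ψ (u - ∑ i, a i • constSec E A x (b i)))
      simp only [multi_add_apply, multi_mul_apply, ofSec_apply] at h3
      rw [hψ2, h0.self_of_nhds, map_zero, map_zero, mul_zero, zero_add, ofFn_apply, hψ1, map_one,
        one_mul, map_sub, multi_sub_apply, multi_zero_apply] at h3
      exact sub_eq_zero.1 h3.symm
    have hsum : (d1 (∑ i, a i • constSec E A x (b i))).1 x =
        ∑ i, (d0x (a i) * e (ι ℝ (b i)) + a i x • (d1 (constSec E A x (b i))).1 x) := by
      rw [map_sum, ← evalAt_apply, map_sum]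
      refine Finset.sum_congr rfl fun i _ => ?_
      rw [h2, map_add, map_mul, map_mul, evalAt_apply x (ofFn _), ofFn_apply, ← Algebra.smul_def]
      change _ = _ * evalAt E A x (frameHom E A x (ι ℝ (b i))) + _
      rw [frameHom_ι]
      rfl
    change S (ofSec u) + D (ι ℝ (u x)) = (d1 u).1 x
    rw [hd1, hsum, Finset.sum_add_distrib, hDι]
    congr 1
    · rw [hS]
      have hc : ∀ i, comp x (B.coord i) (ofSec u) = ∑ j, B.coord i (ι ℝ (b j)) • a j := fun i => by
        refine ContMDiffMap.ext fun y => ?_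
        simp only [fn_sum_apply, ContMDiffMap.coe_smul, Pi.smul_apply, ha,
          comp_apply, ofSec_apply, map_apply_ι]
        conv_lhs => rw [← b.sum_repr (t.linearMapAt ℝ y (u y))]
        simp only [map_sum, map_smul, Finset.mul_sum, smul_eq_mul]
        refine Finset.sum_congr rfl fun j _ => ?_
        simp only [Basis.coord_apply]
        ring
      simp only [hc, map_sum, map_smul, Finset.sum_mul, smul_mul_assoc]
      rw [Finset.sum_comm]
      refine Finset.sum_congr rfl fun j _ => ?_
      rw [he (ι ℝ (b j)), Finset.mul_sum]
      simp only [mul_smul_comm]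
    · change (d1 (constSec E A x (t.linearMapAt ℝ x (u x)))).1 x = _
      conv_lhs => rw [← b.sum_repr (t.linearMapAt ℝ x (u x))]
      rw [map_sum, map_sum, ← evalAt_apply, map_sum]
      refine Finset.sum_congr rfl fun i _ => ?_
      rw [map_smul, map_smul, map_smul, ha, htriv.2, one_mul]
      rfl

/-- A pair of operators on functions and on sections which satisfy the Leibniz rules extends to
a graded derivation of `Γ(∧A)`. -/
theorem exists_isGDer (h1 : ∀ f g, d0 (f * g) = ofFn f * d0 g + ofFn g * d0 f)
    (h2 : ∀ f u, d1 (f • u) = d0 f * ofSec u + ofFn f * d1 u)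
    (p0 : ∀ f, IsPar s (d0 f)) (p1 : ∀ u, IsPar (s + 1) (d1 u)) :
    ∃ δ : Multi E F A →ₗ[ℝ] Multi E F A, IsGDer s δ ∧
      (∀ f, δ (ofFn f) = d0 f) ∧ ∀ u, δ (ofSec u) = d1 u := by
  choose δ hδ hf hu using exists_isDerAt h1 h2 p0 p1
  have hgen : ∀ Q ∈ Algebra.adjoin ℝ (Set.range (ofFn : Fn E M → Multi E F A) ∪
      Set.range (ofSec : Sec E F A → Multi E F A)), (fun x => δ x Q) ∈ Multi E F A := by
    intro Q hQ
    induction hQ using Algebra.adjoin_induction with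
    | mem Q hQ =>
      rcases hQ with ⟨f, rfl⟩ | ⟨u, rfl⟩
      · simp only [hf]; exact (d0 f).2
      · simp only [hu]; exact (d1 u).2
    | algebraMap r =>
      have : algebraMap ℝ (Multi E F A) r = r • ofFn 1 := by
        rw [map_one, Algebra.algebraMap_eq_smul_one]
      simp only [this, map_smul, hf]
      exact (r • d0 1).2
    | add P Q _ _ hP hQ => simp only [map_add]; exact add_mem hP hQ
    | mul P Q _ _ hP hQ =>
      simp only [hδ _ _ _]
      exact add_mem (mul_mem hP Q.2) (mul_mem (twistM s P).2 hQ)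
  have hsm : ∀ P, (fun x => δ x P) ∈ Multi E F A := by
    intro P x₀ φ
    obtain ⟨Q, hQ, hPQ⟩ := exists_mem_adjoin P x₀
    refine (hgen Q hQ x₀ φ).congr_of_eventuallyEq ?_
    filter_upwards [hPQ.eventually_nhds] with y hy
    rw [(hδ y).congr_of_eventually hy]
  let Δ : Multi E F A →ₗ[ℝ] Multi E F A :=
    { toFun := fun P => ⟨_, hsm P⟩
      map_add' := fun P Q => multi_ext fun x => map_add (δ x) P Q
      map_smul' := fun r P => multi_ext fun x => map_smul (δ x) r P }
  have hΔf : ∀ f, Δ (ofFn f) = d0 f := fun f => multi_ext fun x => hf x f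
  have hΔu : ∀ u, Δ (ofSec u) = d1 u := fun u => multi_ext fun x => hu x u
  exact ⟨Δ, isGDer_of_leib (fun P Q => multi_ext fun x => hδ x P Q)
    (fun f => hΔf f ▸ p0 f) (fun u => hΔu u ▸ p1 u), hΔf, hΔu⟩

/-- `exists_isGDer` for families which depend linearly on a parameter. -/
theorem exists_isGDer_family {X : Type*} [AddCommGroup X] [Module ℝ X] (s : ℕ)
    (d0 : X →ₗ[ℝ] Fn E M →ₗ[ℝ] Multi E F A) (d1 : X →ₗ[ℝ] Sec E F A →ₗ[ℝ] Multi E F A)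
    (h1 : ∀ z f g, d0 z (f * g) = ofFn f * d0 z g + ofFn g * d0 z f)
    (h2 : ∀ z f u, d1 z (f • u) = d0 z f * ofSec u + ofFn f * d1 z u)
    (p0 : ∀ z f, IsPar s (d0 z f)) (p1 : ∀ z u, IsPar (s + 1) (d1 z u)) :
    ∃ δ : X →ₗ[ℝ] Multi E F A →ₗ[ℝ] Multi E F A, ∀ z, IsGDer s (δ z) ∧
      (∀ f, δ z (ofFn f) = d0 z f) ∧ ∀ u, δ z (ofSec u) = d1 z u := by
  choose δ hδ hf hu using fun z => exists_isGDer (h1 z) (h2 z) (p0 z) (p1 z)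
  refine ⟨⟨⟨δ, fun z w => (hδ _).ext ((hδ z).add (hδ w)) (fun f => ?_) (fun u => ?_)⟩,
    fun r z => (hδ _).ext ((hδ z).smul r) (fun f => ?_) (fun u => ?_)⟩,
    fun z => ⟨hδ z, hf z, hu z⟩⟩
  · rw [LinearMap.add_apply, hf, hf, hf, map_add, LinearMap.add_apply]
  · rw [LinearMap.add_apply, hu, hu, hu, map_add, LinearMap.add_apply]
  · rw [LinearMap.smul_apply, hf, hf, map_smul, LinearMap.smul_apply, RingHom.id_apply]
  · rw [LinearMap.smul_apply, hu, hu, map_smul, LinearMap.smul_apply, RingHom.id_apply]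

end Extension

end GradedDerivations

/-! ### Vector fields as derivations -/

section RealScalars

variable {E : Type*} [NormedAddCommGroup E] [NormedSpace ℝ E]
  {M : Type*} [TopologicalSpace M] [ChartedSpace E M]
  {F : Type*} [NormedAddCommGroup F] [NormedSpace ℝ F]
  {V : M → Type*} [TopologicalSpace (TotalSpace F V)]
  [∀ x, AddCommGroup (V x)] [∀ x, Module ℝ (V x)] [∀ x, TopologicalSpace (V x)]
  [FiberBundle F V] [VectorBundle ℝ F V]

/-- Real scalars act on sections through constant functions. -/
instance isScalarTower_sec : IsScalarTower ℝ (Fn E M) (Sec E F V) where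
  smul_assoc r f u := ContMDiffSection.ext fun x => smul_assoc r (f x) (u x)

end RealScalars

section VectorFields

variable {E : Type*} [NormedAddCommGroup E] [NormedSpace ℝ E] [FiniteDimensional ℝ E]
  {M : Type*} [TopologicalSpace M] [ChartedSpace E M] [IsManifold 𝓘(ℝ, E) ∞ M] [T2Space M]

theorem der_smul (X : Vect E M) (r : ℝ) (f : Fn E M) : der X (r • f) = r • der X f := by
  refine ContMDiffMap.ext fun x => ?_
  obtain ⟨D, -, hD⟩ := isPtDer_mvfderiv (E := E) x (X x)
  exact (hD _).symm.trans ((map_smul D r f).trans (congrArg (r • ·) (hD f)))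

/-- The action of vector fields on functions as a bilinear map. -/
def derHom (E : Type*) [NormedAddCommGroup E] [NormedSpace ℝ E] [FiniteDimensional ℝ E]
    (M : Type*) [TopologicalSpace M] [ChartedSpace E M] [IsManifold 𝓘(ℝ, E) ∞ M] [T2Space M] :
    Vect E M →ₗ[ℝ] Fn E M →ₗ[ℝ] Fn E M :=
  LinearMap.mk₂ ℝ der der_add_left
    (fun r X f => ContMDiffMap.ext fun x => map_smul (mvfderiv 𝓘(ℝ, E) f x) r (X x))
    der_add (fun r X f => der_smul X r f)

theorem vbr_add_left (X Y Z : Vect E M) : vbr (X + Y) Z = vbr X Z + vbr Y Z := by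
  ext x
  exact VectorField.mlieBracket_add_left X.mdifferentiableAt Y.mdifferentiableAt

theorem vbr_smul_left (f : Fn E M) (X Y : Vect E M) :
    vbr (f • X) Y = f • vbr X Y - der Y f • X := by
  have h : ∀ X Y : Vect E M, vbr X Y = -vbr Y X := fun X Y => by
    ext x
    exact VectorField.mlieBracket_swap_apply
  rw [h, vbr_smul, h Y X, smul_neg, neg_add, neg_neg, sub_eq_add_neg]

theorem vbr_jacobi (X Y Z : Vect E M) :
    vbr X (vbr Y Z) = vbr (vbr X Y) Z + vbr Y (vbr X Z) := by
  have : CompleteSpace E := FiniteDimensional.complete ℝ E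
  have : IsManifold 𝓘(ℝ, E) (minSmoothness ℝ 3) M := by
    rw [minSmoothness_of_isRCLikeNormedField]
    exact IsManifold.of_le (n := ∞) (WithTop.coe_le_coe.2 (le_top : (3 : ℕ∞) ≤ ⊤))
  have h : ∀ W : Vect E M, ContMDiff 𝓘(ℝ, E) (𝓘(ℝ, E).prod 𝓘(ℝ, E)) (minSmoothness ℝ 2)
      (fun x => TotalSpace.mk' E x (W x)) := fun W =>
    W.contMDiff.of_le (by
      rw [minSmoothness_of_isRCLikeNormedField]
      exact WithTop.coe_le_coe.2 (le_top : (2 : ℕ∞) ≤ ⊤))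
  ext x
  exact VectorField.leibniz_identity_mlieBracket_apply (h X x) (h Y x) (h Z x)

/-- The bracket of vector fields is the commutator of derivations. It follows from the Jacobi
identity for `X`, `Y` and `f Z`, with arbitrary `Z`. -/
theorem der_vbr (X Y : Vect E M) (f : Fn E M) :
    der (vbr X Y) f = der X (der Y f) - der Y (der X f) := by
  have h0 : ∀ Z : Vect E M,
      (der (vbr X Y) f - (der X (der Y f) - der Y (der X f))) • Z = 0 := by
    intro Z
    have h1 := vbr_jacobi X Y (f • Z)
    have h2 := vbr_jacobi X Y Z
    simp only [vbr_smul, vbr_add, h2, smul_add] at h1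
    rw [sub_smul, sub_smul, sub_sub_eq_add_sub, sub_eq_zero]
    rw [← sub_eq_zero] at h1 ⊢
    rw [← neg_eq_zero, ← h1]
    abel
  refine ContMDiffMap.ext fun x => ?_
  -- if the tangent spaces vanish, `f Z` carries no information, but then all derivatives vanish too
  by_contra hx
  have h2 : ∀ v : TangentSpace 𝓘(ℝ, E) x, v = 0 := by
    intro v
    obtain ⟨Z, rfl⟩ := exists_sec (E := E) (F := E)
      (V := fun x : M => TangentSpace 𝓘(ℝ, E) x) x v
    have h3 : (der (vbr X Y) f x - (der X (der Y f) x - der Y (der X f) x)) • Z x = 0 :=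
      congrArg (fun Z : Vect E M => Z x) (h0 Z)
    exact (smul_eq_zero.1 h3).resolve_left (sub_ne_zero.2 hx)
  have h3 : ∀ (Z : Vect E M) (g : Fn E M), der Z g x = 0 := fun Z g => by
    change mvfderiv 𝓘(ℝ, E) g x (Z x) = 0
    rw [h2 (Z x), map_zero]
  apply hx
  change der (vbr X Y) f x = der X (der Y f) x - der Y (der X f) x
  rw [h3, h3, h3, sub_zero]

end VectorFields

/-! ### Homogeneous components -/

section Grading

open ExteriorAlgebra

theorem proj_map {V W : Type*} [AddCommGroup V] [Module ℝ V] [AddCommGroup W] [Module ℝ W]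
    (g : V →ₗ[ℝ] W) (i : ℕ) (a : ExteriorAlgebra ℝ V) :
    GradedAlgebra.proj (fun i : ℕ => ⋀[ℝ]^i W) i (ExteriorAlgebra.map g a) =
      ExteriorAlgebra.map g (GradedAlgebra.proj (fun i : ℕ => ⋀[ℝ]^i V) i a) := by
  induction a using DirectSum.Decomposition.inductionOn (fun i : ℕ => ⋀[ℝ]^i V) with
  | zero => simp only [map_zero]
  | add a b ha hb => simp only [map_add, ha, hb]
  | @homogeneous j a =>
    have h : ExteriorAlgebra.map g a ∈ ⋀[ℝ]^j W := by
      rw [← coe_exteriorPower_map]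
      exact Subtype.mem _
    rw [GradedAlgebra.proj_apply, GradedAlgebra.proj_apply]
    by_cases hij : j = i
    · subst hij
      rw [DirectSum.decompose_of_mem_same (fun i : ℕ => ⋀[ℝ]^i W) h,
        DirectSum.decompose_of_mem_same (fun i : ℕ => ⋀[ℝ]^i V) a.2]
    · rw [DirectSum.decompose_of_mem_ne (fun i : ℕ => ⋀[ℝ]^i W) h hij,
        DirectSum.decompose_of_mem_ne (fun i : ℕ => ⋀[ℝ]^i V) a.2 hij, map_zero]

theorem eq_sum_proj {V : Type*} [AddCommGroup V] [Module ℝ V] [FiniteDimensional ℝ V]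
    (a : ExteriorAlgebra ℝ V) :
    a = ∑ i ∈ Finset.range (finrank ℝ V + 1),
      GradedAlgebra.proj (fun i : ℕ => ⋀[ℝ]^i V) i a := by
  classical
  conv_lhs => rw [← DirectSum.sum_support_decompose (fun i : ℕ => ⋀[ℝ]^i V) a]
  refine Finset.sum_subset (fun i hi => ?_) fun i _ hi => ?_
  · by_contra h
    have h0 : ⋀[ℝ]^i V = ⊥ := by
      rw [← Submodule.finrank_eq_zero (R := ℝ), exteriorPower.finrank_eq,
        Nat.choose_eq_zero_of_lt (by simpa using h)]
    have h1 : (DirectSum.decompose (fun i : ℕ => ⋀[ℝ]^i V) a i : ExteriorAlgebra ℝ V) ∈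
        ⋀[ℝ]^i V := Subtype.mem _
    exact DFinsupp.mem_support_iff.1 hi (Subtype.ext ((Submodule.mem_bot ℝ).1 (h0.le h1)))
  · rw [DFinsupp.notMem_support_iff.1 hi]
    rfl

variable {E : Type*} [NormedAddCommGroup E] [NormedSpace ℝ E]
  {M : Type*} [TopologicalSpace M] [ChartedSpace E M]
  {F : Type*} [NormedAddCommGroup F] [NormedSpace ℝ F] [FiniteDimensional ℝ F]
  {A : M → Type*} [TopologicalSpace (TotalSpace F A)]
  [∀ x, AddCommGroup (A x)] [∀ x, Module ℝ (A x)] [∀ x, TopologicalSpace (A x)]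
  [FiberBundle F A] [VectorBundle ℝ F A]

theorem finrank_fiber (E F : Type*) [NormedAddCommGroup E] [NormedSpace ℝ E]
    {M : Type*} [TopologicalSpace M] [ChartedSpace E M]
    [NormedAddCommGroup F] [NormedSpace ℝ F] [FiniteDimensional ℝ F]
    (A : M → Type*) [TopologicalSpace (TotalSpace F A)]
    [∀ x, AddCommGroup (A x)] [∀ x, Module ℝ (A x)] [∀ x, TopologicalSpace (A x)]
    [FiberBundle F A] [VectorBundle ℝ F A] (x : M) :
    FiniteDimensional ℝ (A x) ∧ finrank ℝ (A x) = finrank ℝ F := by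
  let e := ((trivializationAt F A x).continuousLinearEquivAt ℝ x
    (FiberBundle.mem_baseSet_trivializationAt F A x)).toLinearEquiv
  exact ⟨e.symm.finiteDimensional, e.finrank_eq⟩

/-- The component of degree `i` of a multisection. -/
def homPart (i : ℕ) (P : Multi E F A) : Multi E F A :=
  ⟨fun x => GradedAlgebra.proj (fun i : ℕ => ⋀[ℝ]^i (A x)) i (P.1 x), fun x₀ φ => by
    simp only [← proj_map]
    exact P.2 x₀ (φ ∘ₗ GradedAlgebra.proj (fun i : ℕ => ⋀[ℝ]^i F) i)⟩

theorem isHomog_homPart (i : ℕ) (P : Multi E F A) : IsHomog i (homPart i P) := fun _ =>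
  Subtype.mem _

theorem eq_sum_homPart (P : Multi E F A) :
    P = ∑ i ∈ Finset.range (finrank ℝ F + 1), homPart i P := by
  refine multi_ext fun x => ?_
  obtain ⟨h1, h2⟩ := finrank_fiber E F A x
  rw [← evalAt_apply x (∑ i ∈ _, _), map_sum, ← h2]
  exact eq_sum_proj (P.1 x)

/-- Every multisection is a sum of homogeneous ones. -/
theorem multi_induction {C : Multi E F A → Prop} (P : Multi E F A)
    (homog : ∀ p P, IsHomog p P → C P) (add : ∀ P Q, C P → C Q → C (P + Q)) : C P := by
  rw [eq_sum_homPart P]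
  refine Finset.sum_induction _ C add (homog 0 0 fun x => ?_) fun i _ =>
    homog i _ (isHomog_homPart i P)
  exact zero_mem _

theorem isHomog_ofFn (f : Fn E M) : IsHomog 0 (ofFn f : Multi E F A) := fun x => by
  rw [ofFn_apply]
  exact SetLike.algebraMap_mem_graded (fun i : ℕ => ⋀[ℝ]^i (A x)) (f x)

theorem isHomog_ofSec (u : Sec E F A) : IsHomog 1 (ofSec u) := fun x => by
  rw [ofSec_apply, exteriorPower, pow_one]
  exact LinearMap.mem_range_self _ _

theorem IsHomog.sub {p : ℕ} {P Q : Multi E F A} (hP : IsHomog p P) (hQ : IsHomog p Q) :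
    IsHomog p (P - Q) := fun x => sub_mem (hP x) (hQ x)

theorem IsHomog.smul {p : ℕ} {P : Multi E F A} (hP : IsHomog p P) (r : ℝ) :
    IsHomog p (r • P) := fun x => Submodule.smul_mem _ r (hP x)

end Grading

/-! ### The Euler derivation -/

section Euler

open ExteriorAlgebra

variable {E : Type*} [NormedAddCommGroup E] [NormedSpace ℝ E] [FiniteDimensional ℝ E]
  {M : Type*} [TopologicalSpace M] [ChartedSpace E M] [IsManifold 𝓘(ℝ, E) ∞ M] [T2Space M]
  {F : Type*} [NormedAddCommGroup F] [NormedSpace ℝ F] [FiniteDimensional ℝ F]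
  {A : M → Type*} [TopologicalSpace (TotalSpace F A)]
  [∀ x, AddCommGroup (A x)] [∀ x, Module ℝ (A x)] [∀ x, TopologicalSpace (A x)]
  [FiberBundle F A] [VectorBundle ℝ F A] [ContMDiffVectorBundle ∞ F A 𝓘(ℝ, E)]

/-- A graded Leibniz rule for homogeneous first factors holds for all multisections. -/
theorem leib_of_homog {s : ℕ} {δ : Multi E F A →ₗ[ℝ] Multi E F A}
    (h : ∀ p P Q, IsHomog p P → δ (P * Q) = δ P * Q + (-1 : ℝ) ^ (p * s) • (P * δ Q))
    (P Q : Multi E F A) : δ (P * Q) = δ P * Q + twistM s P * δ Q := by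
  refine multi_induction (C := fun P => δ (P * Q) = δ P * Q + twistM s P * δ Q) P
    (fun p P hP => ?_) fun P P' hP hP' => ?_
  · rw [h p P Q hP, hP.isPar.twistM, smul_mul_assoc]
  · simp only [add_mul, map_add, hP, hP']
    abel

/-- A graded Leibniz rule for multisections of definite parity holds for all multisections. -/
theorem leib_of_par {s : ℕ} {δ : Multi E F A →ₗ[ℝ] Multi E F A}
    (h : ∀ p q P Q, IsPar p P → IsPar q Q →
      δ (P * Q) = δ P * Q + (-1 : ℝ) ^ (p * s) • (P * δ Q))
    (P Q : Multi E F A) : δ (P * Q) = δ P * Q + twistM s P * δ Q := by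
  refine leib_of_homog (fun p P Q hP => ?_) P Q
  refine multi_induction (C := fun Q => δ (P * Q) = δ P * Q + (-1 : ℝ) ^ (p * s) • (P * δ Q)) Q
    (fun q Q hQ => h p q P Q hP.isPar hQ.isPar) fun Q Q' hQ hQ' => ?_
  simp only [mul_add, map_add, hQ, hQ', smul_add]
  abel

variable (E F A) in
theorem exists_euler : ∃ N : Multi E F A →ₗ[ℝ] Multi E F A, IsGDer 0 N ∧
    (∀ f, N (ofFn f) = 0) ∧ ∀ u, N (ofSec u) = ofSec u :=
  exists_isGDer (d0 := 0) (d1 := ofSecR) (fun f g => by simp)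
    (fun f u => by simp [fn_smul_eq]) (fun f => isPar_zero _) fun u => isPar_ofSec u

variable (E F A) in
/-- The derivation of `Γ(∧A)` which multiplies multisections of degree `p` by `p`. -/
def euler : Multi E F A →ₗ[ℝ] Multi E F A := (exists_euler E F A).choose

theorem isGDer_euler : IsGDer 0 (euler E F A) := (exists_euler E F A).choose_spec.1

@[simp] theorem euler_ofFn (f : Fn E M) : euler E F A (ofFn f) = 0 :=
  (exists_euler E F A).choose_spec.2.1 f

@[simp] theorem euler_ofSec (u : Sec E F A) : euler E F A (ofSec u) = ofSec u :=
  (exists_euler E F A).choose_spec.2.2 u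

/-- A pointwise derivation is determined by its restriction to sections. -/
theorem apply_eq_extDer {x : M} {δ : Multi E F A →ₗ[ℝ] ExteriorAlgebra ℝ (A x)}
    (hδ : IsDerAt 0 x δ) (T : A x →ₗ[ℝ] A x) (hf : ∀ f, δ (ofFn f) = 0)
    (hu : ∀ u : Sec E F A, δ (ofSec u) = ι ℝ (T (u x))) (P : Multi E F A) :
    δ P = extDer T (P.1 x) := by
  have : δ = extDer T ∘ₗ (evalAt E A x).toLinearMap := by
    refine hδ.ext (fun P Q => ?_) (fun f => ?_) fun u => ?_
    · change extDer T (P.1 x * Q.1 x) =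
        extDer T (P.1 x) * Q.1 x + twist 0 (P.1 x) * extDer T (Q.1 x)
      rw [extDer_mul, twist_of_even (by simp)]
    · rw [hf]
      exact (extDer_algebraMap T _).symm
    · rw [hu]
      exact (extDer_ι T _).symm
  rw [this]
  rfl

theorem euler_apply (P : Multi E F A) (x : M) :
    (euler E F A P).1 x = extDer LinearMap.id (P.1 x) := by
  refine apply_eq_extDer (IsGDer.isDerAt isGDer_euler.leib x) LinearMap.id (fun f => ?_)
    (fun u => ?_) P
  · rw [LinearMap.comp_apply, euler_ofFn, map_zero]
  · rw [LinearMap.comp_apply, euler_ofSec]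
    rfl

theorem IsHomog.euler {p : ℕ} {P : Multi E F A} (hP : IsHomog p P) :
    euler E F A P = (p : ℝ) • P :=
  multi_ext fun x => by rw [euler_apply, extDer_id_of_mem (hP x)]; rfl

theorem isHomog_of_euler {p : ℕ} {P : Multi E F A} (hP : euler E F A P = (p : ℝ) • P) :
    IsHomog p P := fun x =>
  mem_of_extDer_id (by rw [← euler_apply, hP]; rfl)

/-- A graded derivation which has degree `c` on functions and sections has degree `c`. Since `c` may
be negative, degrees of values are expressed by eigenvalues of the Euler derivation. -/
theorem IsGDer.euler {s : ℕ} {δ : Multi E F A →ₗ[ℝ] Multi E F A} (h : IsGDer s δ) (c : ℝ)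
    (hf : ∀ f, LieAlgd.euler E F A (δ (ofFn f)) = c • δ (ofFn f))
    (hu : ∀ u, LieAlgd.euler E F A (δ (ofSec u)) = (c + 1) • δ (ofSec u)) {p : ℕ}
    {P : Multi E F A} (hP : IsHomog p P) :
    LieAlgd.euler E F A (δ P) = (p + c) • δ P := by
  have h1 : IsGDer s (LieAlgd.euler E F A ∘ₗ δ - (-1 : ℝ) ^ (0 * s) • (δ ∘ₗ LieAlgd.euler E F A)) :=
    (isGDer_euler.commutator h).congr (by rw [zero_add]; exact ⟨s, rfl⟩)
  have h2 := h1.ext (h.smul c) (fun f => ?_) (fun u => ?_)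
  · have h3 := LinearMap.congr_fun h2 P
    simp only [zero_mul, pow_zero, one_smul, LinearMap.sub_apply, LinearMap.comp_apply, hP.euler,
      map_smul, LinearMap.smul_apply] at h3
    rw [sub_eq_iff_eq_add.1 h3, ← add_smul, add_comm]
  · simp [hf]
  · simp [hu, add_smul]

end Euler

/-! ### Signs in graded identities -/

section Signs

theorem sign_mul_left_fst (q q' : ℕ) : (-1 : ℝ) ^ (q + q') * (-1) ^ (q * 1) = (-1) ^ q' := by
  rw [← pow_add]
  exact neg_one_pow_congr (by grind)

theorem sign_mul_left_snd (q q' : ℕ) :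
    (-1 : ℝ) ^ (q * q') * (-1) ^ q * (-1) ^ (q' * (q + 1)) = (-1) ^ (q + q') := by
  rw [← pow_add, ← pow_add]
  exact neg_one_pow_congr (by grind)

theorem sign_skew_fst (p q q' : ℕ) : (-1 : ℝ) ^ ((p + 1) * (q + q' + 1)) * (-1) ^ (q * q') =
    (-1) ^ ((p + 1) * (q + 1)) * (-1) ^ ((p + (q + 1)) * q') := by
  rw [← pow_add, ← pow_add]
  exact neg_one_pow_congr (by grind)

theorem sign_skew_snd (p q q' : ℕ) : (-1 : ℝ) ^ ((p + 1) * (q + q' + 1)) =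
    (-1) ^ (q * (p + 1)) * (-1) ^ ((p + 1) * (q' + 1)) := by
  rw [← pow_add]
  exact neg_one_pow_congr (by grind)

theorem sign_defect_fst (s p q : ℕ) :
    (-1 : ℝ) ^ (s * (p + 1)) * (-1) ^ ((p + 1) * (q + s + 1)) = (-1) ^ ((p + 1) * (q + 1)) := by
  rw [← pow_add]
  exact neg_one_pow_congr (by grind)

theorem sign_defect_snd (s p q : ℕ) : (-1 : ℝ) ^ ((p + s + 1) * (q + 1)) =
    (-1) ^ ((p + 1) * (q + 1)) * (-1) ^ (s * (q + 1)) := by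
  rw [← pow_add]
  exact neg_one_pow_congr (by grind)

end Signs

section RingInstance

variable {E : Type*} [NormedAddCommGroup E] [NormedSpace ℝ E]
  {M : Type*} [TopologicalSpace M] [ChartedSpace E M]
  {F : Type*} [NormedAddCommGroup F] [NormedSpace ℝ F] [FiniteDimensional ℝ F]
  {A : M → Type*} [TopologicalSpace (TotalSpace F A)]
  [∀ x, AddCommGroup (A x)] [∀ x, Module ℝ (A x)] [∀ x, TopologicalSpace (A x)]
  [FiberBundle F A] [VectorBundle ℝ F A]

/-- A shortcut for instance search. -/
instance multiRing : Ring (Multi E F A) := inferInstance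

end RingInstance

namespace LieAlgebroid

/-! ### Existence of the Schouten bracket -/

section SchoutenExistence

variable {E : Type*} [NormedAddCommGroup E] [NormedSpace ℝ E] [FiniteDimensional ℝ E]
  {M : Type*} [TopologicalSpace M] [ChartedSpace E M] [IsManifold 𝓘(ℝ, E) ∞ M] [T2Space M]
  {F : Type*} [NormedAddCommGroup F] [NormedSpace ℝ F] [FiniteDimensional ℝ F]
  {A : M → Type*} [TopologicalSpace (TotalSpace F A)]
  [∀ x, AddCommGroup (A x)] [∀ x, Module ℝ (A x)] [∀ x, TopologicalSpace (A x)]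
  [FiberBundle F A] [VectorBundle ℝ F A] [ContMDiffVectorBundle ∞ F A 𝓘(ℝ, E)]
  (𝓐 : LieAlgebroid E F A)

theorem bracket_skew (u v : Sec E F A) : 𝓐.bracket u v = -𝓐.bracket v u := by
  have h := 𝓐.bracket_self (u + v)
  simp only [map_add, LinearMap.add_apply, 𝓐.bracket_self, zero_add, add_zero] at h
  exact eq_neg_of_add_eq_zero_right h

theorem bracket_smul_left (f : Fn E M) (u v : Sec E F A) :
    𝓐.bracket (f • u) v = f • 𝓐.bracket u v - der (𝓐.anchor v) f • u := by
  rw [𝓐.bracket_skew, 𝓐.leibniz, 𝓐.bracket_skew v u, smul_neg, neg_add, neg_neg, sub_eq_add_neg]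

/-- The map `(u, f) ↦ ρ(u) f` as a bilinear map. -/
def anchorHom : Sec E F A →ₗ[ℝ] Fn E M →ₗ[ℝ] Fn E M :=
  derHom E M ∘ₗ 𝓐.anchor.restrictScalars ℝ

theorem exists_fnOp : ∃ a : Fn E M →ₗ[ℝ] Multi E F A →ₗ[ℝ] Multi E F A,
    ∀ f, IsGDer 1 (a f) ∧ (∀ g, a f (ofFn g) = 0) ∧
      ∀ u, a f (ofSec u) = -ofFn (der (𝓐.anchor u) f) := by
  refine exists_isGDer_family 1 0
    (𝓐.anchorHom.flip.compr₂ (-(ofFnR : Fn E M →ₗ[ℝ] Multi E F A))) (fun z f g => by simp)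
    (fun z f u => ?_) (fun z f => isPar_zero _) fun z u => (isPar_ofFn _).neg.congr (by decide)
  change -ofFn (der (𝓐.anchor (f • u)) z) = 0 * ofSec u + ofFn f * -ofFn (der (𝓐.anchor u) z)
  rw [map_smul, der_smul_left, map_mul, zero_mul, zero_add, mul_neg]

/-- The operator `[f, ·]` on `Γ(∧A)`, for a function `f`. -/
def fnOp : Fn E M →ₗ[ℝ] Multi E F A →ₗ[ℝ] Multi E F A := 𝓐.exists_fnOp.choose

theorem isGDer_fnOp (f : Fn E M) : IsGDer 1 (𝓐.fnOp f) := (𝓐.exists_fnOp.choose_spec f).1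

@[simp] theorem fnOp_ofFn (f g : Fn E M) : 𝓐.fnOp f (ofFn g) = 0 :=
  (𝓐.exists_fnOp.choose_spec f).2.1 g

@[simp] theorem fnOp_ofSec (f : Fn E M) (u : Sec E F A) :
    𝓐.fnOp f (ofSec u) = -ofFn (der (𝓐.anchor u) f) :=
  (𝓐.exists_fnOp.choose_spec f).2.2 u

theorem exists_secOp : ∃ b : Sec E F A →ₗ[ℝ] Multi E F A →ₗ[ℝ] Multi E F A,
    ∀ u, IsGDer 0 (b u) ∧ (∀ g, b u (ofFn g) = ofFn (der (𝓐.anchor u) g)) ∧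
      ∀ v, b u (ofSec v) = ofSec (𝓐.bracket u v) := by
  refine exists_isGDer_family 0 (𝓐.anchorHom.compr₂ (ofFnR : Fn E M →ₗ[ℝ] Multi E F A))
    (𝓐.bracket.compr₂ (ofSecR : Sec E F A →ₗ[ℝ] Multi E F A))
    (fun z f g => ?_) (fun z f u => ?_) (fun z f => isPar_ofFn _) fun z u => isPar_ofSec _
  · change ofFn (der (𝓐.anchor z) (f * g)) =
      ofFn f * ofFn (der (𝓐.anchor z) g) + ofFn g * ofFn (der (𝓐.anchor z) f)
    rw [der_mul, map_add, map_mul, map_mul]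
  · change ofSec (𝓐.bracket z (f • u)) =
      ofFn (der (𝓐.anchor z) f) * ofSec u + ofFn f * ofSec (𝓐.bracket z u)
    rw [𝓐.leibniz, map_add, ofSec_fn_smul, ofSec_fn_smul, add_comm]

/-- The operator `[u, ·]` on `Γ(∧A)`, for a section `u` of `A`. -/
def secOp : Sec E F A →ₗ[ℝ] Multi E F A →ₗ[ℝ] Multi E F A := 𝓐.exists_secOp.choose

theorem isGDer_secOp (u : Sec E F A) : IsGDer 0 (𝓐.secOp u) := (𝓐.exists_secOp.choose_spec u).1

@[simp] theorem secOp_ofFn (u : Sec E F A) (f : Fn E M) :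
    𝓐.secOp u (ofFn f) = ofFn (der (𝓐.anchor u) f) :=
  (𝓐.exists_secOp.choose_spec u).2.1 f

@[simp] theorem secOp_ofSec (u v : Sec E F A) :
    𝓐.secOp u (ofSec v) = ofSec (𝓐.bracket u v) :=
  (𝓐.exists_secOp.choose_spec u).2.2 v

theorem fnOp_mul (f g : Fn E M) (P : Multi E F A) :
    𝓐.fnOp (f * g) P = ofFn f * 𝓐.fnOp g P + ofFn g * 𝓐.fnOp f P := by
  have h := (𝓐.isGDer_fnOp (f * g)).ext (((𝓐.isGDer_fnOp g).mul_left (isPar_ofFn f)).add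
    ((𝓐.isGDer_fnOp f).mul_left (isPar_ofFn g))) (fun h => ?_) (fun u => ?_)
  · exact LinearMap.congr_fun h P
  · simp
  · simp [der_mul, add_comm]

theorem secOp_smul (f : Fn E M) (u : Sec E F A) (P : Multi E F A) :
    𝓐.secOp (f • u) P = ofFn f * 𝓐.secOp u P + ofSec u * 𝓐.fnOp f P := by
  have h := (𝓐.isGDer_secOp (f • u)).ext (((𝓐.isGDer_secOp u).mul_left (isPar_ofFn f)).add
    (((𝓐.isGDer_fnOp f).mul_left (isPar_ofSec u)).congr (t := 0) (by decide)))
    (fun h => ?_) (fun v => ?_)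
  · exact LinearMap.congr_fun h P
  · rw [LinearMap.add_apply, LinearMap.comp_apply, LinearMap.comp_apply, secOp_ofFn, secOp_ofFn,
      fnOp_ofFn, map_zero, add_zero, map_smul 𝓐.anchor, der_smul_left, map_mul]
    rfl
  · simp only [LinearMap.add_apply, LinearMap.comp_apply, LinearMap.mulLeft_apply, secOp_ofSec,
      fnOp_ofSec]
    rw [bracket_smul_left, map_sub, ofSec_fn_smul, ofSec_fn_smul, mul_neg, ← ofFn_mul_comm,
      sub_eq_add_neg]

/-- The graded derivation `[P, ·]`, for `P` of parity `p`; components of `z` of the other parity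
are ignored. -/
theorem exists_parBracket (p : ℕ) : ∃ D : Multi E F A →ₗ[ℝ] Multi E F A →ₗ[ℝ] Multi E F A,
    ∀ z, IsGDer (p + 1) (D z) ∧ (∀ f, D z (ofFn f) = (-1 : ℝ) ^ p • 𝓐.fnOp f (parPart p z)) ∧
      ∀ u, D z (ofSec u) = -𝓐.secOp u (parPart p z) := by
  refine exists_isGDer_family (p + 1) ((-1 : ℝ) ^ p • (𝓐.fnOp.flip ∘ₗ parPart p))
    (-(𝓐.secOp.flip ∘ₗ parPart p)) (fun z f g => ?_) (fun z f u => ?_) (fun z f => ?_)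
    fun z u => ?_
  · change (-1 : ℝ) ^ p • 𝓐.fnOp (f * g) (parPart p z) =
      ofFn f * (-1 : ℝ) ^ p • 𝓐.fnOp g (parPart p z) +
        ofFn g * (-1 : ℝ) ^ p • 𝓐.fnOp f (parPart p z)
    rw [fnOp_mul, smul_add, mul_smul_comm, mul_smul_comm]
  · change -𝓐.secOp (f • u) (parPart p z) =
      ((-1 : ℝ) ^ p • 𝓐.fnOp f (parPart p z)) * ofSec u + ofFn f * -𝓐.secOp u (parPart p z)
    rw [secOp_smul, (isPar_ofSec u).mul_comm' ((𝓐.isGDer_fnOp f).isPar (isPar_parPart p z))]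
    rw [one_mul, smul_mul_assoc, mul_neg, neg_add_rev, ← neg_smul, pow_add, pow_one]
    simp
  · change IsPar (p + 1) ((-1 : ℝ) ^ p • 𝓐.fnOp f (parPart p z))
    exact (((𝓐.isGDer_fnOp f).isPar (isPar_parPart p z)).smul _).congr ⟨1 + p, by ring⟩
  · change IsPar (p + 1 + 1) (-𝓐.secOp u (parPart p z))
    exact ((𝓐.isGDer_secOp u).isPar (isPar_parPart p z)).neg.congr ⟨p + 1, by ring⟩

/-- A bracket given by graded derivations `[P, ·]` with the values `±[f, P]` and `-[u, P]` on
functions and sections, where the signs depend only on the parity of `P`. The Schouten bracket is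
the only one. -/
structure IsParBracket (br : Multi E F A →ₗ[ℝ] Multi E F A →ₗ[ℝ] Multi E F A) : Prop where
  isGDer : ∀ p P, IsPar p P → IsGDer (p + 1) (br P)
  fn : ∀ p P f, IsPar p P → br P (ofFn f) = (-1 : ℝ) ^ p • 𝓐.fnOp f P
  sec : ∀ P u, br P (ofSec u) = -𝓐.secOp u P

theorem exists_isParBracket : ∃ br, 𝓐.IsParBracket br := by
  obtain ⟨D0, h0⟩ := 𝓐.exists_parBracket 0
  obtain ⟨D1, h1⟩ := 𝓐.exists_parBracket 1
  have h00 : ∀ {p P}, IsPar p P → Odd p → D0 P = 0 := fun {p P} hP hp =>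
    (h0 P).1.ext (isGDer_zero _) (fun f => by
      rw [(h0 P).2.1, parPart_of_isPar_succ hP (by simpa using hp)]; simp) (fun u => by
      rw [(h0 P).2.2, parPart_of_isPar_succ hP (by simpa using hp)]; simp)
  have h11 : ∀ {p P}, IsPar p P → Even p → D1 P = 0 := fun {p P} hP hp =>
    (h1 P).1.ext (isGDer_zero _) (fun f => by
      rw [(h1 P).2.1, parPart_of_isPar_succ hP (by rw [add_comm]; exact hp.add_one)]; simp)
      (fun u => by
      rw [(h1 P).2.2, parPart_of_isPar_succ hP (by rw [add_comm]; exact hp.add_one)]; simp)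
  refine ⟨D0 + D1, ⟨fun p P hP => ?_, fun p P f hP => ?_, fun P u => ?_⟩⟩
  · rw [LinearMap.add_apply]
    rcases Nat.even_or_odd p with hp | hp
    · rw [h11 hP hp, add_zero]
      exact (h0 P).1.congr (by rw [zero_add, add_comm, add_assoc]; exact hp.add (by decide))
    · rw [h00 hP hp, zero_add]
      exact (h1 P).1.congr (by
        simpa [Nat.even_add, parity_simps] using hp)
  · rw [LinearMap.add_apply]
    rcases Nat.even_or_odd p with hp | hp
    · rw [h11 hP hp, add_zero, (h0 P).2.1, parPart_of_isPar (hP.congr (by simpa using hp)),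
        hp.neg_one_pow, pow_zero]
    · rw [h00 hP hp, zero_add, (h1 P).2.1, parPart_of_isPar (hP.congr hp.add_one),
        hp.neg_one_pow, pow_one]
  · rw [LinearMap.add_apply, LinearMap.add_apply, (h0 P).2.2, (h1 P).2.2, ← neg_add, ← map_add,
      parPart_add]

namespace IsParBracket

variable {𝓐} {br : Multi E F A →ₗ[ℝ] Multi E F A →ₗ[ℝ] Multi E F A} (h : 𝓐.IsParBracket br)
include h

theorem br_ofFn (f : Fn E M) : br (ofFn f) = 𝓐.fnOp f :=
  (h.isGDer 0 _ (isPar_ofFn f)).ext (𝓐.isGDer_fnOp f)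
    (fun g => by rw [h.fn 0 _ g (isPar_ofFn f)]; simp) fun u => by rw [h.sec]; simp

theorem br_ofSec (u : Sec E F A) : br (ofSec u) = 𝓐.secOp u :=
  ((h.isGDer 1 _ (isPar_ofSec u)).congr (t := 0) (by decide)).ext (𝓐.isGDer_secOp u)
    (fun g => by rw [h.fn 1 _ g (isPar_ofSec u)]; simp)
    fun v => by rw [h.sec, secOp_ofSec, secOp_ofSec, 𝓐.bracket_skew u v, map_neg]

/-- The Leibniz rule in the first argument. -/
theorem mul_left {q q' : ℕ} {Q Q' : Multi E F A} (hQ : IsPar q Q) (hQ' : IsPar q' Q')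
    (P : Multi E F A) :
    br (Q * Q') P = Q * br Q' P + (-1 : ℝ) ^ (q * q') • (Q' * br Q P) := by
  have h1 : IsGDer (q + q' + 1) (LinearMap.mulLeft ℝ Q ∘ₗ br Q') :=
    ((h.isGDer q' Q' hQ').mul_left hQ).congr ⟨q + q' + 1, by ring⟩
  have h2 : IsGDer (q + q' + 1) (LinearMap.mulLeft ℝ Q' ∘ₗ br Q) :=
    ((h.isGDer q Q hQ).mul_left hQ').congr ⟨q + q' + 1, by ring⟩
  have h3 := (h.isGDer (q + q') _ (hQ.mul hQ')).ext (h1.add (h2.smul ((-1 : ℝ) ^ (q * q'))))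
    (fun f => ?_) (fun u => ?_)
  · exact LinearMap.congr_fun h3 P
  · simp only [LinearMap.add_apply, LinearMap.comp_apply, LinearMap.mulLeft_apply,
      LinearMap.smul_apply]
    rw [h.fn _ _ f (hQ.mul hQ'), h.fn _ _ f hQ, h.fn _ _ f hQ', (𝓐.isGDer_fnOp f).leib,
      hQ.twistM, mul_smul_comm, mul_smul_comm,
      hQ'.mul_comm' ((𝓐.isGDer_fnOp f).isPar hQ), smul_smul, smul_smul, smul_add, smul_mul_assoc,
      smul_smul, add_comm]
    rw [sign_mul_left_fst, sign_mul_left_snd]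
  · simp only [LinearMap.add_apply, LinearMap.comp_apply, LinearMap.mulLeft_apply,
      LinearMap.smul_apply]
    rw [h.sec, h.sec, h.sec, (𝓐.isGDer_secOp u).leib, twistM_zero, mul_neg, mul_neg,
      hQ'.mul_comm' ((𝓐.isGDer_secOp u).isPar hQ), smul_neg, smul_smul, neg_add_rev, add_zero,
      mul_comm q' q, ← mul_pow]
    simp

/-- Both sides are derivations in `Q`, so that functions and sections suffice for `Q`. -/
theorem skew {p q : ℕ} {P Q : Multi E F A} (hP : IsPar p P) (hQ : IsPar q Q) :
    br P Q = -((-1 : ℝ) ^ ((p + 1) * (q + 1)) • br Q P) := by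
  -- `R` is the right-hand side as a linear function of `Q`, even and odd `Q` having different signs
  let R : Multi E F A →ₗ[ℝ] Multi E F A :=
    -((-1 : ℝ) ^ (p + 1) • (br.flip P ∘ₗ parPart 0) + br.flip P ∘ₗ parPart 1)
  have hR : ∀ {q : ℕ} {Q : Multi E F A}, IsPar q Q →
      R Q = -((-1 : ℝ) ^ ((p + 1) * (q + 1)) • br Q P) := by
    intro q Q hQ
    change -((-1 : ℝ) ^ (p + 1) • br (parPart 0 Q) P + br (parPart 1 Q) P) = _
    rcases Nat.even_or_odd q with hq | hq
    · rw [parPart_of_isPar (hQ.congr (by simpa using hq)),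
        parPart_of_isPar_succ hQ (by rw [add_comm]; exact hq.add_one), map_zero,
        LinearMap.zero_apply, add_zero]
      congr 2
      exact neg_one_pow_congr (by
        simp only [Nat.even_add, Nat.even_mul, hq]; simp)
    · rw [parPart_of_isPar (p := 1) (hQ.congr hq.add_one),
        parPart_of_isPar_succ (p := 0) hQ (by simpa using hq), map_zero, LinearMap.zero_apply,
        smul_zero, zero_add, (hq.add_one.mul_left (p + 1)).neg_one_pow, one_smul]
  have h1 : br P = R := by
    refine ext_of_leib (h.isGDer p P hP).leib (leib_of_par fun q q' Q Q' hQ hQ' => ?_)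
      (fun f => ?_) (fun u => ?_)
    · rw [hR hQ, hR hQ', hR (hQ.mul hQ'), h.mul_left hQ hQ', neg_mul, smul_mul_assoc,
        ((h.isGDer q Q hQ).isPar hP).mul_comm' hQ', mul_neg, mul_smul_comm, smul_neg, smul_smul,
        smul_smul, smul_add, smul_smul, neg_add_rev]
      rw [sign_skew_fst, sign_skew_snd]
    · rw [hR (isPar_ofFn f), h.fn p P f hP, h.br_ofFn, zero_add, mul_one, pow_succ, mul_neg_one,
        neg_smul, neg_neg]
    · rw [hR (isPar_ofSec u), h.sec, h.br_ofSec,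
        ((show Even (1 + 1) from ⟨1, rfl⟩).mul_left (p + 1)).neg_one_pow, one_smul]
  rw [h1, hR hQ]

end IsParBracket

end SchoutenExistence

end LieAlgebroid

namespace LieAlgebroid

open ExteriorAlgebra

variable {E : Type*} [NormedAddCommGroup E] [NormedSpace ℝ E] [FiniteDimensional ℝ E]
  {M : Type*} [TopologicalSpace M] [ChartedSpace E M] [IsManifold 𝓘(ℝ, E) ∞ M] [T2Space M]
  {F : Type*} [NormedAddCommGroup F] [NormedSpace ℝ F] [FiniteDimensional ℝ F]
  {A : M → Type*} [TopologicalSpace (TotalSpace F A)]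
  [∀ x, AddCommGroup (A x)] [∀ x, Module ℝ (A x)] [∀ x, TopologicalSpace (A x)]
  [FiberBundle F A] [VectorBundle ℝ F A] [ContMDiffVectorBundle ∞ F A 𝓘(ℝ, E)]
  (𝓐 : LieAlgebroid E F A)

/-! ### Uniqueness of the Schouten bracket -/

section SchoutenUniqueness

theorem euler_fnOp (f : Fn E M) {p : ℕ} {P : Multi E F A} (hP : IsHomog p P) :
    euler E F A (𝓐.fnOp f P) = ((p : ℝ) - 1) • 𝓐.fnOp f P := by
  rw [(𝓐.isGDer_fnOp f).euler (-1) (fun g => ?_) (fun u => ?_) hP, sub_eq_add_neg]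
  · rw [fnOp_ofFn, map_zero, smul_zero]
  · rw [fnOp_ofSec, map_neg, euler_ofFn, neg_zero, neg_add_cancel, zero_smul]

theorem euler_secOp (u : Sec E F A) {p : ℕ} {P : Multi E F A} (hP : IsHomog p P) :
    euler E F A (𝓐.secOp u P) = (p : ℝ) • 𝓐.secOp u P := by
  rw [(𝓐.isGDer_secOp u).euler 0 (fun g => ?_) (fun v => ?_) hP, add_zero]
  · rw [secOp_ofFn, euler_ofFn, zero_smul]
  · rw [secOp_ofSec, euler_ofSec, zero_add, one_smul]

variable {𝓐} in
theorem IsParBracket.isSchouten {br : Multi E F A →ₗ[ℝ] Multi E F A →ₗ[ℝ] Multi E F A}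
    (h : 𝓐.IsParBracket br) : 𝓐.IsSchouten br where
  homog p q r P Q hP hQ hpq := by
    refine isHomog_of_euler ?_
    rw [(h.isGDer p P hP.isPar).euler ((p : ℝ) - 1) (fun f => ?_) (fun u => ?_) hQ]
    · congr 1
      have : (p : ℝ) + q = r + 1 := by exact_mod_cast hpq
      linarith
    · rw [h.fn p P f hP.isPar, map_smul, 𝓐.euler_fnOp f hP, smul_comm]
    · rw [h.sec, map_neg, 𝓐.euler_secOp u hP, smul_neg, sub_add_cancel]
  skew p q P Q hP hQ := h.skew hP.isPar hQ.isPar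
  leibniz p q P Q R hP hQ := by
    rw [(h.isGDer p P hP.isPar).leib, hQ.isPar.twistM, smul_mul_assoc, mul_comm q (p + 1)]
  fn_fn f g := by rw [h.br_ofFn, fnOp_ofFn]
  sec_fn u f := by rw [h.br_ofSec, secOp_ofFn]
  sec_sec u v := by rw [h.br_ofSec, secOp_ofSec]

variable {𝓐} in
/-- By the Leibniz rule and skew-symmetry, a Schouten bracket is determined by its values on
functions and sections. -/
theorem IsSchouten.eq_of_isParBracket {br br' : Multi E F A →ₗ[ℝ] Multi E F A →ₗ[ℝ] Multi E F A}
    (h' : 𝓐.IsSchouten br') (h : 𝓐.IsParBracket br) : br' = br := by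
  have leib : ∀ {p : ℕ} {P : Multi E F A}, IsHomog p P → ∀ Q R,
      br' P (Q * R) = br' P Q * R + twistM (p + 1) Q * br' P R := fun {p P} hP =>
    leib_of_homog fun q Q R hQ => by rw [h'.leibniz p q P Q R hP hQ, mul_comm q]
  have hf : ∀ f, br' (ofFn f) = 𝓐.fnOp f := fun f => by
    refine ext_of_leib (leib (isHomog_ofFn f)) (𝓐.isGDer_fnOp f).leib (fun g => ?_) (fun u => ?_)
    · rw [h'.fn_fn, fnOp_ofFn]
    · rw [h'.skew 0 1 _ _ (isHomog_ofFn f) (isHomog_ofSec u), h'.sec_fn, fnOp_ofSec]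
      norm_num
  have hu : ∀ u, br' (ofSec u) = 𝓐.secOp u := fun u => by
    refine ext_of_leib (leib (isHomog_ofSec u)) ((𝓐.isGDer_secOp u).congr (by decide)).leib
      (fun g => ?_) (fun v => ?_)
    · rw [h'.sec_fn, secOp_ofFn]
    · rw [h'.sec_sec, secOp_ofSec]
  refine LinearMap.ext fun P => ?_
  refine multi_induction (C := fun P => br' P = br P) P (fun p P hP => ?_) fun P Q hP hQ => ?_
  · refine ext_of_leib (leib hP) (h.isGDer p P hP.isPar).leib (fun f => ?_) (fun u => ?_)
    · rw [h'.skew p 0 _ _ hP (isHomog_ofFn f), h.skew hP.isPar (isPar_ofFn f), hf, h.br_ofFn]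
    · rw [h'.skew p 1 _ _ hP (isHomog_ofSec u), h.skew hP.isPar (isPar_ofSec u), hu, h.br_ofSec]
  · rw [map_add, map_add, hP, hQ]

/-- The Schouten bracket exists and is unique. -/
theorem existsUnique_isSchouten : ∃! br, 𝓐.IsSchouten br := by
  obtain ⟨br, h⟩ := 𝓐.exists_isParBracket
  exact ⟨br, h.isSchouten, fun br' h' => h'.eq_of_isParBracket h⟩

theorem isSchouten_schouten : 𝓐.IsSchouten 𝓐.schouten := by
  have h := 𝓐.existsUnique_isSchouten.exists
  rw [LieAlgebroid.schouten, dif_pos h]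
  exact h.choose_spec

theorem isParBracket_schouten : 𝓐.IsParBracket 𝓐.schouten := by
  obtain ⟨br, h⟩ := 𝓐.exists_isParBracket
  rw [𝓐.isSchouten_schouten.eq_of_isParBracket h]
  exact h

theorem schouten_ofSec (u : Sec E F A) : 𝓐.schouten (ofSec u) = 𝓐.secOp u :=
  𝓐.isParBracket_schouten.br_ofSec u

theorem isGDer_schouten {p : ℕ} {P : Multi E F A} (hP : IsPar p P) :
    IsGDer (p + 1) (𝓐.schouten P) := 𝓐.isParBracket_schouten.isGDer p P hP

/-- The bracket with `f` is the contraction with `-ρ* df`. -/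
theorem fnOp_apply (f : Fn E M) (P : Multi E F A) (x : M) :
    (𝓐.fnOp f P).1 x = -ctr ((mvfderiv 𝓘(ℝ, E) f x).toLinearMap ∘ₗ 𝓐.rho x) (P.1 x) := by
  have h : (evalAt E A x).toLinearMap ∘ₗ 𝓐.fnOp f =
      -(ctr ((mvfderiv 𝓘(ℝ, E) f x).toLinearMap ∘ₗ 𝓐.rho x) ∘ₗ (evalAt E A x).toLinearMap) := by
    refine (IsGDer.isDerAt (𝓐.isGDer_fnOp f).leib x).ext (s := 1) (fun P Q => ?_) (fun g => ?_)
      (fun u => ?_)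
    · change -ctr _ (P.1 x * Q.1 x) = -ctr _ (P.1 x) * Q.1 x + twist 1 (P.1 x) * -ctr _ (Q.1 x)
      rw [ctr_mul, neg_add, neg_mul, mul_neg]
    · rw [LinearMap.comp_apply, fnOp_ofFn, map_zero]
      change 0 = -ctr _ (algebraMap ℝ _ (g x))
      rw [Algebra.algebraMap_eq_smul_one, map_smul, ctr_one, smul_zero, neg_zero]
    · rw [LinearMap.comp_apply, fnOp_ofSec]
      change -algebraMap ℝ _ (mvfderiv 𝓘(ℝ, E) f x (𝓐.anchor u x)) = -ctr _ (ι ℝ (u x))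
      rw [ctr_ι, LinearMap.comp_apply, rho, fiber_apply]
      rfl
  exact LinearMap.congr_fun h P

end SchoutenUniqueness

/-! ### Compatibility of derivations with the Schouten bracket -/

section Defect

variable {s : ℕ} {δ : Multi E F A →ₗ[ℝ] Multi E F A}

/-- The failure of the derivation `δ`, of the parity of `s`, to be compatible with the Schouten
bracket with a multisection `P` of parity `p`. -/
def defect (s : ℕ) (δ : Multi E F A →ₗ[ℝ] Multi E F A) (p : ℕ) (P : Multi E F A) :
    Multi E F A →ₗ[ℝ] Multi E F A :=
  (δ ∘ₗ 𝓐.schouten P - (-1 : ℝ) ^ (s * (p + 1)) • (𝓐.schouten P ∘ₗ δ)) - 𝓐.schouten (δ P)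

theorem defect_apply (p : ℕ) (P Q : Multi E F A) : 𝓐.defect s δ p P Q =
    δ (𝓐.schouten P Q) - (-1 : ℝ) ^ (s * (p + 1)) • 𝓐.schouten P (δ Q) - 𝓐.schouten (δ P) Q := rfl

theorem isGDer_defect (hδ : IsGDer s δ) {p : ℕ} {P : Multi E F A} (hP : IsPar p P) :
    IsGDer (s + (p + 1)) (𝓐.defect s δ p P) :=
  (hδ.commutator (𝓐.isGDer_schouten hP)).sub
    ((𝓐.isGDer_schouten (hδ.isPar hP)).congr ⟨p + s + 1, by ring⟩)

/-- The defect is graded skew-symmetric like the Schouten bracket. -/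
theorem defect_skew (hδ : IsGDer s δ) {p q : ℕ} {P Q : Multi E F A} (hP : IsPar p P)
    (hQ : IsPar q Q) : 𝓐.defect s δ p P Q =
      -((-1 : ℝ) ^ ((p + 1) * (q + 1)) • 𝓐.defect s δ q Q P) := by
  have h := 𝓐.isParBracket_schouten
  rw [defect_apply, defect_apply, h.skew hP hQ, h.skew hP (hδ.isPar hQ), h.skew (hδ.isPar hP) hQ,
    map_neg, map_smul, smul_neg, smul_smul, sign_defect_fst, sign_defect_snd, smul_sub, smul_sub,
    smul_smul]
  abel

/-- Compatibility with the Schouten bracket can be checked on functions and sections. -/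
theorem defect_eq_zero (hδ : IsGDer s δ) (hff : ∀ f g, 𝓐.defect s δ 0 (ofFn f) (ofFn g) = 0)
    (huf : ∀ u f, 𝓐.defect s δ 1 (ofSec u) (ofFn f) = 0)
    (huu : ∀ u v, 𝓐.defect s δ 1 (ofSec u) (ofSec v) = 0) {p : ℕ} {P : Multi E F A}
    (hP : IsPar p P) : 𝓐.defect s δ p P = 0 := by
  have hf : ∀ f, 𝓐.defect s δ 0 (ofFn f) = 0 := fun f => by
    refine (𝓐.isGDer_defect hδ (isPar_ofFn f)).ext (isGDer_zero _) (fun g => ?_) (fun u => ?_)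
    · rw [hff]; rfl
    · rw [𝓐.defect_skew hδ (isPar_ofFn f) (isPar_ofSec u), huf, smul_zero, neg_zero]; rfl
  have hu : ∀ u, 𝓐.defect s δ 1 (ofSec u) = 0 := fun u => by
    refine (𝓐.isGDer_defect hδ (isPar_ofSec u)).ext (isGDer_zero _) (fun g => ?_) (fun v => ?_)
    · rw [huf]; rfl
    · rw [huu]; rfl
  refine (𝓐.isGDer_defect hδ hP).ext (isGDer_zero _) (fun g => ?_) (fun u => ?_)
  · rw [𝓐.defect_skew hδ hP (isPar_ofFn g), hf, LinearMap.zero_apply, smul_zero, neg_zero]; rfl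
  · rw [𝓐.defect_skew hδ hP (isPar_ofSec u), hu, LinearMap.zero_apply, smul_zero, neg_zero]; rfl

theorem defect_fn_fn (hδ : IsGDer s δ) (f g : Fn E M) : 𝓐.defect s δ 0 (ofFn f) (ofFn g) =
    -((-1 : ℝ) ^ s • (𝓐.fnOp f (δ (ofFn g)) + 𝓐.fnOp g (δ (ofFn f)))) := by
  have h := 𝓐.isParBracket_schouten
  rw [defect_apply, h.skew (hδ.isPar (isPar_ofFn f)) (isPar_ofFn g), h.br_ofFn, h.br_ofFn,
    fnOp_ofFn, map_zero, zero_sub, zero_add, mul_one, mul_one, zero_add s, pow_succ, mul_neg_one,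
    neg_smul, neg_neg, smul_add]
  abel

/-- Below the top degree, a multisection which is killed by all sections vanishes. Hence the
compatibility of `δ` with brackets of sections implies the one with brackets of sections and
functions. -/
theorem defect_sec_fn {k : ℕ} (hk : 1 ≤ k) (hk' : k ≤ finrank ℝ F) (hδ : IsGDer s δ)
    (hf : ∀ f, IsHomog (k - 1) (δ (ofFn f))) (hu : ∀ u, IsHomog k (δ (ofSec u)))
    (huu : ∀ u v, 𝓐.defect s δ 1 (ofSec u) (ofSec v) = 0) (u : Sec E F A) (f : Fn E M) :
    𝓐.defect s δ 1 (ofSec u) (ofFn f) = 0 := by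
  have hS := 𝓐.isSchouten_schouten
  have h1 : IsHomog (k - 1) (𝓐.defect s δ 1 (ofSec u) (ofFn f)) := by
    rw [defect_apply, hS.sec_fn]
    exact ((hf _).sub ((hS.homog 1 (k - 1) (k - 1) _ _ (isHomog_ofSec u) (hf f)
      (add_comm _ _)).smul _)).sub
      (hS.homog k 0 (k - 1) _ _ (hu u) (isHomog_ofFn f) (by omega))
  have h2 : ∀ v, 𝓐.defect s δ 1 (ofSec u) (ofFn f) * ofSec v = 0 := fun v => by
    have h3 := (𝓐.isGDer_defect hδ (isPar_ofSec u)).leib (ofFn f) (ofSec v)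
    rwa [← ofSec_fn_smul, huu, huu, mul_zero, add_zero, eq_comm] at h3
  refine multi_ext fun x => ?_
  obtain ⟨h4, h5⟩ := finrank_fiber E F A x
  refine eq_zero_of_forall_mul_ι (j := k - 1) (by omega) (h1 x) fun v => ?_
  obtain ⟨w, rfl⟩ := exists_sec (E := E) (F := F) x v
  exact congrArg (fun P : Multi E F A => P.1 x) (h2 w)

/-- The Jacobi identity for the Schouten bracket. On functions and sections it says that the
operators `[f, ·]` and `[u, ·]` have the expected graded commutators, which are again compared on
functions and sections. -/
theorem defect_schouten {k : ℕ} {τ : Multi E F A} (hτ : IsPar k τ) {p : ℕ} {P : Multi E F A}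
    (hP : IsPar p P) : 𝓐.defect (k + 1) (𝓐.schouten τ) p P = 0 := by
  have h := 𝓐.isParBracket_schouten
  have h1 : ∀ f g P, 𝓐.fnOp f (𝓐.fnOp g P) + 𝓐.fnOp g (𝓐.fnOp f P) = 0 := fun f g P => by
    have h2 := ((𝓐.isGDer_fnOp f).commutator (𝓐.isGDer_fnOp g)).ext (isGDer_zero _)
      (fun g => by simp) (fun u => by simp)
    have h3 := LinearMap.congr_fun h2 P
    simpa using h3
  have h2 : ∀ u f P, 𝓐.secOp u (𝓐.fnOp f P) - 𝓐.fnOp f (𝓐.secOp u P) =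
      𝓐.fnOp (der (𝓐.anchor u) f) P := fun u f P => by
    have h2 := (((𝓐.isGDer_secOp u).commutator (𝓐.isGDer_fnOp f)).congr (t := 1)
      (by decide)).ext (𝓐.isGDer_fnOp (der (𝓐.anchor u) f)) (fun g => by simp) (fun v => by
        simp only [LinearMap.sub_apply, LinearMap.comp_apply, zero_mul,
          pow_zero, one_smul, fnOp_ofSec, secOp_ofSec, map_neg, secOp_ofFn, 𝓐.anchor_bracket,
          der_vbr, map_sub]
        abel)
    have h3 := LinearMap.congr_fun h2 P
    simpa using h3
  have h3 : ∀ u v P, 𝓐.secOp u (𝓐.secOp v P) - 𝓐.secOp v (𝓐.secOp u P) =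
      𝓐.secOp (𝓐.bracket u v) P := fun u v P => by
    have h2 := ((𝓐.isGDer_secOp u).commutator (𝓐.isGDer_secOp v)).ext
      (𝓐.isGDer_secOp (𝓐.bracket u v)) (fun g => by
        simp only [LinearMap.sub_apply, LinearMap.comp_apply, zero_mul,
          pow_zero, one_smul, secOp_ofFn, 𝓐.anchor_bracket, der_vbr, map_sub]) (fun w => by
        simp only [LinearMap.sub_apply, LinearMap.comp_apply, zero_mul,
          pow_zero, one_smul, secOp_ofSec, 𝓐.jacobi u v w, map_add]
        abel)
    have h3 := LinearMap.congr_fun h2 P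
    simpa using h3
  refine 𝓐.defect_eq_zero (𝓐.isGDer_schouten hτ) (fun f g => ?_) (fun u f => ?_) (fun u v => ?_) hP
  · rw [𝓐.defect_fn_fn (𝓐.isGDer_schouten hτ), h.fn k τ f hτ, h.fn k τ g hτ, map_smul, map_smul,
      ← smul_add, h1, smul_zero, smul_zero, neg_zero]
  · rw [defect_apply, h.sec, map_neg, h.br_ofSec, secOp_ofFn, h.fn k τ _ hτ, h.fn k τ f hτ,
      map_smul, LinearMap.neg_apply, h.fn k _ f (by simpa using (𝓐.isGDer_secOp u).isPar hτ),
      ← h2, smul_sub, ((show Even (1 + 1) from ⟨1, rfl⟩).mul_left (k + 1)).neg_one_pow, one_smul]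
    abel
  · rw [defect_apply, h.br_ofSec, secOp_ofSec]
    simp only [h.sec, map_neg, LinearMap.neg_apply]
    rw [((show Even (1 + 1) from ⟨1, rfl⟩).mul_left (k + 1)).neg_one_pow, one_smul,
      ← h3]
    abel

end Defect

end LieAlgebroid

/-! ### Sections of the jet bundle -/

section JetSections

variable {E : Type*} [NormedAddCommGroup E] [NormedSpace ℝ E] [FiniteDimensional ℝ E]
  {M : Type*} [TopologicalSpace M] [ChartedSpace E M] [IsManifold 𝓘(ℝ, E) ∞ M] [T2Space M]
  {F : Type*} [NormedAddCommGroup F] [NormedSpace ℝ F] [FiniteDimensional ℝ F]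
  {A : M → Type*} [TopologicalSpace (TotalSpace F A)]
  [∀ x, AddCommGroup (A x)] [∀ x, Module ℝ (A x)] [∀ x, TopologicalSpace (A x)]
  [FiberBundle F A] [VectorBundle ℝ F A] [ContMDiffVectorBundle ∞ F A 𝓘(ℝ, E)]

namespace JetSec

theorem ext' {ξ η : JetSec E F A} (h1 : ξ.base = η.base) (h2 : ∀ X, ξ.hom X = η.hom X) : ξ = η :=
  Prod.ext h1 (LinearMap.ext h2)

theorem base_add (ξ η : JetSec E F A) : (ξ + η).base = ξ.base + η.base := rfl

theorem hom_add (ξ η : JetSec E F A) (X : Vect E M) : (ξ + η).hom X = ξ.hom X + η.hom X := rfl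

theorem base_smul (f : Fn E M) (ξ : JetSec E F A) : (f • ξ).base = f • ξ.base := rfl

theorem hom_smul (f : Fn E M) (ξ : JetSec E F A) (X : Vect E M) :
    (f • ξ).hom X = f • ξ.hom X - der X f • ξ.base := rfl

theorem hom_neg (ξ : JetSec E F A) (X : Vect E M) : (-ξ).hom X = -ξ.hom X := rfl

theorem hom_j1 (u : Sec E F A) : (j1 u : JetSec E F A).hom = 0 := rfl

theorem j1_add (u v : Sec E F A) : (j1 (u + v) : JetSec E F A) = j1 u + j1 v :=
  ext' rfl fun _ => (add_zero _).symm

theorem ofHom_add (H K : Vect E M →ₗ[Fn E M] Sec E F A) : ofHom (H + K) = ofHom H + ofHom K :=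
  ext' (add_zero _).symm fun _ => rfl

theorem ofHom_smul (f : Fn E M) (H : Vect E M →ₗ[Fn E M] Sec E F A) :
    ofHom (f • H) = f • ofHom H :=
  ext' (smul_zero _).symm fun X => by
    rw [hom_smul]
    change f • H X = f • H X - der X f • (0 : Sec E F A)
    rw [smul_zero, sub_zero]

theorem j1_add_ofHom (ξ : JetSec E F A) : j1 ξ.base + ofHom ξ.hom = ξ :=
  ext' (add_zero _) fun _ => zero_add _

/-- Jet prolongations generate the sections of the jet bundle locally: near a point with
coordinates `q` and frame `X`, a section `H` of `Hom(TM, A)` is `∑ dq_j ⊗ H X_j`, and `df ⊗ u` is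
`j¹(f u) - f j¹u`. Hence a `C^∞(M)`-linear map that vanishes on jet prolongations vanishes. -/
theorem eq_zero_of_j1 {T : JetSec E F A →ₗ[Fn E M] Multi E F A} (hT : ∀ u, T (j1 u) = 0) :
    T = 0 := by
  have h1 : ∀ f u, T (ofHom (dTensor f u)) = 0 := fun f u => by
    have h := congrArg T (j1_smul f u)
    rwa [map_add, map_smul, hT, hT, smul_zero, add_zero, eq_comm] at h
  have h2 : ∀ H, T (ofHom H) = 0 := fun H => by
    refine multi_ext fun x => ?_
    obtain ⟨q, X, hX, -⟩ := exists_coordinates (E := E) x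
    obtain ⟨ψ, hψ1, hψ⟩ := exists_bump_forall (E := E) hX
    have h3 : ψ • H = ∑ j, dTensor (q j) (ψ • H (X j)) := by
      refine LinearMap.ext fun Y => ContMDiffSection.ext fun y => ?_
      rw [LinearMap.sum_apply, sec_sum_apply]
      change ψ y • H Y y = ∑ j, mvfderiv 𝓘(ℝ, E) (q j) y (Y y) • ψ y • H (X j) y
      rcases hψ y with hy | hy
      · rw [← fiber_apply H Y y, congrArg (fiber H y) (hy (Y y)), map_sum, Finset.smul_sum]
        refine Finset.sum_congr rfl fun j _ => ?_
        rw [map_smul, fiber_apply, smul_comm]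
      · simp [hy]
    have h4 : T (ofHom (ψ • H)) = 0 := by
      rw [h3]
      refine Finset.sum_induction _ (fun H => T (ofHom H) = 0) (fun H K hH hK => ?_) ?_
        fun j _ => h1 _ _
      · rw [ofHom_add, map_add, hH, hK, add_zero]
      · exact map_zero T
    rw [ofHom_smul, map_smul] at h4
    have h5 := congrArg (fun P : Multi E F A => P.1 x) h4
    simpa only [fn_smul_apply, hψ1, one_smul] using h5
  refine LinearMap.ext fun ξ => ?_
  rw [← j1_add_ofHom ξ, map_add, hT, h2, add_zero]
  rfl

end JetSec

end JetSections

namespace LieAlgebroid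

open ExteriorAlgebra

variable {E : Type*} [NormedAddCommGroup E] [NormedSpace ℝ E] [FiniteDimensional ℝ E]
  {M : Type*} [TopologicalSpace M] [ChartedSpace E M] [IsManifold 𝓘(ℝ, E) ∞ M] [T2Space M]
  {F : Type*} [NormedAddCommGroup F] [NormedSpace ℝ F] [FiniteDimensional ℝ F]
  {A : M → Type*} [TopologicalSpace (TotalSpace F A)]
  [∀ x, AddCommGroup (A x)] [∀ x, Module ℝ (A x)] [∀ x, TopologicalSpace (A x)]
  [FiberBundle F A] [VectorBundle ℝ F A] [ContMDiffVectorBundle ∞ F A 𝓘(ℝ, E)]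
  (𝓐 : LieAlgebroid E F A)

/-! ### The bracket of jets -/

section JetBracket

theorem base_jetBracket (ξ η : JetSec E F A) :
    (𝓐.jetBracket ξ η).base = 𝓐.bracket ξ.base η.base := rfl

theorem hom_jetBracket (ξ η : JetSec E F A) (X : Vect E M) :
    (𝓐.jetBracket ξ η).hom X = (𝓐.bracket ξ.base (η.hom X) - η.hom (vbr (𝓐.anchor ξ.base) X)) -
      (𝓐.bracket η.base (ξ.hom X) - ξ.hom (vbr (𝓐.anchor η.base) X)) +
      η.hom (𝓐.anchor (ξ.hom X)) - ξ.hom (𝓐.anchor (η.hom X)) := rfl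

theorem jetBracket_skew (ξ η : JetSec E F A) : 𝓐.jetBracket ξ η = -𝓐.jetBracket η ξ := by
  refine JetSec.ext' (𝓐.bracket_skew _ _) fun X => ?_
  rw [JetSec.hom_neg, hom_jetBracket, hom_jetBracket]
  abel

theorem jetBracket_add (ξ η η' : JetSec E F A) :
    𝓐.jetBracket ξ (η + η') = 𝓐.jetBracket ξ η + 𝓐.jetBracket ξ η' := by
  refine JetSec.ext' (map_add _ _ _) fun X => ?_
  simp only [JetSec.hom_add, hom_jetBracket, JetSec.base_add, map_add, vbr_add_left,
    LinearMap.add_apply]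
  abel

/-- The Leibniz rule for the bracket of jets, whose anchor is `j¹u + H ↦ ρ(u)`. -/
theorem jetBracket_smul (ξ : JetSec E F A) (f : Fn E M) (η : JetSec E F A) :
    𝓐.jetBracket ξ (f • η) = f • 𝓐.jetBracket ξ η + der (𝓐.anchor ξ.base) f • η := by
  refine JetSec.ext' (𝓐.leibniz _ _ _) fun X => ?_
  simp only [JetSec.hom_add, hom_jetBracket, JetSec.hom_smul, JetSec.base_smul, base_jetBracket,
    map_sub, map_smul, 𝓐.leibniz, bracket_smul_left, vbr_smul_left, der_vbr, smul_sub, smul_add,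
    sub_smul]
  abel

end JetBracket

/-! ### The adjoint action of jets and the cocycle condition -/

section Adjoint

theorem exists_homOp (H : Vect E M →ₗ[Fn E M] Sec E F A) :
    ∃ D : Multi E F A →ₗ[ℝ] Multi E F A, IsGDer 0 D ∧ (∀ f, D (ofFn f) = 0) ∧
      ∀ u, D (ofSec u) = -ofSec (H (𝓐.anchor u)) := by
  refine exists_isGDer (s := 0) (d0 := 0)
    (d1 := (-(ofSecR : Sec E F A →ₗ[ℝ] Multi E F A)) ∘ₗ (H ∘ₗ 𝓐.anchor).restrictScalars ℝ)
    (fun f g => by simp) (fun f u => ?_) (fun f => isPar_zero _) fun u => (isPar_ofSec _).neg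
  change -ofSec (H (𝓐.anchor (f • u))) = 0 * ofSec u + ofFn f * -ofSec (H (𝓐.anchor u))
  rw [map_smul, map_smul, ofSec_fn_smul, zero_mul, zero_add, mul_neg]

/-- The action of `H ∈ Γ(𝔥)` on multisections. -/
def homOp (H : Vect E M →ₗ[Fn E M] Sec E F A) : Multi E F A →ₗ[ℝ] Multi E F A :=
  (𝓐.exists_homOp H).choose

/-- The adjoint action of `Γ(𝔍A)` on `Γ(∧A)` by derivations; its pointwise values are `ad`. -/
def adM (ξ : JetSec E F A) : Multi E F A →ₗ[ℝ] Multi E F A :=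
  𝓐.secOp ξ.base + 𝓐.homOp ξ.hom

theorem isGDer_adM (ξ : JetSec E F A) : IsGDer 0 (𝓐.adM ξ) :=
  (𝓐.isGDer_secOp _).add (𝓐.exists_homOp ξ.hom).choose_spec.1

theorem adM_ofFn (ξ : JetSec E F A) (f : Fn E M) :
    𝓐.adM ξ (ofFn f) = ofFn (der (𝓐.anchor ξ.base) f) := by
  rw [adM, LinearMap.add_apply, secOp_ofFn, homOp, (𝓐.exists_homOp ξ.hom).choose_spec.2.1, add_zero]

theorem adM_ofSec (ξ : JetSec E F A) (u : Sec E F A) :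
    𝓐.adM ξ (ofSec u) = ofSec (𝓐.bracket ξ.base u) - ofSec (ξ.hom (𝓐.anchor u)) := by
  rw [adM, LinearMap.add_apply, secOp_ofSec, homOp, (𝓐.exists_homOp ξ.hom).choose_spec.2.2,
    sub_eq_add_neg]

theorem ad_eq (ξ : JetSec E F A) (w : Multi E F A) (x : M) :
    𝓐.ad ξ w x = (𝓐.adM ξ w).1 x := by
  rw [ad, schouten_ofSec, adM, LinearMap.add_apply, multi_add_apply]
  congr 1
  have h := (𝓐.exists_homOp ξ.hom).choose_spec
  refine (apply_eq_extDer (IsGDer.isDerAt h.1.leib x) _ (fun f => ?_) (fun u => ?_) w).symm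
  · rw [LinearMap.comp_apply, h.2.1, map_zero]
  · rw [LinearMap.comp_apply, h.2.2]
    change -ι ℝ (ξ.hom (𝓐.anchor u) x) = ι ℝ (-fiber ξ.hom x (𝓐.rho x (u x)))
    rw [map_neg, rho, fiber_apply, fiber_apply]

theorem adM_j1 (u : Sec E F A) : 𝓐.adM (JetSec.j1 u) = 𝓐.secOp u := by
  refine (𝓐.isGDer_adM _).ext (𝓐.isGDer_secOp u) (fun f => ?_) (fun v => ?_)
  · rw [adM_ofFn, secOp_ofFn]; rfl
  · rw [adM_ofSec, secOp_ofSec, JetSec.hom_j1, LinearMap.zero_apply, map_zero, sub_zero]; rfl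

theorem adM_add (ξ η : JetSec E F A) : 𝓐.adM (ξ + η) = 𝓐.adM ξ + 𝓐.adM η := by
  refine (𝓐.isGDer_adM _).ext ((𝓐.isGDer_adM ξ).add (𝓐.isGDer_adM η)) (fun f => ?_) (fun v => ?_)
  · rw [LinearMap.add_apply, adM_ofFn, adM_ofFn, adM_ofFn, JetSec.base_add, map_add, der_add_left,
      map_add]
  · rw [LinearMap.add_apply, adM_ofSec, adM_ofSec, adM_ofSec, JetSec.base_add, JetSec.hom_add,
      map_add 𝓐.bracket, LinearMap.add_apply, map_add, map_add]
    abel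

theorem adM_smul (f : Fn E M) (ξ : JetSec E F A) (P : Multi E F A) :
    𝓐.adM (f • ξ) P = f • 𝓐.adM ξ P := by
  have h := (𝓐.isGDer_adM (f • ξ)).ext ((𝓐.isGDer_adM ξ).mul_left (isPar_ofFn f)) (fun g => ?_)
    (fun v => ?_)
  · exact LinearMap.congr_fun h P
  · change _ = ofFn f * 𝓐.adM ξ (ofFn g)
    rw [adM_ofFn, adM_ofFn, JetSec.base_smul, map_smul, der_smul_left, map_mul]
  · change _ = ofFn f * 𝓐.adM ξ (ofSec v)
    rw [adM_ofSec, adM_ofSec, JetSec.base_smul, JetSec.hom_smul, bracket_smul_left, mul_sub,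
      ← ofSec_fn_smul, ← ofSec_fn_smul, map_sub, map_sub]
    abel

theorem adM_fn_smul (ξ : JetSec E F A) (f : Fn E M) (P : Multi E F A) :
    𝓐.adM ξ (f • P) = f • 𝓐.adM ξ P + der (𝓐.anchor ξ.base) f • P := by
  rw [fn_smul_eq, (𝓐.isGDer_adM ξ).leib, adM_ofFn, twistM_ofFn, add_comm]
  rfl

/-- The cocycle condition can be checked on jet prolongations, since its defect is
`C^∞(M)`-bilinear. -/
theorem cocycle_of_j1 (χ : JetSec E F A →ₗ[Fn E M] Multi E F A)
    (h : ∀ u v, χ (JetSec.j1 (𝓐.bracket u v)) =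
      𝓐.secOp u (χ (JetSec.j1 v)) - 𝓐.secOp v (χ (JetSec.j1 u))) (ξ η : JetSec E F A) :
    χ (𝓐.jetBracket ξ η) = 𝓐.adM ξ (χ η) - 𝓐.adM η (χ ξ) := by
  let C : JetSec E F A → JetSec E F A →ₗ[Fn E M] Multi E F A := fun ξ =>
    { toFun := fun η => χ (𝓐.jetBracket ξ η) - 𝓐.adM ξ (χ η) + 𝓐.adM η (χ ξ)
      map_add' := fun η η' => by
        simp only [jetBracket_add, map_add, adM_add, LinearMap.add_apply]
        abel
      map_smul' := fun f η => by
        rw [jetBracket_smul, map_add, map_smul, map_smul, map_smul, adM_fn_smul, adM_smul,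
          RingHom.id_apply, smul_add, smul_sub]
        abel }
  have hC : ∀ ξ η, C ξ η = χ (𝓐.jetBracket ξ η) - 𝓐.adM ξ (χ η) + 𝓐.adM η (χ ξ) :=
    fun ξ η => rfl
  have hskew : ∀ ξ η, C ξ η = -C η ξ := fun ξ η => by
    rw [hC, hC, jetBracket_skew, map_neg]
    abel
  have h1 : ∀ u, C (JetSec.j1 u) = 0 := fun u => JetSec.eq_zero_of_j1 fun v => by
    rw [hC, jetBracket_j1, h, adM_j1, adM_j1]
    abel
  have h2 : C ξ = 0 := JetSec.eq_zero_of_j1 fun u => by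
    rw [hskew, h1, LinearMap.zero_apply, neg_zero]
  have h3 := LinearMap.congr_fun h2 η
  rw [hC, LinearMap.zero_apply, sub_add, sub_eq_zero] at h3
  exact h3

end Adjoint

end LieAlgebroid

/-! ### Tensors as derivations on functions -/

section MixedTensors

open ExteriorAlgebra TensorProduct

variable {E : Type*} [NormedAddCommGroup E] [NormedSpace ℝ E] [FiniteDimensional ℝ E]
  {M : Type*} [TopologicalSpace M] [ChartedSpace E M]
  {F : Type*} [NormedAddCommGroup F] [NormedSpace ℝ F] [FiniteDimensional ℝ F]

theorem contMDiffAt_tmul {j : ℕ} {a : M → E} {u : M → ⋀[ℝ]^j F} {x : M}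
    (ha : ContMDiffAt 𝓘(ℝ, E) 𝓘(ℝ, E) ∞ a x)
    (hu : SmoothExtAt E (fun y => (u y : ExteriorAlgebra ℝ F)) x)
    (φ : TensorProduct ℝ E (⋀[ℝ]^j F) →ₗ[ℝ] ℝ) :
    ContMDiffAt 𝓘(ℝ, E) 𝓘(ℝ, ℝ) ∞ (fun y => φ (a y ⊗ₜ[ℝ] u y)) x := by
  let e := Module.finBasis ℝ E
  let c := Module.finBasis ℝ (⋀[ℝ]^j F)
  obtain ⟨p, hp⟩ := LinearMap.exists_leftInverse_of_injective (⋀[ℝ]^j F).subtype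
    (Submodule.ker_subtype _)
  have key : ∀ y, φ (a y ⊗ₜ[ℝ] u y) = ∑ i, ∑ l,
      e.coord i (a y) * (c.coord l ∘ₗ p) (u y : ExteriorAlgebra ℝ F) * φ (e i ⊗ₜ c l) := by
    intro y
    have hpu : p (u y : ExteriorAlgebra ℝ F) = u y := LinearMap.congr_fun hp (u y)
    conv_lhs => rw [← e.sum_repr (a y), ← c.sum_repr (u y)]
    simp only [TensorProduct.sum_tmul, TensorProduct.tmul_sum, map_sum,
      TensorProduct.smul_tmul_smul, map_smul, smul_eq_mul, LinearMap.comp_apply, hpu,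
      Basis.coord_apply]
    exact Finset.sum_comm
  rw [show (fun y => φ (a y ⊗ₜ[ℝ] u y)) = _ from funext key]
  exact contMDiffAt_finsetSum fun i _ => contMDiffAt_finsetSum fun l _ =>
    (((e.coord i).toContinuousLinearMap.contMDiff.contMDiffAt.comp x ha).mul (hu _)).mul
      contMDiffAt_const

variable [IsManifold 𝓘(ℝ, E) ∞ M] [T2Space M]
  {A : M → Type*} [TopologicalSpace (TotalSpace F A)]
  [∀ x, AddCommGroup (A x)] [∀ x, Module ℝ (A x)] [∀ x, TopologicalSpace (A x)]
  [FiberBundle F A] [VectorBundle ℝ F A] [ContMDiffVectorBundle ∞ F A 𝓘(ℝ, E)]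

/-- Every covector is the differential of a function. -/
theorem exists_mvfderiv_eq (x : M) (ξ : TangentSpace 𝓘(ℝ, E) x →ₗ[ℝ] ℝ) :
    ∃ f : Fn E M, (mvfderiv 𝓘(ℝ, E) f x).toLinearMap = ξ := by
  obtain ⟨q, X, hX, -⟩ := exists_coordinates (E := E) x
  refine ⟨∑ j, ξ (X j x) • q j, LinearMap.ext fun v => ?_⟩
  obtain ⟨D, -, hD⟩ := isPtDer_mvfderiv (E := E) x v
  change mvfderiv 𝓘(ℝ, E) (∑ j, ξ (X j x) • q j : Fn E M) x v = ξ v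
  conv_rhs => rw [hX.self_of_nhds v]
  rw [← hD, map_sum, map_sum]
  refine Finset.sum_congr rfl fun j _ => ?_
  rw [map_smul, map_smul, hD, smul_eq_mul, smul_eq_mul, mul_comm]

theorem mem_multi_of_eventually {P : Π x, ExteriorAlgebra ℝ (A x)}
    (h : ∀ x, ∃ Q : Multi E F A, ∀ᶠ y in 𝓝 x, P y = Q.1 y) : P ∈ Multi E F A := by
  intro x φ
  obtain ⟨Q, hQ⟩ := h x
  refine (Q.2 x φ).congr_of_eventuallyEq ?_
  filter_upwards [hQ] with y hy
  rw [hy]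

/-- A derivation on functions with values in `Γ(∧ʲA)` is the contraction of differentials with a
section of `TM ⊗ ∧ʲA`. -/
theorem exists_mixed {j : ℕ} (d0 : Fn E M →ₗ[ℝ] Multi E F A)
    (h1 : ∀ f g, d0 (f * g) = ofFn f * d0 g + ofFn g * d0 f) (hj : ∀ f, IsHomog j (d0 f)) :
    ∃ t : Mixed E F A j, ∀ (f : Fn E M) (x : M),
      contract (mvfderiv 𝓘(ℝ, E) f x).toLinearMap j (t.toFun x) = (d0 f).1 x := by
  have h : ∀ x : M, ∃ t : TensorProduct ℝ (TangentSpace 𝓘(ℝ, E) x) (⋀[ℝ]^j (A x)),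
      ∀ f : Fn E M, contract (mvfderiv 𝓘(ℝ, E) f x).toLinearMap j t = (d0 f).1 x := by
    intro x
    obtain ⟨q, X, hX, hf⟩ := exists_coordinates (E := E) x
    refine ⟨∑ i, X i x ⊗ₜ ⟨(d0 (q i)).1 x, hj (q i) x⟩, fun f => ?_⟩
    have hD : IsPtDer x ((evalAt E A x).toLinearMap ∘ₗ d0) := fun f g => by
      change (d0 (f * g)).1 x = f x • (d0 g).1 x + g x • (d0 f).1 x
      rw [h1, multi_add_apply, ← fn_smul_eq, ← fn_smul_eq, fn_smul_apply, fn_smul_apply]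
    obtain ⟨g, hg1, hg2⟩ := hf f
    have h2 := hD.eq_sum hg2
    rw [map_sum]
    refine Eq.trans (Finset.sum_congr rfl fun i _ => ?_) h2.symm
    rw [contract_tmul, hg1]
    rfl
  choose t ht using h
  refine ⟨⟨t, fun x₀ φ => ?_⟩, fun f x => ht x f⟩
  obtain ⟨q, X, hX, -⟩ := exists_coordinates (E := E) x₀
  let e := trivializationAt E (fun x : M => TangentSpace 𝓘(ℝ, E) x) x₀
  let e' := trivializationAt F A x₀
  have hloc : ∀ᶠ y in 𝓝 x₀, t y = ∑ i, X i y ⊗ₜ ⟨(d0 (q i)).1 y, hj (q i) y⟩ := by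
    filter_upwards [hX] with y hy
    have : FiniteDimensional ℝ (TangentSpace 𝓘(ℝ, E) y) := inferInstanceAs (FiniteDimensional ℝ E)
    refine tensor_ext fun ξ => ?_
    rw [contract_eq_sum _ _ hy, map_sum]
    refine Finset.sum_congr rfl fun i _ => ?_
    rw [contract_tmul]
    congr 1
    exact ht y (q i)
  have hsm : ContMDiffAt 𝓘(ℝ, E) 𝓘(ℝ, ℝ) ∞ (fun y => ∑ i, φ ((e ⟨y, X i y⟩).2 ⊗ₜ[ℝ]
      exteriorPower.map j (e'.linearMapAt ℝ y) ⟨(d0 (q i)).1 y, hj (q i) y⟩)) x₀ := by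
    refine contMDiffAt_finsetSum fun i _ => contMDiffAt_tmul
      ((Bundle.contMDiffAt_section x₀).1 ((X i).contMDiff x₀)) (fun ψ => ?_) φ
    simp only [coe_exteriorPower_map]
    exact (d0 (q i)).2 x₀ ψ
  refine hsm.congr_of_eventuallyEq ?_
  filter_upwards [hloc, e.open_baseSet.mem_nhds (FiberBundle.mem_baseSet_trivializationAt E
    (fun x : M => TangentSpace 𝓘(ℝ, E) x) x₀)] with y hy hy'
  rw [hy, map_sum, map_sum]
  refine Finset.sum_congr rfl fun i _ => ?_
  rw [TensorProduct.map_tmul, Trivialization.linearMapAt_apply, if_pos hy']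

theorem contract_mem_multi {j : ℕ} (t : Mixed E F A j) (f : Fn E M) :
    (fun x => contract (mvfderiv 𝓘(ℝ, E) f x).toLinearMap j (t.toFun x)) ∈ Multi E F A := by
  intro x₀ φ
  let b := Module.finBasis ℝ E
  let e := trivializationAt E (fun x : M => TangentSpace 𝓘(ℝ, E) x) x₀
  let e' := trivializationAt F A x₀
  let X : Fin (finrank ℝ E) → Vect E M := fun i =>
    constSec E (fun x : M => TangentSpace 𝓘(ℝ, E) x) x₀ (b i)
  let θ : ∀ y : M, TensorProduct ℝ E (⋀[ℝ]^j F) := fun y =>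
    TensorProduct.map (e.linearMapAt ℝ y) (exteriorPower.map j (e'.linearMapAt ℝ y)) (t.toFun y)
  let ψ : Fin (finrank ℝ E) → TensorProduct ℝ E (⋀[ℝ]^j F) →ₗ[ℝ] ℝ := fun i =>
    φ ∘ₗ (⋀[ℝ]^j F).subtype ∘ₗ (TensorProduct.lid ℝ (⋀[ℝ]^j F)).toLinearMap ∘ₗ
      TensorProduct.map (b.coord i) LinearMap.id
  have hsm : ContMDiffAt 𝓘(ℝ, E) 𝓘(ℝ, ℝ) ∞ (fun y => ∑ i, der (X i) f y * ψ i (θ y)) x₀ :=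
    contMDiffAt_finsetSum fun i _ => (der (X i) f).contMDiff.contMDiffAt.mul (t.smooth x₀ (ψ i))
  refine hsm.congr_of_eventuallyEq ?_
  filter_upwards [eventually_triv (E := E) (F := E)
    (A := fun x : M => TangentSpace 𝓘(ℝ, E) x) x₀] with y hy
  have h1 : (mvfderiv 𝓘(ℝ, E) f y).toLinearMap =
      ((mvfderiv 𝓘(ℝ, E) f y).toLinearMap ∘ₗ e.symmₗ ℝ y) ∘ₗ e.linearMapAt ℝ y := by
    refine LinearMap.ext fun v => ?_
    rw [LinearMap.comp_apply, LinearMap.comp_apply, e.symmₗ_linearMapAt hy.1]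
  rw [h1, ← contract_map]
  change φ (TensorProduct.lid ℝ (⋀[ℝ]^j F) (TensorProduct.map _ LinearMap.id (θ y)) :
    ExteriorAlgebra ℝ F) = _
  conv_lhs => rw [tensor_eq_sum b (θ y)]
  simp only [map_sum, TensorProduct.map_tmul, TensorProduct.lid_tmul, Submodule.coe_sum,
    Submodule.coe_smul, map_smul, smul_eq_mul, LinearMap.id_apply]
  refine Finset.sum_congr rfl fun i _ => ?_
  congr 1
  change mvfderiv 𝓘(ℝ, E) f y (e.symmₗ ℝ y (b i)) = mvfderiv 𝓘(ℝ, E) f y (X i y)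
  rw [show X i y = e.symmₗ ℝ y (b i) by rw [constSec_apply, hy.2, one_smul]]

/-- The derivation `f ↦ ι_{df} t` on functions. -/
def contractHom {j : ℕ} (t : Mixed E F A j) : Fn E M →ₗ[ℝ] Multi E F A where
  toFun f := ⟨_, contract_mem_multi t f⟩
  map_add' f g := multi_ext fun x => by
    change contract (mvfderiv 𝓘(ℝ, E) (f + g : Fn E M) x).toLinearMap j (t.toFun x) =
      contract _ j (t.toFun x) + contract _ j (t.toFun x)
    rw [← contract_add]
    refine congrArg (fun ξ => contract ξ j (t.toFun x)) (LinearMap.ext fun v => ?_)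
    obtain ⟨D, -, hD⟩ := isPtDer_mvfderiv (E := E) x v
    exact (hD _).symm.trans ((map_add D f g).trans (congrArg₂ (· + ·) (hD f) (hD g)))
  map_smul' r f := multi_ext fun x => by
    change contract (mvfderiv 𝓘(ℝ, E) (r • f : Fn E M) x).toLinearMap j (t.toFun x) =
      r • contract _ j (t.toFun x)
    rw [← contract_smul]
    refine congrArg (fun ξ => contract ξ j (t.toFun x)) (LinearMap.ext fun v => ?_)
    obtain ⟨D, -, hD⟩ := isPtDer_mvfderiv (E := E) x v
    exact (hD _).symm.trans ((map_smul D r f).trans (congrArg (r • ·) (hD f)))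

theorem contractHom_apply {j : ℕ} (t : Mixed E F A j) (f : Fn E M) (x : M) :
    (contractHom t f).1 x = contract (mvfderiv 𝓘(ℝ, E) f x).toLinearMap j (t.toFun x) := rfl

theorem isHomog_contractHom {j : ℕ} (t : Mixed E F A j) (f : Fn E M) :
    IsHomog j (contractHom t f) := fun _ => contract_mem _ _ _

theorem contractHom_mul {j : ℕ} (t : Mixed E F A j) (f g : Fn E M) :
    contractHom t (f * g) = ofFn f * contractHom t g + ofFn g * contractHom t f := by
  refine multi_ext fun x => ?_
  rw [← fn_smul_eq, ← fn_smul_eq, multi_add_apply, fn_smul_apply, fn_smul_apply]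
  simp only [contractHom_apply]
  rw [← contract_smul, ← contract_smul, ← contract_add]
  refine congrArg (fun ξ => contract ξ j (t.toFun x)) (LinearMap.ext fun v => ?_)
  obtain ⟨D, h, hD⟩ := isPtDer_mvfderiv (E := E) x v
  exact (hD _).symm.trans ((h f g).trans
    (congrArg₂ (· + ·) (congrArg (f x • ·) (hD g)) (congrArg (g x • ·) (hD f))))

/-- A section of `TM ⊗ ∧ʲA` is determined by its contractions with differentials. -/
theorem mixed_ext {j : ℕ} {t t' : Mixed E F A j} (h : contractHom t = contractHom t') :
    t = t' := by
  have h1 : t.toFun = t'.toFun := funext fun x => by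
    have : FiniteDimensional ℝ (TangentSpace 𝓘(ℝ, E) x) := inferInstanceAs (FiniteDimensional ℝ E)
    refine tensor_ext fun ξ => ?_
    obtain ⟨f, rfl⟩ := exists_mvfderiv_eq x ξ
    exact congrArg (fun P : Multi E F A => P.1 x) (LinearMap.congr_fun h f)
  cases t
  cases t'
  congr

theorem fiber_add (H K : Vect E M →ₗ[Fn E M] Sec E F A) (x : M) :
    fiber (H + K) x = fiber H x + fiber K x := by
  refine LinearMap.ext fun v => ?_
  obtain ⟨X, rfl⟩ := exists_sec (E := E) (F := E) (V := fun x : M => TangentSpace 𝓘(ℝ, E) x) x v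
  rw [LinearMap.add_apply, fiber_apply, fiber_apply, fiber_apply]
  rfl

theorem fiber_smul (f : Fn E M) (H : Vect E M →ₗ[Fn E M] Sec E F A) (x : M) :
    fiber (f • H) x = f x • fiber H x := by
  refine LinearMap.ext fun v => ?_
  obtain ⟨X, rfl⟩ := exists_sec (E := E) (F := E) (V := fun x : M => TangentSpace 𝓘(ℝ, E) x) x v
  rw [LinearMap.smul_apply, fiber_apply, fiber_apply]
  rfl

theorem fiber_dTensor (f : Fn E M) (u : Sec E F A) (x : M) :
    fiber (dTensor f u) x = (mvfderiv 𝓘(ℝ, E) f x).toLinearMap.smulRight (u x) := by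
  refine LinearMap.ext fun v => ?_
  obtain ⟨X, rfl⟩ := exists_sec (E := E) (F := E) (V := fun x : M => TangentSpace 𝓘(ℝ, E) x) x v
  exact fiber_apply (dTensor f u) X x

theorem homWedge_mem_multi {j : ℕ} (t : Mixed E F A j) (H : Vect E M →ₗ[Fn E M] Sec E F A) :
    (fun x => homWedge (fiber H x) j (t.toFun x)) ∈ Multi E F A := by
  refine mem_multi_of_eventually fun x => ?_
  obtain ⟨q, X, hX, -⟩ := exists_coordinates (E := E) x
  refine ⟨∑ i, ofSec (H (X i)) * contractHom t (q i), ?_⟩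
  filter_upwards [hX] with y hy
  rw [homWedge_eq_sum (fun i => (mvfderiv 𝓘(ℝ, E) (q i) y).toLinearMap) (fun i => X i y) hy,
    ← evalAt_apply y (∑ i, _), map_sum]
  refine Finset.sum_congr rfl fun i _ => ?_
  rw [fiber_apply]
  rfl

/-- The bundle map `μ_t : H ↦ (H ⊗ id) t` from `Hom(TM, A)` to `∧A`. -/
def muHom {j : ℕ} (t : Mixed E F A j) :
    (Vect E M →ₗ[Fn E M] Sec E F A) →ₗ[Fn E M] Multi E F A where
  toFun H := ⟨_, homWedge_mem_multi t H⟩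
  map_add' H K := multi_ext fun x => by
    change homWedge (fiber (H + K) x) j (t.toFun x) = _
    rw [fiber_add, homWedge_add]
    rfl
  map_smul' f H := multi_ext fun x => by
    change homWedge (fiber (f • H) x) j (t.toFun x) = _
    rw [fiber_smul, homWedge_smul, RingHom.id_apply, fn_smul_apply]

theorem muHom_apply {j : ℕ} (t : Mixed E F A j) (H : Vect E M →ₗ[Fn E M] Sec E F A) (x : M) :
    (muHom t H).1 x = homWedge (fiber H x) j (t.toFun x) := rfl

theorem isHomog_muHom {j : ℕ} (t : Mixed E F A j) (H : Vect E M →ₗ[Fn E M] Sec E F A) :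
    IsHomog (j + 1) (muHom t H) := fun _ => homWedge_mem _ _ _

theorem muHom_dTensor {j : ℕ} (t : Mixed E F A j) (f : Fn E M) (u : Sec E F A) :
    muHom t (dTensor f u) = (-1 : ℝ) ^ j • contractHom t f * ofSec u := by
  refine multi_ext fun x => ?_
  rw [muHom_apply, fiber_dTensor, homWedge_smulRight, ← contractHom_apply, ← ofSec_apply,
    ← multi_mul_apply, (isPar_ofSec u).mul_comm' (isHomog_contractHom t f).isPar, one_mul,
    smul_mul_assoc]

end MixedTensors

namespace LieAlgebroid

open ExteriorAlgebra

/-! ### Differentials and characteristic pairs -/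

section Correspondence

variable {E : Type*} [NormedAddCommGroup E] [NormedSpace ℝ E] [FiniteDimensional ℝ E]
  {M : Type*} [TopologicalSpace M] [ChartedSpace E M] [IsManifold 𝓘(ℝ, E) ∞ M] [T2Space M]
  {F : Type*} [NormedAddCommGroup F] [NormedSpace ℝ F] [FiniteDimensional ℝ F]
  {A : M → Type*} [TopologicalSpace (TotalSpace F A)]
  [∀ x, AddCommGroup (A x)] [∀ x, Module ℝ (A x)] [∀ x, TopologicalSpace (A x)]
  [FiberBundle F A] [VectorBundle ℝ F A] [ContMDiffVectorBundle ∞ F A 𝓘(ℝ, E)]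
  {𝓐 : LieAlgebroid E F A} {k : ℕ}

theorem Differential.isGDer (hk : 1 ≤ k) (δ : 𝓐.Differential k) : IsGDer (k - 1) δ.toFun := by
  refine isGDer_of_leib (leib_of_homog fun p P Q hP => δ.derivation p P Q hP)
    (fun f => (δ.homog 0 _ (isHomog_ofFn f)).isPar.congr ⟨k - 1, by omega⟩)
    fun u => (δ.homog 1 _ (isHomog_ofSec u)).isPar.congr ⟨k, by omega⟩

theorem Differential.ext_of (hk : 1 ≤ k) {δ δ' : 𝓐.Differential k}
    (hf : ∀ f, δ.toFun (ofFn f) = δ'.toFun (ofFn f))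
    (hu : ∀ u, δ.toFun (ofSec u) = δ'.toFun (ofSec u)) : δ = δ' := by
  have h := (δ.isGDer hk).ext (δ'.isGDer hk) hf hu
  cases δ
  cases δ'
  congr

theorem Differential.defect_eq_zero (δ : 𝓐.Differential k) {p : ℕ} {P : Multi E F A}
    (hP : IsHomog p P) (Q : Multi E F A) : 𝓐.defect (k - 1) δ.toFun p P Q = 0 := by
  rw [defect_apply, δ.schouten p P Q hP]
  abel

theorem corresponds_iff {δ : 𝓐.Differential k} {c : 𝓐.CharPair k} : Corresponds δ c ↔
    (∀ u, δ.toFun (ofSec u) = c.chi (JetSec.j1 u)) ∧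
      ∀ f, δ.toFun (ofFn f) = (-1 : ℝ) ^ (k - 1) • contractHom c.tensor f :=
  and_congr_right fun _ => forall_congr' fun _ =>
    ⟨fun h => multi_ext h, fun h x => congrArg (fun P : Multi E F A => P.1 x) h⟩

theorem Corresponds.left_unique (hk : 1 ≤ k) {δ δ' : 𝓐.Differential k} {c : 𝓐.CharPair k}
    (h : Corresponds δ c) (h' : Corresponds δ' c) : δ = δ' := by
  rw [corresponds_iff] at h h'
  exact Differential.ext_of hk (fun f => by rw [h.2, h'.2]) fun u => by rw [h.1, h'.1]

theorem Corresponds.right_unique {δ : 𝓐.Differential k} {c c' : 𝓐.CharPair k}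
    (h : Corresponds δ c) (h' : Corresponds δ c') : c = c' := by
  rw [corresponds_iff] at h h'
  have h1 : c.chi = c'.chi := sub_eq_zero.1 (JetSec.eq_zero_of_j1 fun u => by
    rw [LinearMap.sub_apply, ← h.1, ← h'.1, sub_self])
  have h2 : c.tensor = c'.tensor := mixed_ext (LinearMap.ext fun f =>
    smul_right_injective _ (pow_ne_zero (k - 1) (neg_ne_zero.2 (one_ne_zero (α := ℝ))))
      ((h.2 f).symm.trans (h'.2 f)))
  cases c
  cases c'
  congr

/-- The compatibility of `π` is the compatibility of `δ` with the brackets of functions. -/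
theorem isCompatible_iff {j : ℕ} (t : Mixed E F A j) : 𝓐.IsCompatible t ↔
    ∀ f g, 𝓐.fnOp f (contractHom t g) + 𝓐.fnOp g (contractHom t f) = 0 := by
  have h : ∀ f g x, (𝓐.fnOp f (contractHom t g) + 𝓐.fnOp g (contractHom t f)).1 x =
      -(ctr ((mvfderiv 𝓘(ℝ, E) f x).toLinearMap ∘ₗ 𝓐.rho x)
        (contract (mvfderiv 𝓘(ℝ, E) g x).toLinearMap j (t.toFun x)) +
      ctr ((mvfderiv 𝓘(ℝ, E) g x).toLinearMap ∘ₗ 𝓐.rho x)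
        (contract (mvfderiv 𝓘(ℝ, E) f x).toLinearMap j (t.toFun x))) := fun f g x => by
    rw [multi_add_apply, fnOp_apply, fnOp_apply, neg_add]
    rfl
  constructor
  · intro ht f g
    refine multi_ext fun x => ?_
    rw [h, multi_zero_apply, neg_eq_zero, ← eq_neg_iff_add_eq_zero]
    exact ht x _ _
  · intro ht x ξ η
    obtain ⟨f, rfl⟩ := exists_mvfderiv_eq x ξ
    obtain ⟨g, rfl⟩ := exists_mvfderiv_eq x η
    have h1 := congrArg (fun P : Multi E F A => P.1 x) (ht f g)
    simp only [h] at h1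
    exact eq_neg_iff_add_eq_zero.2 (neg_eq_zero.1 h1)

/-- The operators on functions and sections given by a characteristic pair satisfy the Leibniz rules
because `χ` restricts to `μ_π`, so they extend to a graded derivation. Its compatibility with
brackets of sections is the cocycle condition on jet prolongations, and that with brackets of
functions is the compatibility of `π`. -/
theorem exists_differential (hk : 1 ≤ k) (hk' : k ≤ finrank ℝ F) (c : 𝓐.CharPair k) :
    ∃ δ : 𝓐.Differential k, Corresponds δ c := by
  let d0 : Fn E M →ₗ[ℝ] Multi E F A := (-1 : ℝ) ^ (k - 1) • contractHom c.tensor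
  let d1 : Sec E F A →ₗ[ℝ] Multi E F A :=
    { toFun := fun u => c.chi (JetSec.j1 u)
      map_add' := fun u v => by rw [JetSec.j1_add, map_add]
      map_smul' := fun r u => by
        have h1 : (JetSec.j1 (r • u) : JetSec E F A) = (r • (1 : Fn E M)) • JetSec.j1 u := by
          refine JetSec.ext' ?_ fun X => ?_
          · rw [JetSec.base_smul, smul_assoc, one_smul]; rfl
          · rw [JetSec.hom_smul, der_smul, der_one, smul_zero, zero_smul, sub_zero]
            exact (smul_zero _).symm
        rw [h1, map_smul, RingHom.id_apply]
        refine multi_ext fun x => ?_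
        rw [fn_smul_apply, multi_real_smul_apply, ContMDiffMap.coe_smul, Pi.smul_apply,
          ContMDiffMap.coe_one, Pi.one_apply, smul_eq_mul, mul_one] }
  have hd0 : ∀ f, IsHomog (k - 1) (d0 f) := fun f => (isHomog_contractHom c.tensor f).smul _
  have hd1 : ∀ u, IsHomog k (d1 u) := fun u => c.homog _
  have h1 : ∀ f g, d0 (f * g) = ofFn f * d0 g + ofFn g * d0 f := fun f g => by
    change (-1 : ℝ) ^ (k - 1) • contractHom c.tensor (f * g) =
      ofFn f * (-1 : ℝ) ^ (k - 1) • contractHom c.tensor g +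
        ofFn g * (-1 : ℝ) ^ (k - 1) • contractHom c.tensor f
    rw [contractHom_mul, smul_add, mul_smul_comm, mul_smul_comm]
  have h2 : ∀ f u, d1 (f • u) = d0 f * ofSec u + ofFn f * d1 u := fun f u => by
    change c.chi (JetSec.j1 (f • u)) = _
    rw [JetSec.j1_smul, map_add, map_smul]
    rw [show c.chi (JetSec.ofHom (dTensor f u)) = muHom c.tensor (dTensor f u) from
      multi_ext (c.restrict _), muHom_dTensor]
    rfl
  obtain ⟨δ, hδ, hf, hu⟩ := exists_isGDer (s := k - 1) h1 h2 (fun f => (hd0 f).isPar)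
    fun u => (hd1 u).isPar.congr ⟨k, by omega⟩
  have hhom : ∀ p P, IsHomog p P → IsHomog (p + k - 1) (δ P) := fun p P hP => by
    refine isHomog_of_euler ?_
    rw [hδ.euler (k - 1 : ℕ) (fun f => ?_) (fun u => ?_) hP]
    · rw [Nat.add_sub_assoc hk, Nat.cast_add]
    · rw [hf, (hd0 f).euler]
    · rw [hu, (hd1 u).euler, ← Nat.cast_succ, Nat.succ_eq_add_one, Nat.sub_add_cancel hk]
  have huu : ∀ u v, 𝓐.defect (k - 1) δ 1 (ofSec u) (ofSec v) = 0 := fun u v => by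
    have h3 : (c.chi (JetSec.j1 (𝓐.bracket u v)) : Multi E F A) =
        𝓐.secOp u (c.chi (JetSec.j1 v)) - 𝓐.secOp v (c.chi (JetSec.j1 u)) := by
      refine multi_ext fun x => ?_
      rw [← jetBracket_j1, c.cocycle, ad_eq, ad_eq, adM_j1, adM_j1]
      rfl
    rw [defect_apply, schouten_ofSec, secOp_ofSec, 𝓐.isParBracket_schouten.sec, hu, hu, hu,
      ((show Even (1 + 1) from ⟨1, rfl⟩).mul_left (k - 1)).neg_one_pow, one_smul]
    change c.chi (JetSec.j1 (𝓐.bracket u v)) - 𝓐.secOp u (c.chi (JetSec.j1 v)) -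
      -𝓐.secOp v (c.chi (JetSec.j1 u)) = 0
    rw [h3]
    abel
  have huf := 𝓐.defect_sec_fn hk hk' hδ (fun f => by rw [hf]; exact hd0 f)
    (fun u => by rw [hu]; exact hd1 u) huu
  have hff : ∀ f g, 𝓐.defect (k - 1) δ 0 (ofFn f) (ofFn g) = 0 := fun f g => by
    rw [𝓐.defect_fn_fn hδ, hf, hf]
    change -((-1 : ℝ) ^ (k - 1) • (𝓐.fnOp f ((-1 : ℝ) ^ (k - 1) • contractHom c.tensor g) +
      𝓐.fnOp g ((-1 : ℝ) ^ (k - 1) • contractHom c.tensor f))) = 0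
    rw [map_smul, map_smul, ← smul_add, (isCompatible_iff c.tensor).1 c.compatible, smul_zero,
      smul_zero, neg_zero]
  refine ⟨⟨δ, hhom, fun p P Q hP => ?_, fun p P Q hP => ?_⟩, corresponds_iff.2 ⟨hu, hf⟩⟩
  · rw [hδ.leib, hP.isPar.twistM, smul_mul_assoc]
  · have h3 := LinearMap.congr_fun (𝓐.defect_eq_zero hδ hff huf huu hP.isPar) Q
    rw [defect_apply, LinearMap.zero_apply, sub_sub, sub_eq_zero] at h3
    rw [h3, add_comm]

/-- The tensor `π` is found from the derivation `δ` on functions, and `χ` is `δ` on jet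
prolongations and `μ_π` on `𝔥`. -/
theorem exists_charPair (hk : 1 ≤ k) (δ : 𝓐.Differential k) :
    ∃ c : 𝓐.CharPair k, Corresponds δ c := by
  have hδ := δ.isGDer hk
  have hf : ∀ f, IsHomog (k - 1) (δ.toFun (ofFn f)) := fun f => by
    simpa using δ.homog 0 _ (isHomog_ofFn f)
  have hu : ∀ u, IsHomog k (δ.toFun (ofSec u)) := fun u => by
    simpa using δ.homog 1 _ (isHomog_ofSec u)
  have hsq : (-1 : ℝ) ^ (k - 1) * (-1) ^ (k - 1) = 1 := by rw [← mul_pow]; simp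
  obtain ⟨t, ht⟩ := exists_mixed ((-1 : ℝ) ^ (k - 1) • (δ.toFun ∘ₗ ofFnR)) (fun f g => by
    change (-1 : ℝ) ^ (k - 1) • δ.toFun (ofFn (f * g)) =
      ofFn f * (-1 : ℝ) ^ (k - 1) • δ.toFun (ofFn g) +
        ofFn g * (-1 : ℝ) ^ (k - 1) • δ.toFun (ofFn f)
    rw [map_mul, hδ.leib, twistM_ofFn, ← ofFn_mul_comm, smul_add, mul_smul_comm, mul_smul_comm,
      add_comm]) (fun f => (hf f).smul _)
  have ht' : ∀ f, contractHom t f = (-1 : ℝ) ^ (k - 1) • δ.toFun (ofFn f) := fun f =>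
    multi_ext fun x => ht f x
  have ht'' : ∀ f, δ.toFun (ofFn f) = (-1 : ℝ) ^ (k - 1) • contractHom t f := fun f => by
    rw [ht', smul_smul, hsq, one_smul]
  have hμ : ∀ f u, muHom t (dTensor f u) = δ.toFun (ofFn f) * ofSec u := fun f u => by
    rw [muHom_dTensor, ← ht'']
  let χ : JetSec E F A →ₗ[Fn E M] Multi E F A :=
    { toFun := fun ξ => δ.toFun (ofSec ξ.base) + muHom t ξ.hom
      map_add' := fun ξ η => by
        change δ.toFun (ofSec (ξ.base + η.base)) + muHom t (ξ.hom + η.hom) = _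
        simp only [map_add]
        abel
      map_smul' := fun f ξ => by
        change δ.toFun (ofSec (f • ξ.base)) + muHom t (f • ξ.hom - dTensor f ξ.base) = _
        rw [map_sub, hμ, map_smul (muHom t), ofSec_fn_smul, hδ.leib, twistM_ofFn, RingHom.id_apply,
          smul_add, fn_smul_eq, fn_smul_eq]
        abel }
  have hχ : ∀ ξ, χ ξ = δ.toFun (ofSec ξ.base) + muHom t ξ.hom := fun ξ => rfl
  have hχj : ∀ u, χ (JetSec.j1 u) = δ.toFun (ofSec u) := fun u => by
    rw [hχ, JetSec.hom_j1, map_zero, add_zero]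
    rfl
  have hχh : ∀ H, χ (JetSec.ofHom H) = muHom t H := fun H => by
    rw [hχ]
    change δ.toFun (ofSec 0) + muHom t H = muHom t H
    rw [map_zero, map_zero, zero_add]
  refine ⟨⟨χ, fun ξ x => ?_, fun ξ η x => ?_, t, ?_, fun H x => ?_⟩, corresponds_iff.2
    ⟨fun u => (hχj u).symm, ht''⟩⟩
  · rw [hχ]
    refine add_mem (hu _ x) ?_
    have := isHomog_muHom t ξ.hom x
    rwa [Nat.sub_add_cancel hk] at this
  · rw [ad_eq, ad_eq, ← multi_sub_apply, cocycle_of_j1]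
    intro u v
    rw [hχj, hχj, hχj]
    have h3 := δ.defect_eq_zero (isHomog_ofSec u) (ofSec v)
    rw [defect_apply, schouten_ofSec, secOp_ofSec, 𝓐.isParBracket_schouten.sec,
      ((show Even (1 + 1) from ⟨1, rfl⟩).mul_left (k - 1)).neg_one_pow, one_smul] at h3
    rw [← sub_eq_zero, ← h3]
    abel
  · rw [isCompatible_iff]
    intro f g
    have h3 := δ.defect_eq_zero (isHomog_ofFn f) (ofFn g)
    rw [𝓐.defect_fn_fn hδ, ht'', ht'', map_smul, map_smul, ← smul_add, smul_smul, hsq, one_smul,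
      neg_eq_zero] at h3
    exact h3
  · rw [hχh, muHom_apply]

/-- By the Jacobi identity, `[τ, ·]` is a differential. -/
theorem exists_inner_differential (hk : 1 ≤ k) {τ : Multi E F A} (hτ : IsHomog k τ) :
    ∃ δ : 𝓐.Differential k, ∀ P, δ.toFun P = 𝓐.schouten τ P := by
  have h := 𝓐.isSchouten_schouten
  have hs : ∀ p : ℕ, (-1 : ℝ) ^ ((k - 1) * p) = (-1) ^ ((k + 1) * p) := fun p => by
    obtain ⟨m, rfl⟩ := Nat.exists_eq_add_of_le hk
    refine neg_one_pow_congr ?_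
    simp [parity_simps]
  refine ⟨⟨𝓐.schouten τ, fun p P hP => h.homog k p _ _ _ hτ hP (by omega), fun p P Q hP => ?_,
    fun p P Q hP => ?_⟩, fun P => rfl⟩
  · rw [h.leibniz k p τ P Q hτ hP, mul_comm p, hs]
  · have h3 := LinearMap.congr_fun (𝓐.defect_schouten hτ.isPar hP.isPar) Q
    rw [defect_apply, LinearMap.zero_apply, sub_sub, sub_eq_zero] at h3
    rw [h3, hs, add_comm]

/-- For `δ = [τ, ·]` the bundle map `χ` is `-d_{𝔍A} τ`: both agree on jet prolongations. -/
theorem chi_of_inner {τ : Multi E F A} {δ : 𝓐.Differential k} {c : 𝓐.CharPair k}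
    (h : Corresponds δ c) (hδ : ∀ P, δ.toFun P = 𝓐.schouten τ P) (ξ : JetSec E F A) (x : M) :
    (c.chi ξ).1 x = -𝓐.ad ξ τ x := by
  let T : JetSec E F A →ₗ[Fn E M] Multi E F A :=
    { toFun := fun ξ => c.chi ξ + 𝓐.adM ξ τ
      map_add' := fun ξ η => by
        rw [map_add, adM_add, LinearMap.add_apply]
        abel
      map_smul' := fun f ξ => by rw [map_smul, adM_smul, RingHom.id_apply, smul_add] }
  have h1 : T = 0 := JetSec.eq_zero_of_j1 fun u => by
    change c.chi (JetSec.j1 u) + 𝓐.adM (JetSec.j1 u) τ = 0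
    rw [← h.1, hδ, 𝓐.isParBracket_schouten.sec, adM_j1, neg_add_cancel]
  have h2 : c.chi ξ + 𝓐.adM ξ τ = 0 := LinearMap.congr_fun h1 ξ
  rw [ad_eq, eq_neg_of_add_eq_zero_left h2]
  rfl

/-- For `δ = [τ, ·]` the tensor `π` is `D_ρ τ`: the contraction of either with `df` is the
contraction of `τ` with `ρ* df`. -/
theorem tensor_of_inner (hk : 1 ≤ k) {τ : Multi E F A} (hτ : IsHomog k τ) {δ : 𝓐.Differential k}
    {c : 𝓐.CharPair k} (h : Corresponds δ c) (hδ : ∀ P, δ.toFun P = 𝓐.schouten τ P) (x : M) :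
    mixedIncl (TangentSpace 𝓘(ℝ, E) x) (A x) (k - 1) (c.tensor.toFun x) =
      dRho (𝓐.rho x) (ExteriorAlgebra.map (LinearMap.inr ℝ _ _) (τ.1 x)) := by
  have : FiniteDimensional ℝ (TangentSpace 𝓘(ℝ, E) x) := inferInstanceAs (FiniteDimensional ℝ E)
  refine mixedIncl_eq_dRho _ _ _ fun ξ => ?_
  obtain ⟨f, rfl⟩ := exists_mvfderiv_eq x ξ
  have h1 := h.2 f x
  rw [hδ, 𝓐.isParBracket_schouten.fn k τ f hτ.isPar, multi_real_smul_apply, fnOp_apply] at h1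
  have h2 : (-1 : ℝ) ^ k = -(-1) ^ (k - 1) := by
    obtain ⟨m, rfl⟩ := Nat.exists_eq_add_of_le hk
    rw [Nat.add_sub_cancel_left, pow_add, pow_one, neg_one_mul]
  rw [h2, neg_smul, smul_neg, neg_neg] at h1
  exact (smul_right_injective _
    (pow_ne_zero (k - 1) (neg_ne_zero.2 (one_ne_zero (α := ℝ)))) h1).symm

end Correspondence

end LieAlgebroid

end LieAlgd

end

theorem proposition4p3
    {E : Type*} [NormedAddCommGroup E] [NormedSpace ℝ E] [FiniteDimensional ℝ E]
    {M : Type*} [TopologicalSpace M] [ChartedSpace E M] [IsManifold 𝓘(ℝ, E) ∞ M] [T2Space M]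
    {F : Type*} [NormedAddCommGroup F] [NormedSpace ℝ F] [FiniteDimensional ℝ F]
    {A : M → Type*} [TopologicalSpace (TotalSpace F A)]
    [∀ x, AddCommGroup (A x)] [∀ x, Module ℝ (A x)] [∀ x, TopologicalSpace (A x)]
    [FiberBundle F A] [VectorBundle ℝ F A] [ContMDiffVectorBundle ∞ F A 𝓘(ℝ, E)]
    (𝓐 : LieAlgd.LieAlgebroid E F A) (k : ℕ) (hk : 1 ≤ k) (hk' : k ≤ finrank ℝ F) :
    (∃! br, 𝓐.IsSchouten br) ∧
    ∃ Φ : 𝓐.Differential k ≃ 𝓐.CharPair k,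
      (∀ δ c, Φ δ = c ↔ LieAlgd.LieAlgebroid.Corresponds δ c) ∧
      ∀ τ : LieAlgd.Multi E F A, LieAlgd.IsHomog k τ →
        ∃ δ : 𝓐.Differential k, (∀ P, δ.toFun P = 𝓐.schouten τ P) ∧
          (∀ ξ x, ((Φ δ).chi ξ).1 x = -𝓐.ad ξ τ x) ∧
          ∀ x, LieAlgd.mixedIncl (TangentSpace 𝓘(ℝ, E) x) (A x) (k - 1) ((Φ δ).tensor.toFun x) =
            LieAlgd.dRho (𝓐.rho x) (ExteriorAlgebra.map (LinearMap.inr ℝ _ _) (τ.1 x)) := by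
  refine ⟨𝓐.existsUnique_isSchouten, ?_⟩
  choose Φ hΦ using fun δ : 𝓐.Differential k => LieAlgd.LieAlgebroid.exists_charPair hk δ
  choose Ψ hΨ using fun c : 𝓐.CharPair k => LieAlgd.LieAlgebroid.exists_differential hk hk' c
  refine ⟨⟨Φ, Ψ, fun δ => (hΨ (Φ δ)).left_unique hk (hΦ δ),
    fun c => (hΦ (Ψ c)).right_unique (hΨ c)⟩,
    fun δ c => ⟨fun h => h ▸ hΦ δ, fun h => (hΦ δ).right_unique h⟩, fun τ hτ => ?_⟩
  obtain ⟨δ, hδ⟩ := LieAlgd.LieAlgebroid.exists_inner_differential (𝓐 := 𝓐) hk hτ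
  exact ⟨δ, hδ, LieAlgd.LieAlgebroid.chi_of_inner (hΦ δ) hδ,
    LieAlgd.LieAlgebroid.tensor_of_inner hk hτ (hΦ δ) hδ⟩
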